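/- Let $n,r\ge 0$ be integers. For a commutative ring $R$ and $q\in R$, let $\mathcal H^{\mathsf c}_{r,R}$ be the Hecke--Clifford superalgebra: the associative $R$-superalgebra with even generators $T_1,\dots,T_{r-1}$ and odd generators $c_1,\dots,c_r$, subject to $c_i^2=-1$, $c_ic_j=-c_jc_i$ $(i\ne j)$, $(T_i-q)(T_i+1)=0$, $T_iT_j=T_jT_i$ $(|i-j|>1)$, $T_iT_{i+1}T_i=T_{i+1}T_iT_{i+1}$, $T_ic_j=c_jT_i$ $(j\neq i,i+1)$, $T_ic_i=c_{i+1}T_i$ and $T_ic_{i+1}=c_iT_i-(q-1)(c_i-c_{i+1})$. Let $\tau$ be its $R$-linear anti-involution ($\tau(hh')=\tau(h')\tau(h)$) with $\tau(T_i)=-T_i+(q-1)$, $\tau(c_j)=c_j$. Let $\Lambda(n,r)$ be the set of $\lambda\in\mathbb N^n$ with $\sum_i\lambda_i=r$; for $\lambda\in\Lambda(n,r)$ let $\mathfrak S_\lambda\le\mathfrak S_r$ be the standard Young subgroup and $x_\lambda=\sum_{w\in\mathfrak S_\lambda}T_w$, where $T_w=T_{i_1}\cdots T_{i_k}$ for a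 reduced expression $w=s_{i_1}\cdots s_{i_k}$. The Q-$q$-Schur superalgebra is $\mathcal Q_q(n,r;R)=\mathrm{End}_{\mathcal H^{\mathsf c}_{r,R}}\big(\bigoplus_{\lambda\in\Lambda(n,r)}x_\lambda\mathcal H^{\mathsf c}_{r,R}\big)$, the algebra of all endomorphisms of this right module. Let $v\in R$ be invertible and $q=v^2$. Let $V=V(n|n)_R$ be the free $R$-supermodule with even basis $e_1,\dots,e_n$ and odd basis $e_{-1},\dots,e_{-n}$; put $I=\{\pm1,\dots,\pm n\}\subset\mathbb Z$, $\hat j=0$ for $j>0$, $\hat j=1$ for $j<0$, and let $E_{i,j}$ $(i,j\in I)$ be the matrix units. Put $\Omega=\sum_{a=1}^n(E_{-a,a}-E_{a,-a})$, $T=\sum_{i,j\in I}(-1)^{\hat j}E_{i,j}\otimes E_{j,i}$ and $S=v\sum_{i\le j}S_{i,j}\otimes E_{i,j}$, where, for $1\le a,b\le n$, $$S_{a,a}=1+(v-1)(E_{a,a}+E_{-a,-a}),\qquad S_{-a,-a}=1+(v^{-1}-1)(E_{a,a}+E_{-a,-a}),$$ $$S_{b,a}=(v-v^{-1})(E_{a,b}+E_{-a,-b})\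 (b<a),\qquad S_{-b,-a}=-(v-v^{-1})(E_{a,b}+E_{-a,-b})\ (a<b),$$ $$S_{-b,a}=-(v-v^{-1})(E_{-a,b}+E_{a,-b}).$$ Let $\mathcal H^{\mathsf c}_{r,R}$ act on the left of $V^{\otimes r}$ by Olshanski's action: $T_k$ acts as $TS$ in the tensor positions $k,k+1$ and $c_j$ acts as $\Omega$ in position $j$, where operators are tensored by the super sign rule. Let $(V^{\otimes r})^\tau$ be the right module on $V^{\otimes r}$ with $m\cdot h=\tau(h)m$. Assume that the characteristic of $R$ is not $2$. Then there is an isomorphism of right $\mathcal H^{\mathsf c}_{r,R}$-supermodules $$\theta:(V^{\otimes r})^\tau\;\xrightarrow{\ \sim\ }\;\bigoplus_{\lambda\in\Lambda(n,r)}x_\lambda\mathcal H^{\mathsf c}_{r,R},$$ homogeneous of parity $r$ modulo $2$ (it preserves parity if $r$ is even and reverses it if $r$ is odd). It induces $R$-algebra isomorphisms $$\mathrm{End}_{\mathcal H^{\mathsf c}_{r,R}}(V^{\otimes r})\;\cong\;\mathrm{End}_{\mathcal H^{\mathsf c}_{r,R}}\big((V^{\otimes r})^\tau\big)\;\cong\;\mathcal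 Q_{v^2}(n,r;R),$$ the first being $f\mapsto f$ and the second $g\mapsto\theta g\theta^{-1}$, and the composite respects the $\mathbb Z_2$-gradings. Here $\mathrm{End}_{\mathcal H^{\mathsf c}_{r,R}}(V^{\otimes r})$ consists of all $R$-linear maps that commute (in the ordinary, unsigned sense) with the action. In particular, over $\mathcal Z=\mathbb Z[v,v^{-1}]$ with $v$ an indeterminate, the quantum queer Schur superalgebra $\mathrm{End}_{\mathcal H^{\mathsf c}_{r,\mathcal Z}}(V(n|n)_{\mathcal Z}^{\otimes r})$ is isomorphic, as a superalgebra, to the Q-$q$-Schur superalgebra $\mathcal Q_{v^2}(n,r;\mathcal Z)$. -/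

import Mathlib

set_option linter.unusedSimpArgs false

open scoped TensorProduct

namespace QqSchur

/-- Indices of the simple transpositions `s_i = (i, i+1)` of `{0, …, r-1}`. -/
abbrev SIdx (r : ℕ) : Type := {i : ℕ // i + 1 < r}

/-- The two points exchanged by `s_i`. -/
def SIdx.lo {r : ℕ} (s : SIdx r) : Fin r := ⟨s.1, by have := s.2; omega⟩
/-- The two points exchanged by `s_i`. -/
def SIdx.hi {r : ℕ} (s : SIdx r) : Fin r := ⟨s.1 + 1, s.2⟩

/-- The index set `I(n|n) = {1, …, n, -1, …, -n}`: `inl a` stands for `a + 1` and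
`inr a` for `-(a + 1)`. -/
abbrev Ix (n : ℕ) : Type := Fin n ⊕ Fin n

/-- The sign change `i ↦ -i`. -/
def Ix.neg {n : ℕ} : Ix n → Ix n
  | Sum.inl a => Sum.inr a
  | Sum.inr a => Sum.inl a

/-- The parity of the index `i`, which is `0` for `i > 0` and `1` for `i < 0`. -/
def Ix.par {n : ℕ} : Ix n → ℕ
  | Sum.inl _ => 0
  | Sum.inr _ => 1

section Operators

variable {R : Type*} [CommRing R] {n r : ℕ}

/-- The free supermodule `V(n|n)` with basis indexed by `I(n|n)`. -/
abbrev V (n : ℕ) (R : Type*) [CommRing R] : Type _ := Ix n → R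

/-- The basis vector `e_i` of `V(n|n)`. -/
def e1 (R : Type*) [CommRing R] (i : Ix n) : V n R := Pi.single i 1

/-- The basis vector `e_{i_1} ⊗ ⋯ ⊗ e_{i_r}` of the tensor power. -/
noncomputable def eT (R : Type*) [CommRing R] (x : Fin r → Ix n) : ⨂[R]^r (V n R) :=
  PiTensorProduct.tprod R fun k => e1 R (x k)

/-- The parity operator of `V(n|n)`, `e_i ↦ (-1)^{|i|} e_i`. -/
noncomputable def parOp (n : ℕ) (R : Type*) [CommRing R] : Module.End R (V n R) :=
  Matrix.toLin' (Matrix.diagonal fun i => (-1 : R) ^ i.par)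

/-- `A ↦ A^{(k)} = id ⊗ ⋯ ⊗ id ⊗ A ⊗ id ⊗ ⋯ ⊗ id` (`A` in position `k`), as an operator on the
super tensor power: moving a homogeneous operator of parity `p` past a vector of parity `p'`
costs `(-1)^{p p'}`.  The elementary matrix `E_{i,j}` is homogeneous of parity `|i| + |j|`, and
`A = ∑ A_{i,j} E_{i,j}`. -/
noncomputable def tensorOp (A : Matrix (Ix n) (Ix n) R) (k : Fin r) :
    Module.End R (⨂[R]^r (V n R)) :=
  ∑ i, ∑ j, A i j • PiTensorProduct.map fun l =>
    if l < k then parOp n R ^ (i.par + j.par)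
    else if l = k then Matrix.toLin' (Matrix.single i j (1 : R))
    else LinearMap.id

/-- `Ω = ∑_a (E_{-a,a} - E_{a,-a})`. -/
def omegaMat (n : ℕ) (R : Type*) [CommRing R] : Matrix (Ix n) (Ix n) R :=
  ∑ a : Fin n, (Matrix.single (Sum.inr a) (Sum.inl a) (1 : R)
    - Matrix.single (Sum.inl a) (Sum.inr a) (1 : R))

/-- The matrices `S_{i,j}`, `i ≤ j` in `I(n|n) ⊆ ℤ`; for `i > j` the value is `0`. -/
def olS (v : Rˣ) : Ix n → Ix n → Matrix (Ix n) (Ix n) R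
  | Sum.inl b, Sum.inl a =>
    if b = a then
      1 + ((v : R) - 1) • (Matrix.single (Sum.inl a) (Sum.inl a) 1
        + Matrix.single (Sum.inr a) (Sum.inr a) 1)
    else if b < a then
      ((v : R) - ((v⁻¹ : Rˣ) : R)) • (Matrix.single (Sum.inl a) (Sum.inl b) 1
        + Matrix.single (Sum.inr a) (Sum.inr b) 1)
    else 0
  | Sum.inr b, Sum.inr a =>
    if b = a then
      1 + (((v⁻¹ : Rˣ) : R) - 1) • (Matrix.single (Sum.inl a) (Sum.inl a) 1
        + Matrix.single (Sum.inr a) (Sum.inr a) 1)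
    else if a < b then
      (-((v : R) - ((v⁻¹ : Rˣ) : R))) • (Matrix.single (Sum.inl a) (Sum.inl b) 1
        + Matrix.single (Sum.inr a) (Sum.inr b) 1)
    else 0
  | Sum.inr b, Sum.inl a =>
    (-((v : R) - ((v⁻¹ : Rˣ) : R))) • (Matrix.single (Sum.inr a) (Sum.inl b) 1
      + Matrix.single (Sum.inl a) (Sum.inr b) 1)
  | Sum.inl _, Sum.inr _ => 0

/-- `S^{(k,k+1)}` with `S = v ∑_{i ≤ j} S_{i,j} ⊗ E_{i,j}`. -/
noncomputable def opS (v : Rˣ) (s : SIdx r) : Module.End R (⨂[R]^r (V n R)) :=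
  (v : R) • ∑ i : Ix n, ∑ j : Ix n,
    tensorOp (olS v i j) s.lo * tensorOp (Matrix.single i j (1 : R)) s.hi

/-- `T^{(k,k+1)}` with `T = ∑_{i,j} (-1)^{|j|} E_{i,j} ⊗ E_{j,i}`. -/
noncomputable def opFlip (s : SIdx r) : Module.End R (⨂[R]^r (V n R)) :=
  ∑ i : Ix n, ∑ j : Ix n, (-1 : R) ^ j.par •
    (tensorOp (Matrix.single i j (1 : R)) s.lo * tensorOp (Matrix.single j i (1 : R)) s.hi)

/-- `(T S)^{(k,k+1)}`, the operator by which `T_k` acts. -/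
noncomputable def opT (v : Rˣ) (s : SIdx r) : Module.End R (⨂[R]^r (V n R)) :=
  opFlip s * opS v s

/-- `Ω^{(j)}`, the operator by which `c_j` acts. -/
noncomputable def opC (j : Fin r) : Module.End R (⨂[R]^r (V n R)) :=
  tensorOp (omegaMat n R) j

theorem end_ext {f g : Module.End R (⨂[R]^r (V n R))}
    (h : ∀ x : Fin r → Ix n, f (eT R x) = g (eT R x)) : f = g := by
  refine (Basis.piTensorProduct fun _ : Fin r => Pi.basisFun R (Ix n)).ext fun x => ?_
  have : Basis.piTensorProduct (fun _ : Fin r => Pi.basisFun R (Ix n)) x = eT R x := by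
    rw [Basis.piTensorProduct_apply]
    simp [eT, e1, Pi.basisFun_apply]
  rw [this]; exact h x

/-- The total parity of the entries before position `k`. -/
def pre (x : Fin r → Ix n) (k : Fin r) : ℕ := ∑ l with l < k, (x l).par

theorem parOp_pow (m : ℕ) (i : Ix n) :
    (parOp n R ^ m) (e1 R i) = ((-1 : R) ^ (m * i.par)) • e1 R i := by
  induction m with
  | zero => simp
  | succ m ih =>
    have h1 : parOp n R (e1 R i) = (-1 : R) ^ i.par • e1 R i := by
      funext j
      by_cases h : j = i
      · subst h; simp [parOp, e1, Matrix.mulVec_diagonal]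
      · simp [parOp, e1, Matrix.mulVec_diagonal, h]
    rw [pow_succ', Module.End.mul_apply, ih, map_smul, h1, smul_smul]
    congr 1; ring

theorem single_apply (i j k : Ix n) :
    Matrix.toLin' (Matrix.single i j (1 : R)) (e1 R k)
      = (if k = j then (1 : R) else 0) • e1 R i := by
  funext l
  by_cases h : k = j
  · subst h
    by_cases hl : l = i
    · subst hl; simp [e1]
    · simp [e1, hl, Ne.symm hl]
  · simp [e1, h, Ne.symm h]

theorem tensorOp_apply (A : Matrix (Ix n) (Ix n) R) (k : Fin r) (x : Fin r → Ix n) :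
    tensorOp A k (eT R x) = ∑ i, (A i (x k) * (-1 : R) ^ ((i.par + (x k).par) * pre x k)) •
      eT R (Function.update x k i) := by
  have key : ∀ i j : Ix n, (PiTensorProduct.map (R := R) fun l : Fin r =>
      if l < k then parOp n R ^ (i.par + j.par)
      else if l = k then Matrix.toLin' (Matrix.single i j (1 : R))
      else LinearMap.id) (eT R x) =
      (if x k = j then (-1 : R) ^ ((i.par + j.par) * pre x k) else 0) •
        eT R (Function.update x k i) := by
    intro i j
    unfold eT
    rw [PiTensorProduct.map_tprod]
    have h1 : (fun l : Fin r => (if l < k then parOp n R ^ (i.par + j.par)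
      else if l = k then Matrix.toLin' (Matrix.single i j (1 : R))
      else LinearMap.id) (e1 R (x l))) = fun l =>
        (if l < k then (-1 : R) ^ ((i.par + j.par) * (x l).par)
          else if l = k then (if x k = j then 1 else 0) else 1) •
          e1 R (Function.update x k i l) := by
      funext l
      rcases lt_trichotomy l k with h | h | h
      · simp only [h, if_true, parOp_pow, Function.update_of_ne h.ne]
      · subst h
        simp only [lt_irrefl, if_false, if_true, single_apply, Function.update_self]
      · simp only [h.not_gt, h.ne', if_false, Function.update_of_ne h.ne', LinearMap.id_apply,
          one_smul]
    rw [h1, MultilinearMap.map_smul_univ]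
    congr 1
    by_cases hj : x k = j
    · simp only [hj, if_true, ite_self]
      rw [Finset.prod_ite, Finset.prod_const_one, mul_one, Finset.prod_pow_eq_pow_sum,
        ← Finset.mul_sum]
      rfl
    · rw [if_neg hj]
      have h0 : ∀ f : Fin r → R, f k = 0 → ∏ l, f l = 0 := fun f hf =>
        Finset.prod_eq_zero (Finset.mem_univ k) hf
      rw [if_neg hj, h0]
      simp [hj]
  simp only [tensorOp, LinearMap.sum_apply, LinearMap.smul_apply, key]
  refine Finset.sum_congr rfl fun i _ => ?_
  rw [Finset.sum_eq_single (x k)]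
  · simp [smul_smul]
  · intro j _ hj; simp [Ne.symm hj]
  · simp


/-- The operators `T_k` in terms of two adjacent entries. -/
def tab {M : Type*} [AddCommGroup M] [Module R M] (v : R) :
    Ix n → Ix n → (Ix n → Ix n → M) → M
  | Sum.inl a, Sum.inl b, F =>
    if a = b then v ^ 2 • F (.inl b) (.inl a) + (v ^ 2 - 1) • F (.inr a) (.inr b)
    else if a < b then v • F (.inl b) (.inl a) + (v ^ 2 - 1) • F (.inr a) (.inr b)
      + (v ^ 2 - 1) • F (.inl a) (.inl b)
    else v • F (.inl b) (.inl a) + (v ^ 2 - 1) • F (.inr a) (.inr b)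
  | Sum.inl a, Sum.inr b, F =>
    if a = b then F (.inr b) (.inl a)
    else if a < b then v • F (.inr b) (.inl a)
    else v • F (.inr b) (.inl a) - (v ^ 2 - 1) • F (.inr a) (.inl b)
  | Sum.inr a, Sum.inl b, F =>
    if a = b then v ^ 2 • F (.inl b) (.inr a) + (v ^ 2 - 1) • F (.inr a) (.inl b)
    else if a < b then v • F (.inl b) (.inr a) + (v ^ 2 - 1) • F (.inl a) (.inr b)
      + (v ^ 2 - 1) • F (.inr a) (.inl b)
    else v • F (.inl b) (.inr a) + (v ^ 2 - 1) • F (.inr a) (.inl b)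
  | Sum.inr a, Sum.inr b, F =>
    if a = b then - F (.inr b) (.inr a)
    else if a < b then - (v • F (.inr b) (.inr a))
    else - (v • F (.inr b) (.inr a)) + (v ^ 2 - 1) • F (.inr a) (.inr b)

/-- Replace the two entries exchanged by `s`. -/
def upd (s : SIdx r) (x : Fin r → Ix n) (p q : Ix n) : Fin r → Ix n :=
  Function.update (Function.update x s.hi q) s.lo p

theorem lo_ne_hi (s : SIdx r) : s.lo ≠ s.hi := by
  simp [SIdx.lo, SIdx.hi, Fin.ext_iff]

theorem lo_lt_hi (s : SIdx r) : s.lo < s.hi := by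
  simp [SIdx.lo, SIdx.hi, Fin.lt_def]

theorem pre_update_of_le (x : Fin r → Ix n) (k l : Fin r) (h : k ≤ l) (i : Ix n) :
    pre (Function.update x l i) k = pre x k := by
  unfold pre
  refine Finset.sum_congr rfl fun m hm => ?_
  rw [Function.update_of_ne]
  exact ((Finset.mem_filter.1 hm).2.trans_le h).ne

theorem pre_hi (x : Fin r → Ix n) (s : SIdx r) : pre x s.hi = pre x s.lo + (x s.lo).par := by
  unfold pre
  have : (Finset.univ.filter fun l : Fin r => l < s.hi)
      = insert s.lo (Finset.univ.filter fun l : Fin r => l < s.lo) := by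
    ext l
    simp only [Finset.mem_filter, Finset.mem_univ, true_and, Finset.mem_insert, SIdx.lo, SIdx.hi,
      Fin.lt_def, Fin.ext_iff]
    omega
  rw [this, Finset.sum_insert (by simp), add_comm]

theorem two_site (A B : Matrix (Ix n) (Ix n) R) (s : SIdx r) (x : Fin r → Ix n) :
    (tensorOp A s.lo * tensorOp B s.hi) (eT R x) = ∑ q, ∑ p,
      (B q (x s.hi) * A p (x s.lo) *
        ((-1 : R) ^ ((q.par + (x s.hi).par) * (pre x s.lo + (x s.lo).par)) *
         (-1 : R) ^ ((p.par + (x s.lo).par) * pre x s.lo))) • eT R (upd s x p q) := by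
  simp only [Module.End.mul_apply, tensorOp_apply, map_sum, map_smul, Finset.smul_sum, smul_smul,
    pre_update_of_le _ _ _ (lo_lt_hi s).le, Function.update_of_ne (lo_ne_hi s), pre_hi, upd]
  refine Finset.sum_congr rfl fun i _ => Finset.sum_congr rfl fun j _ => ?_
  congr 1; ring

theorem upd_lo (s : SIdx r) (x : Fin r → Ix n) (p q : Ix n) : upd s x p q s.lo = p := by
  simp [upd]

theorem upd_hi (s : SIdx r) (x : Fin r → Ix n) (p q : Ix n) : upd s x p q s.hi = q := by
  simp [upd, Function.update_of_ne (lo_ne_hi s).symm]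

theorem upd_self (s : SIdx r) (x : Fin r → Ix n) : upd s x (x s.lo) (x s.hi) = x := by
  simp [upd]

theorem pre_upd (s : SIdx r) (x : Fin r → Ix n) (p q : Ix n) :
    pre (upd s x p q) s.lo = pre x s.lo := by
  rw [upd, pre_update_of_le _ _ _ le_rfl, pre_update_of_le _ _ _ (lo_lt_hi s).le]

theorem upd_upd (s : SIdx r) (x : Fin r → Ix n) (p q p' q' : Ix n) :
    upd s (upd s x p q) p' q' = upd s x p' q' := by
  funext l
  simp only [upd, Function.update_apply]
  split_ifs <;> rfl

theorem opFlip_apply (s : SIdx r) (x : Fin r → Ix n) :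
    opFlip s (eT R x) = (-1 : R) ^ ((x s.lo).par * (x s.hi).par) •
      eT R (upd s x (x s.hi) (x s.lo)) := by
  simp only [opFlip, LinearMap.sum_apply, LinearMap.smul_apply, two_site]
  rw [Finset.sum_eq_single (x s.hi), Finset.sum_eq_single (x s.lo), Finset.sum_eq_single (x s.lo),
    Finset.sum_eq_single (x s.hi)]
  · simp only [Matrix.single_apply, and_self, if_true, one_mul, smul_smul]
    congr 1
    rcases neg_one_pow_eq_or R (pre x s.lo) with h | h <;>
    rcases x s.lo with a | a <;> rcases x s.hi with b | b <;>
      simp [Ix.par, h, pow_add, mul_add]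
  · intro b _ hb; simp [Matrix.single_apply, Ne.symm hb]
  · simp
  · intro b _ hb; simp [Matrix.single_apply, Ne.symm hb]
  · simp
  · intro b _ hb; simp [Matrix.single_apply, hb]
  · simp
  · intro b _ hb; simp [Matrix.single_apply, hb]
  · simp

theorem opS_apply (v : Rˣ) (s : SIdx r) (x : Fin r → Ix n) :
    opS v s (eT R x) = (v : R) • ∑ q, ∑ p, (olS v q (x s.hi) p (x s.lo) *
      ((-1 : R) ^ ((q.par + (x s.hi).par) * (pre x s.lo + (x s.lo).par)) *
         (-1 : R) ^ ((p.par + (x s.lo).par) * pre x s.lo))) • eT R (upd s x p q) := by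
  simp only [opS, LinearMap.sum_apply, LinearMap.smul_apply, two_site]
  congr 1
  refine Finset.sum_congr rfl fun i _ => ?_
  rw [Finset.sum_eq_single (x s.hi), Finset.sum_eq_single i]
  · simp
  · intro b _ hb; simp [Matrix.single_apply, Ne.symm hb]
  · simp
  · intro b _ hb; simp [Matrix.single_apply, hb]
  · simp

/-- The `y`-th column of `A`, weighted by `c` and paired with `G`. -/
def colSum {M : Type*} [AddCommGroup M] [Module R M] (c : Ix n → R) (G : Ix n → M)
    (A : Matrix (Ix n) (Ix n) R) (y : Ix n) : M := ∑ p, (A p y * c p) • G p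

section colSum

variable {M : Type*} [AddCommGroup M] [Module R M] (c : Ix n → R) (G : Ix n → M) (y : Ix n)

theorem colSum_add (A B : Matrix (Ix n) (Ix n) R) :
    colSum c G (A + B) y = colSum c G A y + colSum c G B y := by
  simp [colSum, add_mul, add_smul, Finset.sum_add_distrib]

theorem colSum_smul (k : R) (A : Matrix (Ix n) (Ix n) R) :
    colSum c G (k • A) y = k • colSum c G A y := by
  simp [colSum, Finset.smul_sum, smul_smul, mul_assoc]

theorem colSum_zero : colSum c G 0 y = 0 := by simp [colSum]

theorem colSum_one : colSum c G 1 y = c y • G y := by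
  simp [colSum, Matrix.one_apply, ite_smul]

theorem colSum_single (i j : Ix n) (t : R) :
    colSum c G (Matrix.single i j t) y = if y = j then (t * c i) • G i else 0 := by
  unfold colSum
  rw [Finset.sum_eq_single i]
  · by_cases h : y = j
    · subst h; simp
    · simp [h, Matrix.single_apply, Ne.symm h]
  · intro b _ hb; simp [Matrix.single_apply, Ne.symm hb]
  · simp

theorem colSum_ite (P : Prop) [Decidable P] (A : Matrix (Ix n) (Ix n) R) :
    colSum c G (if P then A else 0) y = if P then colSum c G A y else 0 := by
  split_ifs <;> simp [colSum]

end colSum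

theorem aux1 {M : Type*} [AddCommGroup M] [Module R M] (v : R) (m : M) :
    v • -m + (1 - v) • -m = -m := by module

theorem aux2 {M : Type*} [AddCommGroup M] [Module R M] (q : R) (m e : M) :
    (q - 1) • m + q • e - q • m + (m - q • e) = 0 := by module

theorem ite_chain {X : Type*} [AddCommGroup X] (a b : Fin n) (A B : X) :
    (if b = a then A else if b < a then B else 0)
      = (if b = a then A else 0) + (if b < a then B else 0) := by
  rcases lt_trichotomy b a with h | h | h
  · simp [h, h.ne]
  · simp [h]
  · simp [h.not_gt, h.ne']

theorem ite_chain' {X : Type*} [AddCommGroup X] (a b : Fin n) (A B : X) :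
    (if b = a then A else if a < b then B else 0)
      = (if b = a then A else 0) + (if a < b then B else 0) := by
  rcases lt_trichotomy b a with h | h | h
  · simp [h.not_gt, h.ne]
  · simp [h]
  · simp [h, h.ne']

theorem sum_ite_ite {X : Type*} [AddCommGroup X] (a : Fin n) (P : Fin n → Prop) [DecidablePred P]
    (f : Fin n → X) :
    ∑ b, (if P b then (if a = b then f b else 0) else 0) = if P a then f a else 0 := by
  rw [Finset.sum_eq_single a]
  · simp
  · intro b _ hb; simp [Ne.symm hb]
  · simp

theorem tri (a b : Fin n) :
    (a < b ∧ (a < b) = True ∧ (b < a) = False ∧ (a = b) = False ∧ (b = a) = False) ∨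
    (a = b ∧ (a < b) = False ∧ (b < a) = False ∧ (a = b) = True ∧ (b = a) = True) ∨
    (b < a ∧ (a < b) = False ∧ (b < a) = True ∧ (a = b) = False ∧ (b = a) = False) := by
  rcases lt_trichotomy a b with h | h | h
  · simp [h, h.not_gt, h.ne, h.ne']
  · simp [h]
  · simp [h, h.not_gt, h.ne, h.ne']

set_option maxHeartbeats 4000000 in
theorem opT_apply (v : Rˣ) (s : SIdx r) (x : Fin r → Ix n) :
    opT v s (eT R x) = tab (v : R) (x s.lo) (x s.hi) fun p q => eT R (upd s x p q) := by
  have hv : (v : R) * ((v⁻¹ : Rˣ) : R) = 1 := v.mul_inv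
  have h1 : ∀ m : ⨂[R]^r (V n R), (v : R) • (((v⁻¹ : Rˣ) : R) - v) • m = (1 - (v : R) ^ 2) • m :=
    fun m => by rw [smul_smul, mul_sub, hv, sq]
  have h2 : ∀ m : ⨂[R]^r (V n R), (v : R) • ((v : R) - ((v⁻¹ : Rˣ) : R)) • m
      = ((v : R) ^ 2 - 1) • m :=
    fun m => by rw [smul_smul, mul_sub, hv, sq]
  have h3 : ∀ m : ⨂[R]^r (V n R), (v : R) • (((v⁻¹ : Rˣ) : R) - 1) • m = (1 - (v : R)) • m :=
    fun m => by rw [smul_smul, mul_sub, hv, mul_one]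
  simp only [opT, Module.End.mul_apply, opS_apply, map_sum, map_smul, opFlip_apply, upd_lo, upd_hi,
    upd_upd]
  generalize hF : (fun p q => eT R (upd s x p q)) = F
  have hF' : ∀ p q, eT R (upd s x p q) = F p q := fun p q => by rw [← hF]
  simp only [hF']
  clear hF hF'
  generalize pre x s.lo = P
  generalize x s.lo = y
  generalize x s.hi = z
  have key : ∀ q : Ix n, ∑ p, (olS v q z p y * ((-1 : R) ^ ((q.par + z.par) * (P + y.par)) *
      (-1 : R) ^ ((p.par + y.par) * P))) • (-1 : R) ^ (p.par * q.par) • F q p =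
      colSum (fun p => (-1 : R) ^ ((q.par + z.par) * (P + y.par)) *
      (-1 : R) ^ ((p.par + y.par) * P)) (fun p => (-1 : R) ^ (p.par * q.par) • F q p)
      (olS v q z) y := fun q => rfl
  simp only [key]
  clear key
  have hP : (-1 : R) ^ P = 1 ∨ (-1 : R) ^ P = -1 := neg_one_pow_eq_or R P
  rcases y with a | a <;> rcases z with b | b <;>
  simp only [Fintype.sum_sum_type, olS, tab, Ix.par, ite_chain, ite_chain', colSum_add,
    colSum_ite, colSum_smul,
    colSum_single, colSum_one, colSum_zero, Sum.inl.injEq, Sum.inr.injEq, reduceCtorEq, if_false,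
    smul_zero, add_zero, zero_add, Finset.sum_add_distrib, Finset.sum_ite_eq, Finset.mem_univ,
    if_true, sum_ite_ite, Finset.sum_const_zero, smul_ite, Finset.sum_ite_eq']
  all_goals
    rcases tri a b with ⟨h, e1, e2, e3, e4⟩ | ⟨h, e1, e2, e3, e4⟩ | ⟨h, e1, e2, e3, e4⟩ <;>
    (try subst h) <;> rcases hP with hP | hP <;>
    simp only [e1, e2, e3, e4, if_true, if_false, pow_add, mul_add, add_mul, zero_mul, mul_zero,
      one_mul, mul_one, pow_zero, pow_one, hP, add_zero, zero_add, neg_neg, neg_smul, smul_neg,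
      one_smul, mul_neg, lt_self_iff_false, smul_zero, smul_add, neg_sub, h1, h2, h3] <;>
    first | module | exact aux1 _ _

section tab

variable {M N : Type*} [AddCommGroup M] [Module R M] [AddCommGroup N] [Module R N] (v : R)

theorem map_tab (g : M →ₗ[R] N) (y z : Ix n) (F : Ix n → Ix n → M) :
    g (tab v y z F) = tab v y z fun p q => g (F p q) := by
  rcases y with a | a <;> rcases z with b | b <;> simp only [tab] <;> split_ifs <;> simp

theorem tab_add (y z : Ix n) (F G : Ix n → Ix n → M) :
    tab v y z (F + G) = tab v y z F + tab v y z G := by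
  rcases y with a | a <;> rcases z with b | b <;> simp only [tab] <;> split_ifs <;>
    simp only [Pi.add_apply] <;> module

theorem tab_smul (y z : Ix n) (t : R) (F : Ix n → Ix n → M) :
    tab v y z (t • F) = t • tab v y z F := by
  rcases y with a | a <;> rcases z with b | b <;> simp only [tab] <;> split_ifs <;>
    simp only [Pi.smul_apply] <;> module

theorem tab_congr (y z : Ix n) (F G : Ix n → Ix n → M)
    (h : ∀ p q : Ix n, (-1 : R) ^ (p.par + q.par) = (-1 : R) ^ (y.par + z.par) → F p q = G p q) :
    tab v y z F = tab v y z G := by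
  rcases y with a | a <;> rcases z with b | b <;> simp only [tab] <;> split_ifs <;>
    simp only [Ix.par] at h <;> simp [h, Ix.par]

theorem tab_comm (y z y' z' : Ix n) (G : Ix n → Ix n → Ix n → Ix n → M) :
    tab v y z (fun p q => tab v y' z' fun p' q' => G p q p' q')
      = tab v y' z' fun p' q' => tab v y z fun p q => G p q p' q' := by
  let L : (Ix n → Ix n → M) →ₗ[R] M :=
    { toFun := tab v y' z', map_add' := tab_add v y' z', map_smul' := tab_smul v y' z' }
  have h1 := map_tab v L y z fun p q => G p q
  refine h1.symm.trans ?_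
  show tab v y' z' (tab v y z fun p q => G p q) = _
  congr 1
  funext p' q'
  exact map_tab v ((LinearMap.proj (R := R) (φ := fun _ : Ix n => M) q').comp
    (LinearMap.proj (R := R) (φ := fun _ : Ix n => Ix n → M) p')) y z fun p q => G p q

theorem tab_quad (y z : Ix n) (F : Ix n → Ix n → M) :
    (tab v y z fun p q => tab v p q F) = (v ^ 2 - 1) • tab v y z F + v ^ 2 • F y z := by
  rcases y with a | a <;> rcases z with b | b <;>
    rcases tri a b with ⟨h, e1, e2, e3, e4⟩ | ⟨h, e1, e2, e3, e4⟩ | ⟨h, e1, e2, e3, e4⟩ <;>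
    (try subst h) <;>
    simp only [tab, e1, e2, e3, e4, if_true, if_false, lt_self_iff_false] <;> module

theorem tab_c_lo (ε : R) (y z : Ix n) (F : Ix n → Ix n → M) :
    (ε * (-1) ^ y.par) • tab v y.neg z F =
      tab v y z fun p q => (ε * (-1) ^ (p.par + q.par)) • F p q.neg := by
  rcases y with a | a <;> rcases z with b | b <;>
    rcases tri a b with ⟨h, e1, e2, e3, e4⟩ | ⟨h, e1, e2, e3, e4⟩ | ⟨h, e1, e2, e3, e4⟩ <;>
    (try subst h) <;>
    simp only [tab, Ix.neg, Ix.par, e1, e2, e3, e4, if_true, if_false,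
      lt_self_iff_false] <;> module

theorem tab_c_hi (ε : R) (y z : Ix n) (F : Ix n → Ix n → M) :
    (ε * (-1) ^ (y.par + z.par)) • tab v y z.neg F =
      (tab v y z fun p q => (ε * (-1) ^ p.par) • F p.neg q) -
        (v ^ 2 - 1) • ((ε * (-1) ^ y.par) • F y.neg z - (ε * (-1) ^ (y.par + z.par)) • F y z.neg) := by
  rcases y with a | a <;> rcases z with b | b <;>
    rcases tri a b with ⟨h, e1, e2, e3, e4⟩ | ⟨h, e1, e2, e3, e4⟩ | ⟨h, e1, e2, e3, e4⟩ <;>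
    (try subst h) <;>
    simp only [tab, Ix.neg, Ix.par, e1, e2, e3, e4, if_true, if_false,
      lt_self_iff_false] <;> module

theorem tab_braid (a b c : Fin n) (E : Ix n → Ix n → Ix n → M) :
    (tab v (.inr a) (.inr b) fun x y => tab v y (.inr c) fun y z => tab v x y fun x y => E x y z) =
      tab v (.inr b) (.inr c) fun y z => tab v (.inr a) y fun x y => tab v y z fun y z =>
        E x y z := by
  rcases tri a b with ⟨h, e1, e2, e3, e4⟩ | ⟨h, e1, e2, e3, e4⟩ | ⟨h, e1, e2, e3, e4⟩ <;>
  rcases tri b c with ⟨h', f1, f2, f3, f4⟩ | ⟨h', f1, f2, f3, f4⟩ | ⟨h', f1, f2, f3, f4⟩ <;>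
  rcases tri a c with ⟨h'', g1, g2, g3, g4⟩ | ⟨h'', g1, g2, g3, g4⟩ | ⟨h'', g1, g2, g3, g4⟩
  any_goals (first | (exfalso; order) | skip)
  all_goals
    try subst h
    try subst h'
    try subst h''
    simp only [tab, e1, e2, e3, e4, f1, f2, f3, f4, g1, g2, g3, g4, if_true, if_false]
  all_goals try module

end tab


theorem opC_apply (j : Fin r) (x : Fin r → Ix n) :
    opC j (eT R x) = (-1 : R) ^ (pre x j + (x j).par) •
      eT R (Function.update x j (x j).neg) := by
  unfold opC
  rw [tensorOp_apply]
  have h1 : ∀ p : Ix n, omegaMat n R p (x j) =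
      if p = (x j).neg then (-1 : R) ^ (x j).par else 0 := by
    intro p
    rcases p with p | p <;> rcases x j with a | a <;>
      simp [omegaMat, Ix.neg, Ix.par, Matrix.sum_apply, Matrix.single_apply, eq_comm,
        Finset.sum_ite_eq, ite_and]
    all_goals split_ifs <;> simp
  simp only [h1]
  rw [Finset.sum_eq_single (x j).neg]
  · rw [if_pos rfl]
    congr 1
    rcases x j with a | a <;> simp [Ix.neg, Ix.par, pow_add]
  · intro b _ hb; simp [hb]
  · simp

theorem pre_update_neg (x : Fin r → Ix n) (i j : Fin r) (h : i < j) :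
    (-1 : R) ^ pre (Function.update x i (x i).neg) j = - (-1 : R) ^ pre x j := by
  have hm : i ∈ Finset.univ.filter fun l : Fin r => l < j := by simp [h]
  unfold pre
  rw [← Finset.add_sum_erase _ _ hm, ← Finset.add_sum_erase _ (fun l => (x l).par) hm]
  have : ∑ l ∈ (Finset.univ.filter fun l : Fin r => l < j).erase i,
      (Function.update x i (x i).neg l).par =
      ∑ l ∈ (Finset.univ.filter fun l : Fin r => l < j).erase i, (x l).par :=
    Finset.sum_congr rfl fun l hl => by
      rw [Function.update_of_ne (Finset.ne_of_mem_erase hl)]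
  rw [this, Function.update_self]
  rcases x i with a | a <;> simp [Ix.neg, Ix.par, pow_add]

theorem opC_sq (j : Fin r) : (opC j * opC j : Module.End R (⨂[R]^r (V n R))) = -1 := by
  refine end_ext fun x => ?_
  simp only [Module.End.mul_apply, opC_apply, map_smul, Function.update_self,
    Function.update_idem, smul_smul, pre_update_of_le _ _ _ le_rfl, LinearMap.neg_apply,
    Module.End.one_apply]
  have h2 : (x j).neg.neg = x j := by rcases x j with a | a <;> rfl
  rw [h2, Function.update_eq_self, ← neg_one_smul R]
  congr 1
  rcases neg_one_pow_eq_or R (pre x j) with h | h <;> rcases x j with a | a <;>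
    simp [Ix.neg, Ix.par, pow_add, h]

theorem opC_anti_lt (i j : Fin r) (h : i < j) :
    (opC i * opC j : Module.End R (⨂[R]^r (V n R))) = -(opC j * opC i) := by
  refine end_ext fun x => ?_
  simp only [Module.End.mul_apply, opC_apply, map_smul, smul_smul, LinearMap.neg_apply,
    pre_update_of_le _ _ _ h.le, Function.update_of_ne h.ne, Function.update_of_ne h.ne', pow_add,
    pre_update_neg _ _ _ h, Function.update_comm h.ne]
  rw [← neg_smul]
  congr 1; ring

theorem opC_anti (i j : Fin r) (h : i ≠ j) :
    (opC i * opC j : Module.End R (⨂[R]^r (V n R))) = -(opC j * opC i) := by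
  rcases lt_or_gt_of_ne h with h | h
  · exact opC_anti_lt i j h
  · rw [opC_anti_lt j i h]; exact (neg_neg (G := Module.End R (⨂[R]^r (V n R))) (opC i * opC j)).symm

theorem opT_upd (v : Rˣ) (s : SIdx r) (x : Fin r → Ix n) (p q : Ix n) :
    opT v s (eT R (upd s x p q)) = tab (v : R) p q fun p' q' => eT R (upd s x p' q') := by
  simp only [opT_apply, upd_lo, upd_hi, upd_upd]

theorem opT_quad (v : Rˣ) (s : SIdx r) :
    ((opT v s - algebraMap R _ ((v : R) ^ 2)) * (opT v s + 1) :
      Module.End R (⨂[R]^r (V n R))) = 0 := by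
  refine end_ext fun x => ?_
  have h1 : opT v s (opT v s (eT R x)) =
      ((v : R) ^ 2 - 1) • opT v s (eT R x) + (v : R) ^ 2 • eT R x := by
    simp only [opT_apply v s x, map_tab, opT_upd]
    rw [tab_quad, upd_self]
  simp only [Module.End.mul_apply, LinearMap.sub_apply, LinearMap.add_apply, Module.End.one_apply,
    map_add, h1, Module.algebraMap_end_apply, LinearMap.zero_apply]
  exact aux2 _ _ _

theorem opT_comm (v : Rˣ) (s t : SIdx r) (h : s.1 + 1 < t.1) :
    (opT v s * opT v t : Module.End R (⨂[R]^r (V n R))) = opT v t * opT v s := by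
  have h1 : s.lo ≠ t.lo := by simp [SIdx.lo, Fin.ext_iff]; omega
  have h2 : s.lo ≠ t.hi := by simp [SIdx.lo, SIdx.hi, Fin.ext_iff]; omega
  have h3 : s.hi ≠ t.lo := by simp [SIdx.lo, SIdx.hi, Fin.ext_iff]; omega
  have h4 : s.hi ≠ t.hi := by simp [SIdx.hi, Fin.ext_iff]; omega
  refine end_ext fun x => ?_
  have hu : ∀ p q p' q', upd s (upd t x p q) p' q' = upd t (upd s x p' q') p q := by
    intro p q p' q'
    funext l
    simp only [upd, Function.update_apply]
    split_ifs <;> simp_all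
  simp only [Module.End.mul_apply, opT_apply v t x, opT_apply v s x, map_tab]
  simp only [opT_apply]
  have e1 : ∀ p q, upd t x p q s.lo = x s.lo := fun p q => by
    simp [upd, Function.update_of_ne, h1, h2]
  have e2 : ∀ p q, upd t x p q s.hi = x s.hi := fun p q => by
    simp [upd, Function.update_of_ne, h3, h4]
  have e3 : ∀ p q, upd s x p q t.lo = x t.lo := fun p q => by
    simp [upd, Function.update_of_ne, h1.symm, h3.symm]
  have e4 : ∀ p q, upd s x p q t.hi = x t.hi := fun p q => by
    simp [upd, Function.update_of_ne, h2.symm, h4.symm]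
  simp only [e1, e2, e3, e4]
  rw [tab_comm]
  simp only [hu]

theorem opT_opC_of_ne (v : Rˣ) (s : SIdx r) (j : Fin r) (h1 : j ≠ s.lo) (h2 : j ≠ s.hi) :
    (opT v s * opC j : Module.End R (⨂[R]^r (V n R))) = opC j * opT v s := by
  refine end_ext fun x => ?_
  have e1 : ∀ p, Function.update x j p s.lo = x s.lo := fun p => Function.update_of_ne h1.symm _ _
  have e2 : ∀ p, Function.update x j p s.hi = x s.hi := fun p => Function.update_of_ne h2.symm _ _
  have e3 : ∀ p q, upd s x p q j = x j := fun p q => by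
    simp [upd, Function.update_of_ne, h1, h2]
  have hu : ∀ p q i, Function.update (upd s x p q) j i = upd s (Function.update x j i) p q := by
    intro p q i
    funext l
    simp only [upd, Function.update_apply]
    split_ifs <;> simp_all
  simp only [Module.End.mul_apply, opC_apply, opT_apply, map_smul, map_tab, e1, e2, e3, hu]
  rw [← tab_smul]
  refine tab_congr _ _ _ _ _ fun p q hpq => ?_
  simp only [Pi.smul_apply]
  congr 1
  rcases lt_or_gt_of_ne h1 with h | h
  · rw [upd, pre_update_of_le _ _ _ h.le, pre_update_of_le _ _ _ (h.trans (lo_lt_hi s)).le]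
  · have hlt : s.hi < j := by
      have : s.hi ≠ j := h2.symm
      simp only [SIdx.lo, SIdx.hi, Fin.lt_def, gt_iff_lt, ne_eq, Fin.ext_iff] at *
      omega
    have hm : s.hi ∈ Finset.univ.filter fun l : Fin r => l < j := by simp [hlt]
    have hm' : s.lo ∈ (Finset.univ.filter fun l : Fin r => l < j).erase s.hi := by
      simp [h, lo_ne_hi s]
    have key : ∀ y : Fin r → Ix n, pre y j = (y s.lo).par + (y s.hi).par +
        ∑ l ∈ ((Finset.univ.filter fun l : Fin r => l < j).erase s.hi).erase s.lo, (y l).par := by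
      intro y
      unfold pre
      rw [← Finset.add_sum_erase _ _ hm, ← Finset.add_sum_erase _ _ hm']
      ring
    rw [key x, key (upd s x p q), upd_lo, upd_hi]
    have hsum : ∑ l ∈ ((Finset.univ.filter fun l : Fin r => l < j).erase s.hi).erase s.lo,
        (upd s x p q l).par =
        ∑ l ∈ ((Finset.univ.filter fun l : Fin r => l < j).erase s.hi).erase s.lo, (x l).par := by
      refine Finset.sum_congr rfl fun l hl => ?_
      have hl1 := Finset.ne_of_mem_erase hl
      have hl2 := Finset.ne_of_mem_erase (Finset.mem_of_mem_erase hl)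
      rw [upd, Function.update_of_ne hl1, Function.update_of_ne hl2]
    rw [hsum, pow_add _ (_ + _ + _), pow_add _ (_ + _ + _), pow_add _ (_ + _), pow_add _ (_ + _),
      hpq]

theorem opC_lo_upd (s : SIdx r) (x : Fin r → Ix n) (p q : Ix n) :
    opC s.lo (eT R (upd s x p q)) =
      ((-1 : R) ^ pre x s.lo * (-1) ^ p.par) • eT R (upd s x p.neg q) := by
  rw [opC_apply, upd_lo, pre_upd, pow_add]
  congr 2
  simp [upd]

theorem opC_hi_upd (s : SIdx r) (x : Fin r → Ix n) (p q : Ix n) :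
    opC s.hi (eT R (upd s x p q)) =
      ((-1 : R) ^ pre x s.lo * (-1) ^ (p.par + q.par)) • eT R (upd s x p q.neg) := by
  rw [opC_apply, upd_hi, pre_hi, upd_lo, pre_upd, add_assoc, pow_add]
  congr 2
  rw [upd, upd, Function.update_comm (lo_ne_hi s), Function.update_idem]

theorem opT_opC_lo (v : Rˣ) (s : SIdx r) :
    (opT v s * opC s.lo : Module.End R (⨂[R]^r (V n R))) = opC s.hi * opT v s := by
  refine end_ext fun x => ?_
  rw [← upd_self s x]
  generalize x s.lo = y
  generalize x s.hi = z
  simp only [Module.End.mul_apply, opC_lo_upd, opT_upd, map_smul, map_tab, opC_hi_upd]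
  exact tab_c_lo _ _ _ _ fun p q => eT R (upd s x p q)

theorem opT_opC_hi (v : Rˣ) (s : SIdx r) :
    (opT v s * opC s.hi : Module.End R (⨂[R]^r (V n R))) =
      opC s.lo * opT v s - algebraMap R _ ((v : R) ^ 2 - 1) * (opC s.lo - opC s.hi) := by
  refine end_ext fun x => ?_
  rw [← upd_self s x]
  generalize x s.lo = y
  generalize x s.hi = z
  simp only [Module.End.mul_apply, LinearMap.sub_apply, Module.algebraMap_end_apply,
    opC_lo_upd, opT_upd, map_smul, map_tab, opC_hi_upd]
  exact tab_c_hi _ _ _ _ fun p q => eT R (upd s x p q)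

theorem braid_c1 {A : Type*} [Ring A] (s t c₁ c₂ c₃ : A)
    (s1 : s * c₁ = c₂ * s) (s3 : s * c₃ = c₃ * s) (t1 : t * c₁ = c₁ * t) (t2 : t * c₂ = c₃ * t) :
    (s * t * s - t * s * t) * c₁ = c₃ * (s * t * s - t * s * t) := by
  have s1' : ∀ x, s * (c₁ * x) = c₂ * (s * x) := fun x => by rw [← mul_assoc, s1, mul_assoc]
  have s3' : ∀ x, s * (c₃ * x) = c₃ * (s * x) := fun x => by rw [← mul_assoc, s3, mul_assoc]
  have t1' : ∀ x, t * (c₁ * x) = c₁ * (t * x) := fun x => by rw [← mul_assoc, t1, mul_assoc]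
  have t2' : ∀ x, t * (c₂ * x) = c₃ * (t * x) := fun x => by rw [← mul_assoc, t2, mul_assoc]
  simp only [sub_mul, mul_sub, mul_assoc, s1, t1, s1', s3', t1', t2']

theorem braid_c2 {A : Type*} [Ring A] (s t c₁ c₂ c₃ k : A) (sk : s * k = k * s) (tk : t * k = k * t)
    (s1 : s * c₁ = c₂ * s) (s2 : s * c₂ = c₁ * s - k * (c₁ - c₂)) (s3 : s * c₃ = c₃ * s)
    (t1 : t * c₁ = c₁ * t) (t2 : t * c₂ = c₃ * t) (t3 : t * c₃ = c₂ * t - k * (c₂ - c₃)) :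
    (s * t * s - t * s * t) * c₂ = c₂ * (s * t * s - t * s * t) := by
  have sk' : ∀ x, s * (k * x) = k * (s * x) := fun x => by rw [← mul_assoc, sk, mul_assoc]
  have tk' : ∀ x, t * (k * x) = k * (t * x) := fun x => by rw [← mul_assoc, tk, mul_assoc]
  have s1' : ∀ x, s * (c₁ * x) = c₂ * (s * x) := fun x => by rw [← mul_assoc, s1, mul_assoc]
  have s3' : ∀ x, s * (c₃ * x) = c₃ * (s * x) := fun x => by rw [← mul_assoc, s3, mul_assoc]
  have t1' : ∀ x, t * (c₁ * x) = c₁ * (t * x) := fun x => by rw [← mul_assoc, t1, mul_assoc]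
  have t3' : ∀ x, t * (c₃ * x) = c₂ * (t * x) - k * (c₂ * x) + k * (c₃ * x) := fun x => by
    rw [← mul_assoc, t3]; noncomm_ring
  simp only [sub_mul, mul_sub, mul_add, mul_assoc, s1, s2, s3, t1, t2, t3, sk', tk', s1', s3', t1',
    t3']
  abel

theorem braid_c3 {A : Type*} [Ring A] (s t c₁ c₂ c₃ k Q : A) (sk : s * k = k * s)
    (tk : t * k = k * t) (ss : s * s = k * s + Q) (tt : t * t = k * t + Q)
    (kc₁ : c₁ * k = k * c₁) (kc₃ : c₃ * k = k * c₃)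
    (s1 : s * c₁ = c₂ * s) (s2 : s * c₂ = c₁ * s - k * (c₁ - c₂)) (s3 : s * c₃ = c₃ * s)
    (t1 : t * c₁ = c₁ * t) (t2 : t * c₂ = c₃ * t) (t3 : t * c₃ = c₂ * t - k * (c₂ - c₃)) :
    (s * t * s - t * s * t) * c₃ = c₁ * (s * t * s - t * s * t) := by
  have sk' : ∀ x, s * (k * x) = k * (s * x) := fun x => by rw [← mul_assoc, sk, mul_assoc]
  have tk' : ∀ x, t * (k * x) = k * (t * x) := fun x => by rw [← mul_assoc, tk, mul_assoc]
  have k1' : ∀ x, c₁ * (k * x) = k * (c₁ * x) := fun x => by rw [← mul_assoc, kc₁, mul_assoc]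
  have k3' : ∀ x, c₃ * (k * x) = k * (c₃ * x) := fun x => by rw [← mul_assoc, kc₃, mul_assoc]
  have s2' : ∀ x, s * (c₂ * x) = c₁ * (s * x) - k * (c₁ * x) + k * (c₂ * x) := fun x => by
    rw [← mul_assoc, s2]; noncomm_ring
  have s3' : ∀ x, s * (c₃ * x) = c₃ * (s * x) := fun x => by rw [← mul_assoc, s3, mul_assoc]
  have t1' : ∀ x, t * (c₁ * x) = c₁ * (t * x) := fun x => by rw [← mul_assoc, t1, mul_assoc]
  have t2' : ∀ x, t * (c₂ * x) = c₃ * (t * x) := fun x => by rw [← mul_assoc, t2, mul_assoc]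
  have t3' : ∀ x, t * (c₃ * x) = c₂ * (t * x) - k * (c₂ * x) + k * (c₃ * x) := fun x => by
    rw [← mul_assoc, t3]; noncomm_ring
  simp only [sub_mul, mul_sub, mul_add, mul_assoc, s2, s3, t1, t2, t3, sk', tk', s2', s3',
    t1', t2', t3', ss, tt, k1', k3']
  abel

theorem opT_braid_neg (v : Rˣ) (s t : SIdx r) (h : t.1 = s.1 + 1) (x : Fin r → Ix n)
    (a b c : Fin n) (ha : x s.lo = .inr a) (hb : x s.hi = .inr b) (hc : x t.hi = .inr c) :
    (opT v s * opT v t * opT v s : Module.End R (⨂[R]^r (V n R))) (eT R x) =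
      (opT v t * opT v s * opT v t : Module.End R (⨂[R]^r (V n R))) (eT R x) := by
  have h1 : s.hi = t.lo := by simp [SIdx.lo, SIdx.hi, Fin.ext_iff, h]
  have h2 : s.lo ≠ t.hi := by simp [SIdx.lo, SIdx.hi, Fin.ext_iff]; omega
  have h3 := lo_ne_hi s
  have h4 := lo_ne_hi t
  rw [← h1] at h4
  let E : Ix n → Ix n → Ix n → ⨂[R]^r (V n R) := fun a b c =>
    eT R (Function.update (Function.update (Function.update x t.hi c) s.hi b) s.lo a)
  have hs : ∀ a b c, opT v s (E a b c) = tab (v : R) a b fun a' b' => E a' b' c := by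
    intro a b c
    simp only [E]
    rw [show Function.update (Function.update (Function.update x t.hi c) s.hi b) s.lo a =
      upd s (Function.update x t.hi c) a b from rfl, opT_upd]
    rfl
  have ht' : ∀ a b c, Function.update (Function.update (Function.update x t.hi c) s.hi b) s.lo a =
      upd t (Function.update x s.lo a) b c := by
    intro a b c
    funext l
    simp only [upd, Function.update_apply, h1]
    split_ifs <;> simp_all
  have ht : ∀ a b c, opT v t (E a b c) = tab (v : R) b c fun b' c' => E a b' c' := by
    intro a b c
    simp only [E, ht', opT_upd]
  have hx : eT R x = E (x s.lo) (x s.hi) (x t.hi) := by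
    simp [E]
  simp only [Module.End.mul_apply, hx, hs, ht, map_tab, ha, hb, hc]
  exact tab_braid _ _ _ _ _

theorem opC_flip (j : Fin r) (x : Fin r → Ix n) :
    ∃ ε : R, eT R x = opC j (ε • eT R (Function.update x j (x j).neg)) := by
  refine ⟨(-1) ^ (pre x j + (x j).neg.par), ?_⟩
  have h2 : (x j).neg.neg = x j := by rcases x j with a | a <;> rfl
  rw [map_smul, opC_apply, Function.update_self, Function.update_idem, h2,
    Function.update_eq_self, smul_smul, pre_update_of_le _ _ _ le_rfl, ← pow_add, ← two_mul,
    pow_mul, neg_one_sq, one_pow, one_smul]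

theorem opT_sq (v : Rˣ) (s : SIdx r) :
    (opT v s * opT v s : Module.End R (⨂[R]^r (V n R))) =
      algebraMap R _ ((v : R) ^ 2 - 1) * opT v s + algebraMap R _ ((v : R) ^ 2) := by
  refine end_ext fun x => ?_
  simp only [Module.End.mul_apply, LinearMap.add_apply, Module.algebraMap_end_apply,
    opT_apply v s x, map_tab, opT_upd]
  rw [tab_quad, upd_self]
  congr 1
  exact (tab_smul _ _ _ _ _).symm

theorem opT_braid (v : Rˣ) (s t : SIdx r) (h : t.1 = s.1 + 1) :
    (opT v s * opT v t * opT v s : Module.End R (⨂[R]^r (V n R))) =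
      opT v t * opT v s * opT v t := by
  have h1 : s.hi = t.lo := by simp [SIdx.lo, SIdx.hi, Fin.ext_iff, h]
  have h2 : s.lo ≠ t.hi := by simp [SIdx.lo, SIdx.hi, Fin.ext_iff]; omega
  have h3 := lo_ne_hi s
  have h4 := lo_ne_hi t
  have sk := (Algebra.commutes (A := Module.End R (⨂[R]^r (V n R))) ((v : R) ^ 2 - 1)
    (opT v s)).symm
  have tk := (Algebra.commutes (A := Module.End R (⨂[R]^r (V n R))) ((v : R) ^ 2 - 1)
    (opT v t)).symm
  have kc := fun j : Fin r => (Algebra.commutes (A := Module.End R (⨂[R]^r (V n R)))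
    ((v : R) ^ 2 - 1) (opC j)).symm
  have s1 := opT_opC_lo (n := n) v s
  have s2 := opT_opC_hi (n := n) v s
  have s3 := opT_opC_of_ne (n := n) v s t.hi h2.symm (h1 ▸ h4.symm)
  have t1 := opT_opC_of_ne (n := n) v t s.lo (h1 ▸ h3) h2
  have t2 := opT_opC_lo (n := n) v t
  have t3 := opT_opC_hi (n := n) v t
  rw [← h1] at t2 t3 h4
  have b1 := braid_c1 (A := Module.End R (⨂[R]^r (V n R))) _ _ _ _ _ s1 s3 t1 t2
  have b2 := braid_c2 (A := Module.End R (⨂[R]^r (V n R))) _ _ _ _ _ _ sk tk s1 s2 s3 t1 t2 t3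
  have b3 := braid_c3 (A := Module.End R (⨂[R]^r (V n R))) _ _ _ _ _ _ _ sk tk (opT_sq v s)
    (opT_sq v t) (kc _) (kc _) s1 s2 s3 t1 t2 t3
  let B : Module.End R (⨂[R]^r (V n R)) :=
    opT v s * opT v t * opT v s - opT v t * opT v s * opT v t
  have flip : ∀ i j : Fin r, B * opC i = opC j * B → ∀ x : Fin r → Ix n,
      B (eT R (Function.update x i (x i).neg)) = 0 → B (eT R x) = 0 := by
    intro i j hB x hx
    obtain ⟨ε, hε⟩ := opC_flip (R := R) i x
    rw [hε, ← Module.End.mul_apply, hB, Module.End.mul_apply, map_smul, hx, smul_zero, map_zero]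
  have force : ∀ i j : Fin r, B * opC i = opC j * B → ∀ x : Fin r → Ix n,
      (∀ y : Fin r → Ix n, (∀ l, l ≠ i → y l = x l) → (∃ a, y i = .inr a) → B (eT R y) = 0) →
      B (eT R x) = 0 := by
    intro i j hB x hx
    rcases hxi : x i with a | a
    · refine flip i j hB x (hx _ (fun l hl => Function.update_of_ne hl _ _) ⟨a, ?_⟩)
      simp [hxi, Ix.neg]
    · exact hx x (fun _ _ => rfl) ⟨a, hxi⟩
  have hB : ∀ x, B (eT R x) = 0 := by
    intro x
    refine force _ _ b1 x fun y _ ⟨a, ha⟩ => ?_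
    refine force _ _ b2 y fun z hz ⟨b, hb⟩ => ?_
    refine force _ _ b3 z fun w hw ⟨c, hc⟩ => ?_
    have := opT_braid_neg v s t h w a b c (by rw [hw _ h2, hz _ h3, ha]) (by rw [hw _ h4, hb]) hc
    exact sub_eq_zero.2 this
  refine end_ext fun x => ?_
  exact sub_eq_zero.1 (hB x)

end Operators

section HeckeClifford

/-- Generators of the Hecke–Clifford superalgebra: the even `T_s` and the odd `c_j`. -/
inductive HCGen (r : ℕ) : Type
  | T (s : SIdx r) : HCGen r
  | c (j : Fin r) : HCGen r

variable {R : Type*} [CommRing R]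

/-- The defining relations of the Hecke–Clifford superalgebra. -/
inductive HCRel (r : ℕ) (q : R) : FreeAlgebra R (HCGen r) → FreeAlgebra R (HCGen r) → Prop
  | c_sq (j : Fin r) :
      HCRel r q (FreeAlgebra.ι R (HCGen.c j) * FreeAlgebra.ι R (HCGen.c j)) (-1)
  | c_anti (i j : Fin r) (h : i ≠ j) :
      HCRel r q (FreeAlgebra.ι R (HCGen.c i) * FreeAlgebra.ι R (HCGen.c j))
        (-(FreeAlgebra.ι R (HCGen.c j) * FreeAlgebra.ι R (HCGen.c i)))
  | quad (s : SIdx r) :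
      HCRel r q ((FreeAlgebra.ι R (HCGen.T s) - algebraMap R _ q) *
        (FreeAlgebra.ι R (HCGen.T s) + 1)) 0
  | comm (s t : SIdx r) (h : s.1 + 1 < t.1) :
      HCRel r q (FreeAlgebra.ι R (HCGen.T s) * FreeAlgebra.ι R (HCGen.T t))
        (FreeAlgebra.ι R (HCGen.T t) * FreeAlgebra.ι R (HCGen.T s))
  | braid (s t : SIdx r) (h : t.1 = s.1 + 1) :
      HCRel r q
        (FreeAlgebra.ι R (HCGen.T s) * FreeAlgebra.ι R (HCGen.T t) * FreeAlgebra.ι R (HCGen.T s))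
        (FreeAlgebra.ι R (HCGen.T t) * FreeAlgebra.ι R (HCGen.T s) * FreeAlgebra.ι R (HCGen.T t))
  | T_c (s : SIdx r) (j : Fin r) (h : j ≠ s.lo) (h' : j ≠ s.hi) :
      HCRel r q (FreeAlgebra.ι R (HCGen.T s) * FreeAlgebra.ι R (HCGen.c j))
        (FreeAlgebra.ι R (HCGen.c j) * FreeAlgebra.ι R (HCGen.T s))
  | T_c_lo (s : SIdx r) :
      HCRel r q (FreeAlgebra.ι R (HCGen.T s) * FreeAlgebra.ι R (HCGen.c s.lo))
        (FreeAlgebra.ι R (HCGen.c s.hi) * FreeAlgebra.ι R (HCGen.T s))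
  | T_c_hi (s : SIdx r) :
      HCRel r q (FreeAlgebra.ι R (HCGen.T s) * FreeAlgebra.ι R (HCGen.c s.hi))
        (FreeAlgebra.ι R (HCGen.c s.lo) * FreeAlgebra.ι R (HCGen.T s) -
          algebraMap R _ (q - 1) *
            (FreeAlgebra.ι R (HCGen.c s.lo) - FreeAlgebra.ι R (HCGen.c s.hi)))

/-- The Hecke–Clifford superalgebra `H^c_{r,R}` with parameter `q`. -/
def HC (r : ℕ) (q : R) : Type _ := RingQuot (HCRel r q)

variable {r : ℕ} {q : R}

noncomputable instance : Ring (HC r q) := inferInstanceAs (Ring (RingQuot (HCRel r q)))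
noncomputable instance : Algebra R (HC r q) := inferInstanceAs (Algebra R (RingQuot (HCRel r q)))

/-- The image of a generator. -/
noncomputable def HC.gen (r : ℕ) (q : R) (g : HCGen r) : HC r q :=
  RingQuot.mkAlgHom R (HCRel r q) (FreeAlgebra.ι R g)

/-- The even generator `T_s`. -/
noncomputable def HC.T (q : R) (s : SIdx r) : HC r q := HC.gen r q (HCGen.T s)

/-- The odd generator `c_j`. -/
noncomputable def HC.c (q : R) (j : Fin r) : HC r q := HC.gen r q (HCGen.c j)

/-- The universal property of `H^c`. -/
noncomputable def HC.lift {A : Type*} [Semiring A] [Algebra R A] (f : HCGen r → A)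
    (h : ∀ x y, HCRel r q x y → FreeAlgebra.lift R f x = FreeAlgebra.lift R f y) :
    HC r q →ₐ[R] A :=
  RingQuot.liftAlgHom R ⟨FreeAlgebra.lift R f, fun {x y} => h x y⟩

theorem HC.lift_gen {A : Type*} [Semiring A] [Algebra R A] (f : HCGen r → A)
    (h : ∀ x y, HCRel r q x y → FreeAlgebra.lift R f x = FreeAlgebra.lift R f y) (g : HCGen r) :
    HC.lift (q := q) f h (HC.gen r q g) = f g := by
  unfold HC.lift HC.gen
  exact (RingQuot.liftAlgHom_mkAlgHom_apply R _ _ _).trans (FreeAlgebra.lift_ι_apply f g)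

theorem HC.hom_ext {A : Type*} [Semiring A] [Algebra R A] {f g : HC r q →ₐ[R] A}
    (h : ∀ x, f (HC.gen r q x) = g (HC.gen r q x)) : f = g :=
  RingQuot.ringQuot_ext' R f g (FreeAlgebra.hom_ext (funext h))

theorem HC.rel {x y : FreeAlgebra R (HCGen r)} (h : HCRel r q x y) :
    FreeAlgebra.lift R (HC.gen r q) x = FreeAlgebra.lift R (HC.gen r q) y := by
  have h1 : FreeAlgebra.lift R (HC.gen r q) =
      (RingQuot.mkAlgHom R (HCRel r q) : FreeAlgebra R (HCGen r) →ₐ[R] HC r q) :=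
    FreeAlgebra.hom_ext (by funext g; simp [HC.gen]; rfl)
  rw [h1]; exact RingQuot.mkAlgHom_rel R h

/-- The anti-involution `τ` on generators: `T_s ↦ -T_s + (q - 1)`, `c_j ↦ c_j`. -/
noncomputable def tauGen (r : ℕ) (q : R) : HCGen r → (HC r q)ᵐᵒᵖ
  | HCGen.T s => MulOpposite.op (-HC.T q s + algebraMap R _ (q - 1))
  | HCGen.c j => MulOpposite.op (HC.c q j)

theorem HC.T_sq (s : SIdx r) :
    HC.T q s * HC.T q s = algebraMap R _ (q - 1) * HC.T q s + algebraMap R _ q := by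
  have rel := HC.rel (HCRel.quad (q := q) s)
  simp only [map_mul, map_add, map_sub, map_one, map_zero, FreeAlgebra.lift_ι_apply,
    AlgHom.commutes] at rel
  have h : HC.T q s * HC.T q s - (algebraMap R _ (q - 1) * HC.T q s + algebraMap R _ q) =
      (HC.T q s - algebraMap R _ q) * (HC.T q s + 1) := by
    rw [map_sub, map_one]; noncomm_ring
  exact sub_eq_zero.1 (h.trans rel)

theorem HC.T_c_lo (s : SIdx r) : HC.T q s * HC.c q s.lo = HC.c q s.hi * HC.T q s := by
  have rel := HC.rel (HCRel.T_c_lo (q := q) s)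
  simp only [map_mul, FreeAlgebra.lift_ι_apply] at rel
  exact rel

theorem HC.T_c_hi (s : SIdx r) : HC.T q s * HC.c q s.hi = HC.c q s.lo * HC.T q s -
    algebraMap R _ (q - 1) * (HC.c q s.lo - HC.c q s.hi) := by
  have rel := HC.rel (HCRel.T_c_hi (q := q) s)
  simp only [map_mul, map_sub (FreeAlgebra.lift R _), FreeAlgebra.lift_ι_apply,
    AlgHom.commutes] at rel
  exact rel

theorem braid_aux {A : Type*} [Ring A] (s t k Q : A) (hs : s * k = k * s) (ht : t * k = k * t)
    (hss : s * s = k * s + Q) (htt : t * t = k * t + Q) (h : s * t * s = t * s * t) :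
    (-s + k) * ((-t + k) * (-s + k)) = (-t + k) * ((-s + k) * (-t + k)) := by
  have hs' : ∀ x, s * (k * x) = k * (s * x) := fun x => by rw [← mul_assoc, hs, mul_assoc]
  have ht' : ∀ x, t * (k * x) = k * (t * x) := fun x => by rw [← mul_assoc, ht, mul_assoc]
  rw [mul_assoc, mul_assoc] at h
  simp only [mul_add, add_mul, neg_mul, mul_neg, hs, ht, hs', ht', hss, htt, h]
  abel

theorem tauGen_rel (r : ℕ) (q : R) (x y : FreeAlgebra R (HCGen r)) (h : HCRel r q x y) :
    FreeAlgebra.lift R (tauGen r q) x = FreeAlgebra.lift R (tauGen r q) y := by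
  have hc : ∀ (s : R) (a : HC r q), a * algebraMap R _ s = algebraMap R _ s * a :=
    fun s a => (Algebra.commutes s a).symm
  have rel := HC.rel h
  apply MulOpposite.unop_injective
  cases h <;>
    simp only [map_mul, map_add, map_neg, map_one, map_zero, FreeAlgebra.lift_ι_apply,
      AlgHom.commutes, tauGen, MulOpposite.unop_mul, MulOpposite.unop_op, map_sub (FreeAlgebra.lift R _),
      MulOpposite.unop_neg, MulOpposite.unop_sub, MulOpposite.unop_add, MulOpposite.unop_one,
      MulOpposite.unop_zero, MulOpposite.algebraMap_apply] at rel ⊢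
  case c_sq => exact rel
  case c_anti i j h => exact (neg_eq_iff_eq_neg.1 rel.symm).trans rfl
  case quad s =>
    refine Eq.trans ?_ rel
    rw [map_sub, map_one]
    simp only [HC.T]
    noncomm_ring
  case comm s t h =>
    have rel' : HC.T q s * HC.T q t = HC.T q t * HC.T q s := rel
    simp only [add_mul, mul_add, rel', neg_mul, mul_neg, hc]
    abel
  case braid s t h =>
    have rel' : HC.T q s * HC.T q t * HC.T q s = HC.T q t * HC.T q s * HC.T q t := rel
    exact braid_aux _ _ _ _ (hc _ _) (hc _ _) (HC.T_sq s) (HC.T_sq t) rel'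
  case T_c s j h h' =>
    have rel' : HC.T q s * HC.c q j = HC.c q j * HC.T q s := rel
    simp only [add_mul, mul_add, rel', neg_mul, mul_neg, hc]
  case T_c_lo s =>
    have h2 := HC.T_c_hi (q := q) s
    simp only [add_mul, mul_add, h2, neg_mul, mul_neg, hc, mul_sub]
    abel
  case T_c_hi s =>
    have h2 := HC.T_c_lo (q := q) s
    simp only [add_mul, mul_add, h2, neg_mul, mul_neg, hc, mul_sub]
    simp only [HC.c]
    abel

/-- The anti-involution `τ` of `H^c`, as an algebra map to the opposite algebra. -/
noncomputable def tau (r : ℕ) (q : R) : HC r q →ₐ[R] (HC r q)ᵐᵒᵖ :=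
  HC.lift (tauGen r q) (tauGen_rel r q)

theorem tau_tau (h : HC r q) : (tau r q ((tau r q h).unop)).unop = h := by
  have hT : ∀ g, tau r q (HC.gen r q g) = tauGen r q g := HC.lift_gen _ _
  have key : (AlgHom.opComm (tau r q)).comp (tau r q) = AlgHom.id R (HC r q) := by
    refine HC.hom_ext fun g => ?_
    show (tau r q ((tau r q (HC.gen r q g)).unop)).unop = HC.gen r q g
    rw [hT]
    rcases g with s | j
    · have h1 : tau r q (HC.T q s) = _ := hT (HCGen.T s)
      simp only [tauGen, MulOpposite.unop_op, map_add, map_neg, h1, AlgHom.commutes,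
        MulOpposite.unop_add, MulOpposite.unop_neg, MulOpposite.algebraMap_apply]
      simp only [HC.T]
      abel
    · exact congrArg MulOpposite.unop (hT (HCGen.c j))
  exact DFunLike.congr_fun key h

/-- The parity of a generator: `T_s` is even and `c_j` is odd. -/
def HCGen.par : HCGen r → ZMod 2
  | HCGen.T _ => 0
  | HCGen.c _ => 1

/-- The degree `p` part of the `ℤ/2`-grading of `H^c`: the span of the monomials in the generators
whose total parity is `p`. -/
noncomputable def HC.homog (r : ℕ) (q : R) (p : ZMod 2) : Submodule R (HC r q) :=
  Submodule.span R {h | ∃ l : List (HCGen r),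
    (l.map HCGen.par).sum = p ∧ h = (l.map (HC.gen r q)).prod}

end HeckeClifford

section Action
variable {R : Type*} [CommRing R] {n r : ℕ}

/-- The images of the generators under `Ψ_r`. -/
noncomputable def actGen (n r : ℕ) (v : Rˣ) : HCGen r → Module.End R (⨂[R]^r (V n R))
  | HCGen.T s => opT v s
  | HCGen.c j => opC j

theorem actGen_rel (n r : ℕ) (v : Rˣ) (x y : FreeAlgebra R (HCGen r))
    (h : HCRel r ((v : R) ^ 2) x y) :
    FreeAlgebra.lift R (actGen n r v) x = FreeAlgebra.lift R (actGen n r v) y := by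
  cases h <;>
    simp only [map_mul, map_add, map_sub, map_neg, map_one, map_zero, FreeAlgebra.lift_ι_apply,
      AlgHom.commutes, actGen]
  case c_sq => exact opC_sq _
  case c_anti h => exact opC_anti _ _ h
  case quad => exact opT_quad _ _
  case comm h => exact opT_comm _ _ _ h
  case braid h => exact opT_braid _ _ _ h
  case T_c h h' => exact opT_opC_of_ne _ _ _ h h'
  case T_c_lo => exact opT_opC_lo _ _
  case T_c_hi => exact (opT_opC_hi _ _).trans (by simp only [map_sub, map_one])

/-- The representation `Ψ_r : H^c_{r,R} → End_R(V(n|n)^{⊗ r})`, with `q = v²`. -/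
noncomputable def Psi (n r : ℕ) (v : Rˣ) :
    HC r ((v : R) ^ 2) →ₐ[R] Module.End R (⨂[R]^r (V n R)) :=
  HC.lift (actGen n r v) (actGen_rel n r v)

/-- The tensor superspace `V(n|n)^{⊗ r}`; the unit `v` fixes the action of `H^c_{r,R}`. -/
def TensorSpace (n r : ℕ) (_v : Rˣ) : Type _ := ⨂[R]^r (V n R)

variable {v : Rˣ}

noncomputable instance : AddCommGroup (TensorSpace n r v) :=
  inferInstanceAs (AddCommGroup (⨂[R]^r (V n R)))
noncomputable instance : Module R (TensorSpace n r v) :=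
  inferInstanceAs (Module R (⨂[R]^r (V n R)))

/-- The left `H^c`-module structure `h · m = Ψ_r(h) m`. -/
noncomputable instance : Module (HC r ((v : R) ^ 2)) (TensorSpace n r v) where
  smul h m := Psi n r v h m
  one_smul m := congrArg (fun f : Module.End R (⨂[R]^r (V n R)) => f m) (map_one (Psi n r v))
  mul_smul h h' m :=
    congrArg (fun f : Module.End R (⨂[R]^r (V n R)) => f m) (map_mul (Psi n r v) h h')
  smul_zero h := map_zero (Psi n r v h)
  smul_add h m m' := map_add (Psi n r v h) m m'
  add_smul h h' m :=
    congrArg (fun f : Module.End R (⨂[R]^r (V n R)) => f m) (map_add (Psi n r v) h h')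
  zero_smul m := congrArg (fun f : Module.End R (⨂[R]^r (V n R)) => f m) (map_zero (Psi n r v))

instance : IsScalarTower R (HC r ((v : R) ^ 2)) (TensorSpace n r v) where
  smul_assoc a h m :=
    congrArg (fun f : Module.End R (⨂[R]^r (V n R)) => f m) (map_smul (Psi n r v) a h)

/-- The degree `p` part of `V(n|n)^{⊗ r}`. -/
noncomputable def TensorSpace.homog (n r : ℕ) (v : Rˣ) (p : ZMod 2) :
    Submodule R (TensorSpace n r v) :=
  Submodule.span R {m | ∃ x : Fin r → Ix n, (∑ k, ((x k).par : ZMod 2)) = p ∧ m = eT R x}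

theorem TensorSpace.T_smul (s : SIdx r) (m : TensorSpace n r v) :
    (HC.T ((v : R) ^ 2) s • m : TensorSpace n r v) = opT v s m :=
  congrArg (fun f : Module.End R (⨂[R]^r (V n R)) => f m)
    (HC.lift_gen (actGen n r v) (actGen_rel n r v) (HCGen.T s))

theorem TensorSpace.c_smul (j : Fin r) (m : TensorSpace n r v) :
    (HC.c ((v : R) ^ 2) j • m : TensorSpace n r v) = opC (R := R) j m :=
  congrArg (fun f : Module.End R (⨂[R]^r (V n R)) => f m)
    (HC.lift_gen (actGen n r v) (actGen_rel n r v) (HCGen.c j))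

end Action

section Twist

variable {R : Type*} [CommRing R] {r : ℕ} {q : R}

/-- The right module `M^τ` of a left `H^c`-module `M`: the same `R`-module, `m · h = τ(h) m`.
Right `H^c`-modules are modules over the opposite algebra. -/
def TauTwist {R : Type*} [CommRing R] (r : ℕ) (q : R) (M : Type*) [AddCommGroup M]
    [Module (HC r q) M] : Type _ := M

variable {M : Type*} [AddCommGroup M] [Module R M] [Module (HC r q) M] [IsScalarTower R (HC r q) M]

instance : AddCommGroup (TauTwist r q M) := inferInstanceAs (AddCommGroup M)
instance : Module R (TauTwist r q M) := inferInstanceAs (Module R M)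

noncomputable instance : Module (HC r q)ᵐᵒᵖ (TauTwist r q M) where
  smul h m := ((tau r q h.unop).unop • (show M from m) : M)
  one_smul m := by
    change ((tau r q (1 : HC r q)).unop • (show M from m) : M) = m
    rw [map_one]; exact one_smul _ _
  mul_smul h h' m := by
    change ((tau r q (h'.unop * h.unop)).unop • (show M from m) : M) =
      (tau r q h.unop).unop • ((tau r q h'.unop).unop • (show M from m) : M)
    rw [map_mul]; exact mul_smul _ _ _
  smul_zero h := smul_zero (A := M) (tau r q h.unop).unop
  smul_add h m m' := smul_add (A := M) (tau r q h.unop).unop m m'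
  add_smul h h' m := by
    change ((tau r q (h.unop + h'.unop)).unop • (show M from m) : M) =
      (tau r q h.unop).unop • (show M from m) + (tau r q h'.unop).unop • (show M from m)
    rw [map_add]; exact add_smul _ _ _
  zero_smul m := by
    change ((tau r q (0 : HC r q)).unop • (show M from m) : M) = (0 : M)
    rw [map_zero]; exact zero_smul _ _

instance : IsScalarTower R (HC r q)ᵐᵒᵖ (TauTwist r q M) where
  smul_assoc a h m := by
    change ((tau r q (a • h.unop)).unop • (show M from m) : M) =
      a • ((tau r q h.unop).unop • (show M from m) : M)
    rw [map_smul]; exact smul_assoc _ _ _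

end Twist

section Permutation

/-- The set `Λ(n,r)` of compositions of `r` with `n` parts. -/
abbrev Comp (n r : ℕ) : Type := {l : Fin n → ℕ // ∑ i, l i = r}

/-- The `a`-th block of consecutive points of `{0, …, r-1}` cut out by a composition. -/
def Comp.block {n r : ℕ} (l : Comp n r) (a : Fin n) : Set (Fin r) :=
  {k | ∑ b with b < a, l.1 b ≤ (k : ℕ) ∧ (k : ℕ) < ∑ b with b ≤ a, l.1 b}

/-- The standard Young subgroup: the permutations which preserve every block. -/
def Comp.young {n r : ℕ} (l : Comp n r) : Subgroup (Equiv.Perm (Fin r)) where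
  carrier := {w | ∀ a k, w k ∈ l.block a ↔ k ∈ l.block a}
  mul_mem' {w w'} h h' a k := by
    rw [Equiv.Perm.mul_apply]
    exact (h a (w' k)).trans (h' a k)
  one_mem' _ _ := Iff.rfl
  inv_mem' {w} h a k := by
    have := h a (w⁻¹ k)
    rw [← Equiv.Perm.mul_apply, mul_inv_cancel, Equiv.Perm.one_apply] at this
    exact this.symm

/-- The simple transposition `s_i`. -/
def simpleTransp {r : ℕ} (s : SIdx r) : Equiv.Perm (Fin r) := Equiv.swap s.lo s.hi

/-- `l` is a reduced expression of `w`: a shortest word in the simple transpositions with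
product `w`. -/
def IsReducedWord {r : ℕ} (l : List (SIdx r)) (w : Equiv.Perm (Fin r)) : Prop :=
  (l.map simpleTransp).prod = w ∧
    ∀ l' : List (SIdx r), (l'.map simpleTransp).prod = w → l.length ≤ l'.length

theorem exists_word {r : ℕ} (w : Equiv.Perm (Fin r)) :
    ∃ l : List (SIdx r), (l.map simpleTransp).prod = w := by
  rcases r with _ | r
  · exact ⟨[], Subsingleton.elim _ _⟩
  · have hw : w ∈ Submonoid.closure
        (Set.range fun i : Fin r => Equiv.swap i.castSucc i.succ) := by
      rw [Equiv.Perm.mclosure_swap_castSucc_succ]; trivial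
    induction hw using Submonoid.closure_induction with
    | mem x hx =>
      obtain ⟨i, rfl⟩ := hx
      exact ⟨[⟨i, by omega⟩], by simp [simpleTransp]; rfl⟩
    | one => exact ⟨[], rfl⟩
    | mul x y _ _ hx hy =>
      obtain ⟨l, hl⟩ := hx
      obtain ⟨l', hl'⟩ := hy
      exact ⟨l ++ l', by simp [hl, hl']⟩

theorem exists_reducedWord {r : ℕ} (w : Equiv.Perm (Fin r)) :
    ∃ l : List (SIdx r), IsReducedWord l w := by
  classical
  have h : ∃ m, ∃ l : List (SIdx r), (l.map simpleTransp).prod = w ∧ l.length = m := by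
    obtain ⟨l, hl⟩ := exists_word w
    exact ⟨_, l, hl, rfl⟩
  obtain ⟨l, hl, hm⟩ := Nat.find_spec h
  exact ⟨l, hl, fun l' hl' => hm ▸ Nat.find_min' h ⟨l', hl', rfl⟩⟩

variable {R : Type*} [CommRing R]

/-- `T_w = T_{s_{i_1}} ⋯ T_{s_{i_k}}` for a reduced expression `w = s_{i_1} ⋯ s_{i_k}`. -/
noncomputable def HC.Tw {r : ℕ} (q : R) (w : Equiv.Perm (Fin r)) : HC r q :=
  ((exists_reducedWord w).choose.map (HC.T q)).prod

open Classical in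
/-- `x_λ = ∑_{w ∈ S_λ} T_w`. -/
noncomputable def xElt {n r : ℕ} (q : R) (l : Comp n r) : HC r q :=
  ∑ w with w ∈ l.young, HC.Tw q w

/-- The right submodule `x_λ H^c` of `H^c`. -/
noncomputable def permModule {n r : ℕ} (q : R) (l : Comp n r) : Submodule (HC r q)ᵐᵒᵖ (HC r q) :=
  Submodule.span (HC r q)ᵐᵒᵖ {xElt q l}

/-- The right module `⨁_{λ ∈ Λ(n,r)} x_λ H^c`. -/
abbrev PermSum (n r : ℕ) (q : R) : Type _ :=
  DirectSum (Comp n r) fun l => permModule q l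

/-- The degree `p` part of `⨁_{λ ∈ Λ(n,r)} x_λ H^c`. -/
noncomputable def PermSum.homog (n r : ℕ) (q : R) (p : ZMod 2) : Submodule R (PermSum n r q) where
  carrier := {x | ∀ l, (x l : HC r q) ∈ HC.homog r q p}
  add_mem' {x y} hx hy l := by
    simpa using (HC.homog r q p).add_mem (hx l) (hy l)
  zero_mem' l := by simp
  smul_mem' a x hx l := (HC.homog r q p).smul_mem a (hx l)

/-- The Q-q-Schur superalgebra `Q_q(n,r;R)`: all endomorphisms of the right module
`⨁_{λ ∈ Λ(n,r)} x_λ H^c`. -/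
abbrev QqSchurAlg (n r : ℕ) (q : R) : Type _ := Module.End (HC r q)ᵐᵒᵖ (PermSum n r q)

/-- The algebra `End_{H^c}(V(n|n)^{⊗ r})` of all endomorphisms of the left module
`V(n|n)^{⊗ r}`. -/
abbrev TensorEnd (n r : ℕ) (v : Rˣ) : Type _ :=
  Module.End (HC r ((v : R) ^ 2)) (TensorSpace n r v)

/-- The map `f` is homogeneous of degree `p` with respect to the gradings `A` and `B`. -/
def IsHomogMap {M N : Type*} [AddCommGroup M] [Module R M] [AddCommGroup N] [Module R N]
    (A : ZMod 2 → Submodule R M) (B : ZMod 2 → Submodule R N) (p : ZMod 2) (f : M → N) : Prop :=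
  ∀ s, ∀ m ∈ A s, f m ∈ B (s + p)

end Permutation

section Generic

open LaurentPolynomial

/-- The indeterminate `v` of `ℤ[v, v⁻¹]`, as a unit. -/
noncomputable def vGen : (LaurentPolynomial ℤ)ˣ where
  val := LaurentPolynomial.T 1
  inv := LaurentPolynomial.T (-1)
  val_inv := by rw [← LaurentPolynomial.T_add]; simp
  inv_val := by rw [← LaurentPolynomial.T_add]; simp

/-- The quantum queer Schur superalgebra `End_{H^c}(V(n|n)^{⊗ r})` over `ℤ[v, v⁻¹]`. -/
abbrev QuantumQueerSchur (n r : ℕ) : Type _ := TensorEnd n r vGen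

end Generic

end QqSchur

/-! Both modules are compared inside copies of one larger module, the tensor power of V(r|r). Write
q = v². Encode a basis vector by its signs and its reversed absolute values y. On vectors with all
entries negative, τ(T_s) = (q-1) - T_s acts as right multiplication by T_s on cosets: it sends e_y
to v e_{ys} if y increases at s, and to q e_y if the two entries agree. This is why τ, negative
signs and reversed absolute values appear together.

The regular vector e, negative with reversed absolute values 0, …, r-1, gives `regMap`, h ↦ τ(h)e.
It sends T_w to v^{ℓ(w)} e_w. The Hecke–Clifford relations reduce every product to a Hecke normal
form times a Clifford normal form, so r!·2^r elements span the algebra (`HC.spannedBy_top`). The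
image of `regMap` contains the r!·2^r basis vectors whose absolute values form a permutation.
Projecting to those coordinates gives a surjective endomorphism of a free module of finite rank,
which must be injective; hence `regMap` is injective (`regMap_injective`), and each x_λ H^c embeds
in the larger tensor power.

In the other direction, let f be the weakly increasing block function of λ. If y = f∘d with d of
minimal length, then e_y should correspond to v^{-ℓ(y)} x_λ T_d, where x_λ T_d is the sum of T_z
over all z with f∘z = y. Read through `regMap`, this prescription is `foldMap`; it is linear over
the algebra (`foldMap_T_smul`, `foldMap_c_smul`). The target basis vectors record both signs and z,
so y can be recovered, and the family of these maps over all λ is injective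
(`repr_eq_zero_of_foldMap`).

The two embeddings into the product over λ have the same image (`range_foldHom`): the sorted
negative vector of content λ and the generator x_λ have equal images (`regHom_permGen`), and these
elements generate the two modules. Composing one embedding with the inverse of the other gives θ.
The parity shift is r because the regular vector has r odd entries. Conjugation by θ cancels the
shift, so the endomorphism algebras agree as superalgebras. -/

namespace QqSchur

/-! ### Spanning sets from Hecke and Clifford normal forms -/

section Spanning

variable {R A : Type*} [CommRing R] [Ring A] [Algebra R A]

/-- `P` is spanned by at most `N` elements. -/
def SpannedBy (N : ℕ) (P : Submodule R A) : Prop :=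
  ∃ g : Fin N → A, Submodule.span R (Set.range g) = P

theorem SpannedBy.mul {N M : ℕ} {P Q : Submodule R A} (hP : SpannedBy N P) (hQ : SpannedBy M Q) :
    SpannedBy (N * M) (P * Q) := by
  obtain ⟨g, rfl⟩ := hP
  obtain ⟨h, rfl⟩ := hQ
  refine ⟨fun i => g (finProdFinEquiv.symm i).1 * h (finProdFinEquiv.symm i).2, ?_⟩
  rw [Submodule.span_mul_span]
  congr 1
  ext x
  simp only [Set.mem_range, Set.mem_mul]
  constructor
  · rintro ⟨i, rfl⟩
    exact ⟨_, ⟨_, rfl⟩, _, ⟨_, rfl⟩, rfl⟩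
  · rintro ⟨_, ⟨i, rfl⟩, _, ⟨j, rfl⟩, rfl⟩
    exact ⟨finProdFinEquiv (i, j), by simp⟩

theorem SpannedBy.one : SpannedBy 1 (1 : Submodule R A) :=
  ⟨fun _ => 1, by rw [Set.range_const, Submodule.one_eq_span]⟩

/-- `t_{m-1} t_{m-2} ⋯ t_k`. -/
def descProd (t : ℕ → A) : ℕ → ℕ → A
  | 0, _ => 1
  | m + 1, k => if m + 1 ≤ k then 1 else t m * descProd t m k

theorem descProd_of_le (t : ℕ → A) {m k : ℕ} (h : m ≤ k) : descProd t m k = 1 := by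
  cases m with
  | zero => rfl
  | succ m => simp [descProd, h]

theorem descProd_succ (t : ℕ → A) {m k : ℕ} (h : k ≤ m) :
    descProd t (m + 1) k = t m * descProd t m k := by
  simp [descProd, h]

/-- The span of the normal forms of the Hecke algebra on the generators `t_i`, `i + 1 < m`. -/
def heckeSpan (R : Type*) [CommRing R] [Algebra R A] (t : ℕ → A) : ℕ → Submodule R A
  | 0 => 1
  | m + 1 => heckeSpan R t m * Submodule.span R (Set.range fun k : Fin (m + 1) => descProd t m k)

theorem spannedBy_heckeSpan (t : ℕ → A) (m : ℕ) : SpannedBy m.factorial (heckeSpan R t m) := by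
  induction m with
  | zero => exact SpannedBy.one
  | succ m ih =>
    rw [Nat.factorial_succ, mul_comm]
    exact ih.mul ⟨_, rfl⟩

section Hecke

variable {t : ℕ → A} {r : ℕ} {a b : R}

theorem descProd_mul_far (hcomm : ∀ i j, i + 1 < j → j + 1 < r → t i * t j = t j * t i) {m k i : ℕ}
    (hm : m ≤ i) (hi : i + 2 < r) : descProd t m k * t (i + 1) = t (i + 1) * descProd t m k := by
  induction m with
  | zero => simp [descProd]
  | succ m ih =>
    unfold descProd
    split_ifs
    · simp
    · rw [mul_assoc, ih (by omega), ← mul_assoc, hcomm m (i + 1) (by omega) (by omega), mul_assoc]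

theorem descProd_mul_lt (hcomm : ∀ i j, i + 1 < j → j + 1 < r → t i * t j = t j * t i) {m k i : ℕ}
    (hm : m < r) (hk : i + 1 < k) (hkm : k ≤ m) : descProd t m k * t i = t i * descProd t m k := by
  induction m with
  | zero => simp [descProd]
  | succ m ih =>
    unfold descProd
    split_ifs
    · simp
    · rw [mul_assoc, ih (by omega) (by omega), ← mul_assoc, ← hcomm i m (by omega) (by omega),
        mul_assoc]

theorem descProd_mul_pred {m i : ℕ} (him : i < m) :
    descProd t m (i + 1) * t i = descProd t m i := by
  induction m with
  | zero => omega
  | succ m ih =>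
    rcases Nat.lt_or_ge i m with h | h
    · rw [descProd_succ t (by omega), mul_assoc, ih h, descProd_succ t (by omega)]
    · obtain rfl : i = m := by omega
      rw [descProd_of_le t le_rfl, descProd_succ t le_rfl, descProd_of_le t le_rfl, one_mul,
        mul_one]

/-- Letters above `t (i + 1)` in the descending product commute with `t i`, so they can be peeled
off until the product begins t_{i+1} t_i. The remaining letters commute with the incoming t_{i+1},
and one braid relation finishes. -/
theorem descProd_mul_gt (hcomm : ∀ i j, i + 1 < j → j + 1 < r → t i * t j = t j * t i)
    (hbraid : ∀ i, i + 2 < r → t i * t (i + 1) * t i = t (i + 1) * t i * t (i + 1)) {m k i : ℕ}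
    (hm : m < r) (hk : k ≤ i) (him : i + 1 < m) :
    descProd t m k * t (i + 1) = t i * descProd t m k := by
  induction m with
  | zero => omega
  | succ m ih =>
    rcases Nat.lt_or_ge (i + 1) m with h | h
    · rw [descProd_succ t (by omega), mul_assoc, ih (by omega) h, ← mul_assoc,
        ← hcomm i m (by omega) (by omega), mul_assoc]
    · obtain rfl : m = i + 1 := by omega
      rw [descProd_succ t (by omega), descProd_succ t hk, mul_assoc, mul_assoc,
        descProd_mul_far hcomm le_rfl (by omega), ← mul_assoc, ← mul_assoc, ← hbraid i (by omega)]
      simp only [mul_assoc]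

/-- The normal forms follow the decomposition of S_{m+1} into right cosets of S_m with
representatives s_{m-1} ⋯ s_k. Right multiplication by a generator either changes the representative
or passes through it to a generator of the smaller algebra. -/
theorem heckeSpan_mul_gen (hquad : ∀ i, i + 1 < r → t i * t i = a • t i + b • 1)
    (hcomm : ∀ i j, i + 1 < j → j + 1 < r → t i * t j = t j * t i)
    (hbraid : ∀ i, i + 2 < r → t i * t (i + 1) * t i = t (i + 1) * t i * t (i + 1)) {m : ℕ}
    (hm : m ≤ r) {i : ℕ} (him : i + 1 < m) {x : A} (hx : x ∈ heckeSpan R t m) :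
    x * t i ∈ heckeSpan R t m := by
  induction m generalizing i x with
  | zero => omega
  | succ m ih =>
    have hmem : ∀ y ∈ heckeSpan R t m, ∀ k, k ≤ m → y * descProd t m k ∈ heckeSpan R t (m + 1) :=
      fun y hy k hk => Submodule.mul_mem_mul hy
        (Submodule.subset_span ⟨⟨k, by omega⟩, rfl⟩)
    refine Submodule.mul_induction_on hx (fun y hy d hd => ?_) (fun y z hy hz => ?_)
    · induction hd using Submodule.span_induction with
      | zero => simp
      | add d e _ _ hd he => rw [mul_add, add_mul]; exact add_mem hd he
      | smul s d _ hd => rw [mul_smul_comm, smul_mul_assoc]; exact Submodule.smul_mem _ _ hd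
      | mem d hd =>
        obtain ⟨⟨k, hk⟩, rfl⟩ := hd
        simp only
        rw [mul_assoc]
        -- For D = t_{m-1} ⋯ t_k: if k < i then D t_i = t_{i-1} D; if k = i the last letter repeats
        -- and the quadratic relation applies; if k = i + 1 the product grows by one letter; if k >
        -- i + 1 then t_i commutes with D.
        rcases lt_trichotomy k i with h | h | h
        · obtain ⟨j, rfl⟩ : ∃ j, i = j + 1 := ⟨i - 1, by omega⟩
          rw [descProd_mul_gt hcomm hbraid (by omega) (by omega) (by omega), ← mul_assoc]
          exact hmem _ (ih (by omega) (by omega) hy) _ (by omega)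
        · subst h
          rw [← descProd_mul_pred (t := t) (by omega), mul_assoc, hquad _ (by omega), mul_add,
            mul_add, mul_smul_comm, mul_smul_comm, mul_smul_comm, mul_smul_comm, mul_one,
            descProd_mul_pred (by omega)]
          exact add_mem (Submodule.smul_mem _ _ (hmem _ hy _ (by omega)))
            (Submodule.smul_mem _ _ (hmem _ hy _ (by omega)))
        · rcases Nat.lt_or_ge (i + 1) k with h' | h'
          · rw [descProd_mul_lt hcomm (by omega) h' (by omega), ← mul_assoc]
            exact hmem _ (ih (by omega) (by omega) hy) _ (by omega)
          · obtain rfl : k = i + 1 := by omega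
            rw [descProd_mul_pred (by omega)]
            exact hmem _ hy _ (by omega)
    · rw [add_mul]; exact add_mem hy hz

theorem one_mem_heckeSpan (m : ℕ) : (1 : A) ∈ heckeSpan R t m := by
  induction m with
  | zero => exact Submodule.one_le.1 le_rfl
  | succ m ih =>
    rw [← mul_one (1 : A)]
    refine Submodule.mul_mem_mul ih (Submodule.subset_span ⟨Fin.last m, ?_⟩)
    simp [descProd_of_le]

end Hecke

/-- The span of the normal forms of the Clifford algebra on the generators `c_i`, `i < m`. -/
def cliffordSpan (R : Type*) [CommRing R] [Algebra R A] (c : ℕ → A) : ℕ → Submodule R A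
  | 0 => 1
  | m + 1 => cliffordSpan R c m * Submodule.span R (Set.range ![1, c m])

theorem spannedBy_cliffordSpan (c : ℕ → A) (m : ℕ) : SpannedBy (2 ^ m) (cliffordSpan R c m) := by
  induction m with
  | zero => exact SpannedBy.one
  | succ m ih => exact (pow_succ 2 m) ▸ ih.mul ⟨_, rfl⟩

section Clifford

variable {c : ℕ → A} {r : ℕ}

theorem cliffordSpan_le_succ (m : ℕ) : cliffordSpan R c m ≤ cliffordSpan R c (m + 1) := by
  intro x hx
  rw [← mul_one x]
  exact Submodule.mul_mem_mul hx (Submodule.subset_span ⟨0, rfl⟩)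

theorem one_mem_cliffordSpan (m : ℕ) : (1 : A) ∈ cliffordSpan R c m := by
  induction m with
  | zero => exact Submodule.one_le.1 le_rfl
  | succ m ih => exact cliffordSpan_le_succ m ih

theorem cliffordSpan_succ_induction {m : ℕ} {P : Submodule R A}
    (h : ∀ y ∈ cliffordSpan R c m, y ∈ P ∧ y * c m ∈ P) : cliffordSpan R c (m + 1) ≤ P := by
  refine Submodule.mul_le.2 fun y hy d hd => ?_
  induction hd using Submodule.span_induction with
  | zero => simp
  | add d e _ _ hd he => rw [mul_add]; exact add_mem hd he
  | smul s d _ hd => rw [mul_smul_comm]; exact Submodule.smul_mem _ _ hd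
  | mem d hd =>
    obtain ⟨k, rfl⟩ := hd
    fin_cases k
    · simpa using (h y hy).1
    · exact (h y hy).2

theorem cliffordSpan_mul_gen (hsq : ∀ i, i < r → c i * c i = -1)
    (hanti : ∀ i j, i < r → j < r → i ≠ j → c i * c j = -(c j * c i)) {m : ℕ}
    (hm : m ≤ r) {i : ℕ} (him : i < m) {x : A} (hx : x ∈ cliffordSpan R c m) :
    x * c i ∈ cliffordSpan R c m := by
  induction m generalizing i x with
  | zero => omega
  | succ m ih =>
    have hmem : ∀ y ∈ cliffordSpan R c m, y * c m ∈ cliffordSpan R c (m + 1) :=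
      fun y hy => Submodule.mul_mem_mul hy (Submodule.subset_span ⟨1, rfl⟩)
    have := cliffordSpan_succ_induction
      (P := (cliffordSpan R c (m + 1)).comap (LinearMap.mulRight R (c i))) (c := c) (m := m)
      fun y hy => ?_
    · exact this hx
    simp only [Submodule.mem_comap, LinearMap.mulRight_apply]
    rcases Nat.lt_or_ge i m with h | h
    · have h1 := ih (by omega) h hy
      refine ⟨cliffordSpan_le_succ m h1, ?_⟩
      rw [mul_assoc, hanti m i (by omega) (by omega) (by omega), mul_neg, ← mul_assoc]
      exact neg_mem (hmem _ h1)
    · obtain rfl : i = m := by omega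
      refine ⟨hmem y hy, ?_⟩
      rw [mul_assoc, hsq i (by omega), mul_neg, mul_one]
      exact neg_mem (cliffordSpan_le_succ i hy)

/-- Moving t leftwards past one Clifford generator costs only a relabelling and Clifford terms
without t; induction on m collects these into y and z. Relabelling may leave the first m generators,
so y and z are sought in the full span on r generators. -/
theorem cliffordSpan_mul_even (hsq : ∀ i, i < r → c i * c i = -1)
    (hanti : ∀ i j, i < r → j < r → i ≠ j → c i * c j = -(c j * c i)) (t : A)
    (ht : ∀ i < r, ∃ j < r, ∃ k < r, ∃ l < r, ∃ a b : R, c i * t = t * c j + a • c k + b • c l)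
    {m : ℕ} (hm : m ≤ r) {x : A} (hx : x ∈ cliffordSpan R c m) :
    ∃ y ∈ cliffordSpan R c r, ∃ z ∈ cliffordSpan R c r, x * t = t * y + z := by
  let P : Submodule R A :=
    { carrier := {x | ∃ y ∈ cliffordSpan R c r, ∃ z ∈ cliffordSpan R c r, x * t = t * y + z}
      add_mem' := by
        rintro x x' ⟨y, hy, z, hz, h⟩ ⟨y', hy', z', hz', h'⟩
        exact ⟨_, add_mem hy hy', _, add_mem hz hz', by rw [add_mul, h, h']; noncomm_ring⟩
      zero_mem' := ⟨0, zero_mem _, 0, zero_mem _, by simp⟩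
      smul_mem' := by
        rintro s x ⟨y, hy, z, hz, h⟩
        exact ⟨_, Submodule.smul_mem _ s hy, _, Submodule.smul_mem _ s hz, by
          rw [smul_mul_assoc, h, smul_add, mul_smul_comm]⟩ }
  have hmono : ∀ m ≤ r, cliffordSpan R c m ≤ cliffordSpan R c r := by
    intro m hm
    exact monotone_nat_of_le_succ cliffordSpan_le_succ hm
  suffices ∀ m ≤ r, cliffordSpan R c m ≤ P from this m hm hx
  clear hx hm
  intro m
  induction m with
  | zero =>
    intro _
    refine Submodule.one_le.2 ⟨1, one_mem_cliffordSpan r, 0, zero_mem _, by simp⟩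
  | succ m ih =>
    intro hm
    refine cliffordSpan_succ_induction fun w hw => ⟨ih (by omega) hw, ?_⟩
    obtain ⟨y, hy, z, hz, h⟩ := ih (by omega) hw
    obtain ⟨j, hj, k, hk, l, hl, a, b, h'⟩ := ht m (by omega)
    have hw' := hmono m (by omega) hw
    refine ⟨y * c j, cliffordSpan_mul_gen hsq hanti le_rfl hj hy,
      z * c j + a • (w * c k) + b • (w * c l),
      add_mem (add_mem (cliffordSpan_mul_gen hsq hanti le_rfl hj hz)
        (Submodule.smul_mem _ _ (cliffordSpan_mul_gen hsq hanti le_rfl hk hw')))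
        (Submodule.smul_mem _ _ (cliffordSpan_mul_gen hsq hanti le_rfl hl hw')), ?_⟩
    rw [mul_assoc, h', mul_add, mul_add, ← mul_assoc, h, mul_smul_comm, mul_smul_comm]
    noncomm_ring

end Clifford

end Spanning

/-! ### Spanning the Hecke–Clifford superalgebra -/

section HeckeClifford

variable {R : Type*} [CommRing R] {r : ℕ} {q : R}

theorem HC.induction {P : HC r q → Prop} (h : HC r q) (halg : ∀ a : R, P (algebraMap R _ a))
    (hgen : ∀ g, P (HC.gen r q g)) (hadd : ∀ x y, P x → P y → P (x + y))
    (hmul : ∀ x y, P x → P y → P (x * y)) : P h := by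
  obtain ⟨f, rfl⟩ := RingQuot.mkAlgHom_surjective R (HCRel r q) h
  induction f using FreeAlgebra.induction with
  | grade0 a => rw [AlgHom.commutes]; exact halg a
  | grade1 g => exact hgen g
  | mul x y hx hy =>
    rw [show RingQuot.mkAlgHom R (HCRel r q) (x * y) = RingQuot.mkAlgHom R (HCRel r q) x *
      RingQuot.mkAlgHom R (HCRel r q) y from map_mul _ _ _]
    exact hmul _ _ hx hy
  | add x y hx hy =>
    rw [show RingQuot.mkAlgHom R (HCRel r q) (x + y) = RingQuot.mkAlgHom R (HCRel r q) x +
      RingQuot.mkAlgHom R (HCRel r q) y from map_add _ _ _]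
    exact hadd _ _ hx hy

theorem HC.eq_top_of_mul_gen (P : Submodule R (HC r q)) (h1 : (1 : HC r q) ∈ P)
    (hT : ∀ x ∈ P, ∀ s, x * HC.T q s ∈ P) (hc : ∀ x ∈ P, ∀ j, x * HC.c q j ∈ P) : P = ⊤ := by
  refine Submodule.eq_top_iff'.2 fun h => ?_
  suffices ∀ x ∈ P, x * h ∈ P by simpa using this 1 h1
  refine HC.induction (P := fun h => ∀ x ∈ P, x * h ∈ P) h (fun a x hx => ?_) (fun g => ?_)
    (fun y z hy hz x hx => ?_) (fun y z hy hz x hx => ?_)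
  · rw [← Algebra.commutes, ← Algebra.smul_def]; exact P.smul_mem a hx
  · rcases g with s | j
    · exact fun x hx => hT x hx s
    · exact fun x hx => hc x hx j
  · rw [mul_add]; exact add_mem (hy x hx) (hz x hx)
  · rw [← mul_assoc]; exact hz _ (hy x hx)

theorem HC.c_sq (j : Fin r) : HC.c q j * HC.c q j = -1 := by
  have rel := HC.rel (HCRel.c_sq (q := q) j)
  simp only [map_mul, map_neg, map_one, FreeAlgebra.lift_ι_apply] at rel
  exact rel

theorem HC.c_anti (i j : Fin r) (h : i ≠ j) : HC.c q i * HC.c q j = -(HC.c q j * HC.c q i) := by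
  have rel := HC.rel (HCRel.c_anti (q := q) i j h)
  simp only [map_mul, map_neg, map_one, FreeAlgebra.lift_ι_apply] at rel
  exact rel

theorem HC.T_comm (s t : SIdx r) (h : s.1 + 1 < t.1) :
    HC.T q s * HC.T q t = HC.T q t * HC.T q s := by
  have rel := HC.rel (HCRel.comm (q := q) s t h)
  simp only [map_mul, FreeAlgebra.lift_ι_apply] at rel
  exact rel

theorem HC.T_braid (s t : SIdx r) (h : t.1 = s.1 + 1) :
    HC.T q s * HC.T q t * HC.T q s = HC.T q t * HC.T q s * HC.T q t := by
  have rel := HC.rel (HCRel.braid (q := q) s t h)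
  simp only [map_mul, FreeAlgebra.lift_ι_apply] at rel
  exact rel

theorem HC.T_c (s : SIdx r) (j : Fin r) (h : j ≠ s.lo) (h' : j ≠ s.hi) :
    HC.T q s * HC.c q j = HC.c q j * HC.T q s := by
  have rel := HC.rel (HCRel.T_c (q := q) s j h h')
  simp only [map_mul, FreeAlgebra.lift_ι_apply] at rel
  exact rel

/-- The product of the two normal-form spans contains 1 and is stable under right multiplication by
every generator: T_s is first moved left past the Clifford factor and then absorbed by the Hecke
factor. Only this upper bound on the rank is needed here; the tensor representation supplies the
matching lower bound. -/
theorem HC.spannedBy_top : SpannedBy (r.factorial * 2 ^ r) (⊤ : Submodule R (HC r q)) := by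
  -- The value 0 outside the valid range never enters: the spans at level r use only genuine
  -- generators.
  let t : ℕ → HC r q := fun i => if h : i + 1 < r then HC.T q ⟨i, h⟩ else 0
  let c : ℕ → HC r q := fun i => if h : i < r then HC.c q ⟨i, h⟩ else 0
  have ht : ∀ s : SIdx r, HC.T q s = t s.1 := fun s => by simp [t, s.2]
  have hc : ∀ j : Fin r, HC.c q j = c j := fun j => by simp [c]
  have hquad : ∀ i, i + 1 < r → t i * t i = (q - 1) • t i + q • 1 := fun i hi => by
    simp only [t, hi, dif_pos, HC.T_sq, Algebra.smul_def, mul_one]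
  have hcomm : ∀ i j, i + 1 < j → j + 1 < r → t i * t j = t j * t i := fun i j hij hj => by
    have hi : i + 1 < r := by omega
    simp only [t, hi, hj, dif_pos]
    exact HC.T_comm _ _ hij
  have hbraid : ∀ i, i + 2 < r → t i * t (i + 1) * t i = t (i + 1) * t i * t (i + 1) :=
    fun i hi => by
      have hi' : i + 1 < r := by omega
      simp only [t, hi', show i + 1 + 1 < r from hi, dif_pos]
      exact HC.T_braid _ _ rfl
  have hsq : ∀ i, i < r → c i * c i = -1 := fun i hi => by
    simp only [c, hi, dif_pos]; exact HC.c_sq _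
  have hanti : ∀ i j, i < r → j < r → i ≠ j → c i * c j = -(c j * c i) := fun i j hi hj h => by
    simp only [c, hi, hj, dif_pos]; exact HC.c_anti _ _ (by simpa using h)
  have hct : ∀ s : SIdx r, ∀ i < r, ∃ j < r, ∃ k < r, ∃ l < r, ∃ a b : R,
      c i * HC.T q s = HC.T q s * c j + a • c k + b • c l := by
    intro s i hi
    have hlo := s.lo.2
    have hhi := s.hi.2
    by_cases h1 : (⟨i, hi⟩ : Fin r) = s.lo
    · refine ⟨s.hi, hhi, s.lo, hlo, s.hi, hhi, q - 1, -(q - 1), ?_⟩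
      have : c i = HC.c q s.lo := by rw [← h1, hc]
      rw [this, ← hc, ← hc, HC.T_c_hi, neg_smul, Algebra.smul_def, Algebra.smul_def]
      noncomm_ring
    by_cases h2 : (⟨i, hi⟩ : Fin r) = s.hi
    · refine ⟨s.lo, hlo, s.lo, hlo, s.hi, hhi, 0, 0, ?_⟩
      have : c i = HC.c q s.hi := by rw [← h2, hc]
      rw [this, ← hc, ← hc, HC.T_c_lo, zero_smul, zero_smul, add_zero, add_zero]
    · refine ⟨i, hi, i, hi, i, hi, 0, 0, ?_⟩
      have : c i = HC.c q ⟨i, hi⟩ := (hc ⟨i, hi⟩).symm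
      rw [this, HC.T_c s _ h1 h2, zero_smul, add_zero, add_zero]
  have := ((spannedBy_heckeSpan (R := R) t r).mul (spannedBy_cliffordSpan (R := R) c r))
  rwa [HC.eq_top_of_mul_gen (heckeSpan R t r * cliffordSpan R c r)] at this
  · rw [← mul_one (1 : HC r q)]
    exact Submodule.mul_mem_mul (one_mem_heckeSpan r) (one_mem_cliffordSpan r)
  · intro x hx s
    refine Submodule.mul_induction_on hx (fun y hy d hd => ?_) (fun y z hy hz => ?_)
    · obtain ⟨e, he, f, hf, h⟩ := cliffordSpan_mul_even hsq hanti _ (hct s) le_rfl hd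
      rw [mul_assoc, h, mul_add, ← mul_assoc, ht]
      exact add_mem (Submodule.mul_mem_mul
        (heckeSpan_mul_gen hquad hcomm hbraid le_rfl s.2 hy) he) (Submodule.mul_mem_mul hy hf)
    · rw [add_mul]; exact add_mem hy hz
  · intro x hx j
    refine Submodule.mul_induction_on hx (fun y hy d hd => ?_) (fun y z hy hz => ?_)
    · rw [mul_assoc, hc]
      exact Submodule.mul_mem_mul hy (cliffordSpan_mul_gen hsq hanti le_rfl j.2 hd)
    · rw [add_mul]; exact add_mem hy hz

end HeckeClifford

/-! ### Inversions and reduced words -/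

section Inversions

variable {r : ℕ}

/-- The set of inversions of a function on `{0, …, r-1}`. -/
def inversions {α : Type*} [LinearOrder α] (y : Fin r → α) : Finset (Fin r × Fin r) :=
  Finset.univ.filter fun p => p.1 < p.2 ∧ y p.2 < y p.1

/-- The number of inversions. -/
def invCard {α : Type*} [LinearOrder α] (y : Fin r → α) : ℕ := (inversions y).card

theorem simpleTransp_lo (s : SIdx r) : simpleTransp s s.lo = s.hi := Equiv.swap_apply_left _ _

theorem simpleTransp_hi (s : SIdx r) : simpleTransp s s.hi = s.lo := Equiv.swap_apply_right _ _

theorem simpleTransp_simpleTransp (s : SIdx r) (k : Fin r) :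
    simpleTransp s (simpleTransp s k) = k :=
  DFunLike.congr_fun (Equiv.swap_mul_self s.lo s.hi) k

theorem simpleTransp_mul_self (s : SIdx r) : simpleTransp s * simpleTransp s = 1 :=
  Equiv.swap_mul_self _ _

theorem simpleTransp_lt (s : SIdx r) {i j : Fin r} (hij : i < j) (h : ¬(i = s.lo ∧ j = s.hi)) :
    simpleTransp s i < simpleTransp s j := by
  simp only [simpleTransp, Equiv.swap_apply_def, SIdx.lo, SIdx.hi, Fin.ext_iff, Fin.lt_def] at *
  split_ifs <;> (try simp only) <;> omega

theorem comp_simpleTransp_comp {α : Type*} (s : SIdx r) (y : Fin r → α) :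
    (y ∘ simpleTransp s) ∘ simpleTransp s = y := by
  funext k; simp [simpleTransp_simpleTransp]

theorem comp_simpleTransp_of_eq {α : Type*} (s : SIdx r) {y : Fin r → α} (h : y s.lo = y s.hi) :
    y ∘ simpleTransp s = y := by
  funext k
  simp only [simpleTransp, Function.comp, Equiv.swap_apply_def]
  split_ifs with h1 h2
  · rw [h1, h]
  · rw [h2, h]
  · rfl

variable {α : Type*} [LinearOrder α]

/-- An adjacent transposition reverses the order of no pair of positions except its own, so it
carries old inversions to inversions, and its own pair is the only new one. -/
theorem inversions_comp_simpleTransp (s : SIdx r) {y : Fin r → α} (h : y s.lo < y s.hi) :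
    inversions (y ∘ simpleTransp s) = insert (s.lo, s.hi)
      ((inversions y).map ((simpleTransp s).prodCongr (simpleTransp s)).toEmbedding) := by
  ext ⟨i, j⟩
  simp only [inversions, Finset.mem_insert, Finset.mem_map_equiv, Finset.mem_filter,
    Finset.mem_univ, true_and, Function.comp, Prod.mk.injEq]
  change _ ↔ _ ∨ (simpleTransp s i < simpleTransp s j ∧
    y (simpleTransp s j) < y (simpleTransp s i))
  by_cases hij : i = s.lo ∧ j = s.hi
  · obtain ⟨rfl, rfl⟩ := hij
    simp [simpleTransp_lo, simpleTransp_hi, lo_lt_hi, h]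
  · simp only [hij, false_or]
    refine and_congr_left fun hy => ⟨fun hlt => simpleTransp_lt s hlt hij, fun hlt => ?_⟩
    have := simpleTransp_lt s hlt (by
      rintro ⟨h1, h2⟩
      rw [h1, h2] at hy
      exact lt_asymm hy h)
    rwa [simpleTransp_simpleTransp, simpleTransp_simpleTransp] at this

theorem invCard_comp_simpleTransp (s : SIdx r) {y : Fin r → α} (h : y s.lo < y s.hi) :
    invCard (y ∘ simpleTransp s) = invCard y + 1 := by
  unfold invCard
  rw [inversions_comp_simpleTransp s h, Finset.card_insert_of_notMem, Finset.card_map]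
  rw [Finset.mem_map_equiv]
  intro hm
  have hm' := (Finset.mem_filter.1 hm).2.1
  change simpleTransp s s.lo < simpleTransp s s.hi at hm'
  rw [simpleTransp_lo, simpleTransp_hi] at hm'
  exact lt_asymm hm' (lo_lt_hi s)

theorem invCard_of_gt (s : SIdx r) {y : Fin r → α} (h : y s.hi < y s.lo) :
    invCard y = invCard (y ∘ simpleTransp s) + 1 := by
  rw [← invCard_comp_simpleTransp s (y := y ∘ simpleTransp s), comp_simpleTransp_comp]
  simpa [simpleTransp_lo, simpleTransp_hi] using h

theorem invCard_comp_simpleTransp_le (s : SIdx r) (y : Fin r → α) :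
    invCard (y ∘ simpleTransp s) ≤ invCard y + 1 := by
  rcases lt_trichotomy (y s.lo) (y s.hi) with h | h | h
  · exact (invCard_comp_simpleTransp s h).le
  · rw [comp_simpleTransp_of_eq s h]; omega
  · have := invCard_of_gt s h; omega

theorem invCard_eq_zero {y : Fin r → α} (h : Monotone y) : invCard y = 0 := by
  rw [invCard, Finset.card_eq_zero, inversions, Finset.filter_eq_empty_iff]
  rintro ⟨i, j⟩ _ ⟨h1, h2⟩
  exact absurd (h h1.le) h2.not_ge

theorem monotone_or_exists_descent (y : Fin r → α) :
    Monotone y ∨ ∃ s : SIdx r, y s.hi < y s.lo := by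
  by_cases h : ∃ s : SIdx r, y s.hi < y s.lo
  · exact Or.inr h
  · refine Or.inl ?_
    push Not at h
    rcases r with _ | r
    · exact fun i => i.elim0
    · exact Fin.monotone_iff_le_succ.2 fun i => h ⟨i, by omega⟩

theorem perm_eq_one_of_monotone {w : Equiv.Perm (Fin r)} (h : Monotone w) : w = 1 := by
  have hs : StrictMono w := h.strictMono_of_injective w.injective
  have : (hs.orderIsoOfSurjective w w.surjective) = OrderIso.refl _ := Subsingleton.elim _ _
  ext k
  exact congrArg Fin.val (DFunLike.congr_fun this k)

theorem invCard_le_length (l : List (SIdx r)) :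
    invCard ((l.map simpleTransp).prod : Equiv.Perm (Fin r)) ≤ l.length := by
  induction l using List.reverseRecOn with
  | nil => exact (invCard_eq_zero (fun _ _ h => h)).le
  | append_singleton l s ih =>
    rw [List.map_append, List.prod_append, List.length_append]
    have := invCard_comp_simpleTransp_le s ((l.map simpleTransp).prod : Equiv.Perm (Fin r))
    simp only [List.map_cons, List.map_nil, List.prod_cons, List.prod_nil, mul_one,
      Equiv.Perm.coe_mul, List.length_cons, List.length_nil]
    omega

/-- Bubble sort: a permutation other than the identity has an adjacent descent, and removing it
lowers the inversion number by exactly one. -/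
theorem exists_word_length_eq_invCard (w : Equiv.Perm (Fin r)) :
    ∃ l : List (SIdx r), (l.map simpleTransp).prod = w ∧ l.length = invCard w := by
  induction h : invCard w generalizing w with
  | zero =>
    rcases monotone_or_exists_descent w with hw | ⟨s, hs⟩
    · exact ⟨[], by simp [perm_eq_one_of_monotone hw], rfl⟩
    · have := invCard_of_gt s hs; omega
  | succ m ih =>
    rcases monotone_or_exists_descent w with hw | ⟨s, hs⟩
    · have := invCard_eq_zero hw; omega
    · have h1 := invCard_of_gt s hs
      obtain ⟨l, hl, hm⟩ := ih (w * simpleTransp s) (by rw [Equiv.Perm.coe_mul]; omega)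
      exact ⟨l ++ [s], by simp [hl, mul_assoc, simpleTransp_mul_self], by simp [hm]⟩

/-- This is what allows induction on reduced words: dropping the last letter leaves a reduced word,
and putting it back is a step up in length. -/
theorem IsReducedWord.of_append {l : List (SIdx r)} {s : SIdx r} {w : Equiv.Perm (Fin r)}
    (h : IsReducedWord (l ++ [s]) w) :
    IsReducedWord l (w * simpleTransp s) ∧
      (w * simpleTransp s) s.lo < (w * simpleTransp s) s.hi := by
  obtain ⟨hw, hmin⟩ := h
  have hl : (l.map simpleTransp).prod = w * simpleTransp s := by
    rw [← hw]; simp [mul_assoc, simpleTransp_mul_self]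
  have hw' : w * simpleTransp s * simpleTransp s = w := by
    rw [mul_assoc, simpleTransp_mul_self, mul_one]
  refine ⟨⟨hl, fun l' hl' => ?_⟩, ?_⟩
  · have := hmin (l' ++ [s]) (by simp [hl', hw'])
    simpa using this
  -- If the last letter lowered the length, w would have inversion number below the length of `l`,
  -- hence a word shorter than `l ++ [s]`.
  · by_contra hlt
    have hlt' := lt_of_le_of_ne (not_lt.1 hlt)
      fun h => lo_ne_hi s ((w * simpleTransp s).injective h).symm
    have h1 := invCard_of_gt s hlt'
    have h2 := invCard_le_length l
    rw [hl] at h2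
    rw [← Equiv.Perm.coe_mul, hw'] at h1
    obtain ⟨l', hl', hm⟩ := exists_word_length_eq_invCard w
    have := hmin l' hl'
    simp only [List.length_append, List.length_cons, List.length_nil] at this
    omega

end Inversions

/-! ### Compositions, block functions and Young subgroups -/

section Blocks

variable {n r : ℕ} (l : Comp n r)

theorem Comp.exists_mem_block (k : Fin r) : ∃ a, k ∈ l.block a := by
  classical
  have hne : (Finset.univ.filter fun a : Fin n => (k : ℕ) < ∑ b with b ≤ a, l.1 b).Nonempty := by
    rcases n with _ | n
    · have := l.2; simp at this; exact absurd k.2 (by omega)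
    · refine ⟨Fin.last n, ?_⟩
      simp only [Finset.mem_filter, Finset.mem_univ, true_and, Fin.le_last, Finset.filter_true]
      rw [l.2]; exact k.2
  -- The least a whose partial sum exceeds k is the block sought. If its lower bound failed, the
  -- partial sum up to its predecessor would already exceed k.
  refine ⟨Finset.min' _ hne, ?_, (Finset.mem_filter.1 (Finset.min'_mem _ hne)).2⟩
  set a := Finset.min' _ hne with ha
  by_contra! hlt
  have hne' : (Finset.univ.filter fun b : Fin n => b < a).Nonempty := by
    rw [Finset.nonempty_iff_ne_empty]
    intro h
    rw [h] at hlt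
    simp at hlt
  set b := Finset.max' _ hne' with hb
  have hba : b < a := (Finset.mem_filter.1 (Finset.max'_mem _ hne')).2
  have hmem : b ∈ Finset.univ.filter fun a : Fin n => (k : ℕ) < ∑ b with b ≤ a, l.1 b := by
    refine Finset.mem_filter.2 ⟨Finset.mem_univ _, hlt.trans_le ?_⟩
    refine Finset.sum_le_sum_of_subset fun c hc => ?_
    simp only [Finset.mem_filter, Finset.mem_univ, true_and] at hc ⊢
    exact Finset.le_max' _ _ (by simpa using hc)
  exact absurd (Finset.min'_le _ _ hmem) hba.not_ge

/-- The block containing a given point. -/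
noncomputable def Comp.index (k : Fin r) : Fin n := (l.exists_mem_block k).choose

theorem Comp.index_spec (k : Fin r) : k ∈ l.block (l.index k) :=
  (l.exists_mem_block k).choose_spec

theorem Comp.le_of_mem_block {k k' : Fin r} (h : k ≤ k') {a a' : Fin n} (ha : k ∈ l.block a)
    (ha' : k' ∈ l.block a') : a ≤ a' := by
  by_contra! hlt
  have h1 : ∑ b with b ≤ a', l.1 b ≤ ∑ b with b < a, l.1 b := by
    refine Finset.sum_le_sum_of_subset fun c hc => ?_
    simp only [Finset.mem_filter, Finset.mem_univ, true_and] at hc ⊢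
    exact hc.trans_lt hlt
  have h2 := ha.1
  have h3 := ha'.2
  have h4 : (k : ℕ) ≤ k' := h
  omega

theorem Comp.index_eq_iff (k : Fin r) (a : Fin n) : l.index k = a ↔ k ∈ l.block a :=
  ⟨fun h => h ▸ l.index_spec k, fun h => le_antisymm
    (l.le_of_mem_block le_rfl (l.index_spec k) h) (l.le_of_mem_block le_rfl h (l.index_spec k))⟩

theorem Comp.index_monotone : Monotone l.index :=
  fun _ _ h => l.le_of_mem_block h (l.index_spec _) (l.index_spec _)

/-- The blocks are the fibres of the block function, so the Young subgroup is its stabiliser. This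
identifies x_λ with a sum over a fibre of permutations. -/
theorem Comp.mem_young (w : Equiv.Perm (Fin r)) : w ∈ l.young ↔ l.index ∘ w = l.index := by
  constructor
  · intro h
    funext k
    exact (l.index_eq_iff _ _).2 ((h _ k).2 (l.index_spec k))
  · intro h a k
    rw [← l.index_eq_iff, ← l.index_eq_iff, ← congrFun h k, Function.comp]

theorem Comp.card_fiber (a : Fin n) :
    (Finset.univ.filter fun k => l.index k = a).card = l.1 a := by
  have hsplit : ∑ b with b ≤ a, l.1 b = (∑ b with b < a, l.1 b) + l.1 a := by
    have : (Finset.univ.filter fun b : Fin n => b ≤ a) =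
        insert a (Finset.univ.filter fun b : Fin n => b < a) := by
      ext b; simp [le_iff_eq_or_lt]
    rw [this, Finset.sum_insert (by simp), add_comm]
  have hle : ∑ b with b ≤ a, l.1 b ≤ r := by
    conv_rhs => rw [← l.2]
    exact Finset.sum_le_sum_of_subset (Finset.filter_subset _ _)
  rw [← Finset.card_map Fin.valEmbedding]
  have : (Finset.univ.filter fun k => l.index k = a).map Fin.valEmbedding =
      Finset.Ico (∑ b with b < a, l.1 b) (∑ b with b ≤ a, l.1 b) := by
    ext m
    simp only [Finset.mem_map, Finset.mem_filter, Finset.mem_univ, true_and, l.index_eq_iff, Comp.block,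
      Set.mem_ofPred_eq, Fin.valEmbedding_apply, Finset.mem_Ico]
    constructor
    · rintro ⟨k, hk, rfl⟩; exact hk
    · intro h; exact ⟨⟨m, by omega⟩, h, rfl⟩
  rw [this, Nat.card_Ico]
  omega

/-- The composition counting the fibres of a function. -/
def content (y : Fin r → Fin n) : Comp n r :=
  ⟨fun a => (Finset.univ.filter fun k => y k = a).card, by
    have := Finset.card_eq_sum_card_fiberwise (f := y) (s := Finset.univ) (t := Finset.univ)
      (by simp)
    simpa using this.symm⟩

theorem content_comp (y : Fin r → Fin n) (w : Equiv.Perm (Fin r)) :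
    content (y ∘ w) = content y := by
  apply Subtype.ext
  funext a
  change (Finset.univ.filter fun k => y (w k) = a).card = (Finset.univ.filter fun k => y k = a).card
  exact Finset.card_equiv w fun k => by simp

theorem content_index : content l.index = l :=
  Subtype.ext (funext fun a => l.card_fiber a)

/-- A weakly increasing function is determined by the sizes of its fibres: positions with smaller
value precede k, and positions up to k have value at most that of k. Counting them gives the two
bounds of the block. -/
theorem index_content {y : Fin r → Fin n} (hy : Monotone y) : (content y).index = y := by
  funext k
  rw [Comp.index_eq_iff]
  have key : ∀ P : Fin n → Prop, ∀ _ : DecidablePred P, ∑ b with P b, (content y).1 b =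
      (Finset.univ.filter fun j => P (y j)).card := by
    intro P _
    rw [Finset.card_eq_sum_card_fiberwise (f := y) (s := Finset.univ.filter fun j => P (y j))
      (t := Finset.univ.filter P) (fun j hj => by simpa using hj)]
    refine Finset.sum_congr rfl fun b hb => ?_
    rw [Finset.filter_filter]
    change (Finset.univ.filter fun k => y k = b).card = _
    refine congrArg Finset.card (Finset.ext fun j => ?_)
    have hb' := (Finset.mem_filter.1 hb).2
    simp only [Finset.mem_filter, Finset.mem_univ, true_and]
    exact ⟨fun h => ⟨h ▸ hb', h⟩, fun h => h.2⟩
  constructor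
  · rw [key (· < y k) inferInstance]
    have hsub : (Finset.univ.filter fun j => y j < y k) ⊆ Finset.Iio k := fun j hj => by
      rw [Finset.mem_Iio]
      by_contra! h
      exact absurd (hy h) (Finset.mem_filter.1 hj).2.not_ge
    simpa using Finset.card_le_card hsub
  · rw [key (· ≤ y k) inferInstance]
    have hsub : Finset.Iic k ⊆ Finset.univ.filter fun j => y j ≤ y k := fun j hj =>
      Finset.mem_filter.2 ⟨Finset.mem_univ _, hy (Finset.mem_Iic.1 hj)⟩
    simpa [Nat.succ_le_iff] using Finset.card_le_card hsub

/-- Sorting y gives the block function of its content, so undoing the sort recovers y. -/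
theorem exists_perm_index_comp (y : Fin r → Fin n) :
    ∃ z : Equiv.Perm (Fin r), (content y).index ∘ z = y := by
  refine ⟨(Tuple.sort y)⁻¹, ?_⟩
  rw [← content_comp y (Tuple.sort y), index_content (Tuple.monotone_sort y)]
  funext k
  simp

end Blocks

/-! ### Signs and absolute values of indices -/

/-- The absolute value of an index. -/
def Ix.abs {n : ℕ} : Ix n → Fin n := Sum.elim id id

/-- The index with the sign of `x` and absolute value `a`. -/
def Ix.relabel {n m : ℕ} (x : Ix n) (a : Fin m) : Ix m := Sum.map (fun _ => a) (fun _ => a) x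

theorem Ix.abs_neg {n : ℕ} (x : Ix n) : x.neg.abs = x.abs := by rcases x with a | a <;> rfl

theorem Ix.relabel_neg {n m : ℕ} (x : Ix n) (a : Fin m) : x.neg.relabel a = (x.relabel a).neg := by
  rcases x with b | b <;> rfl

theorem Ix.par_relabel {n m : ℕ} (x : Ix n) (a : Fin m) : (x.relabel a).par = x.par := by
  rcases x with b | b <;> rfl

theorem Ix.par_neg {n : ℕ} (x : Ix n) : (x.neg.par : ZMod 2) = x.par + 1 := by
  rcases x with b | b
  · simp [Ix.neg, Ix.par]
  · simp only [Ix.neg, Ix.par]; decide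

theorem Ix.abs_relabel {n m : ℕ} (x : Ix n) (a : Fin m) : (x.relabel a).abs = a := by
  rcases x with b | b <;> rfl

theorem Ix.eq_inr_abs {n : ℕ} {x : Ix n} (h : x.par = 1) : x = Sum.inr x.abs := by
  rcases x with b | b
  · simp [Ix.par] at h
  · rfl

theorem Ix.ext {n : ℕ} {x y : Ix n} (h1 : x.par = y.par) (h2 : x.abs = y.abs) : x = y := by
  rcases x with b | b <;> rcases y with c | c <;> simp_all [Ix.par, Ix.abs]

/-! ### The tensor basis and its generation by sorted negative vectors -/

section

variable {R : Type*} [CommRing R] {n r : ℕ} {v : Rˣ}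

/-- The basis vector `e_x` of the tensor superspace. -/
noncomputable def TensorSpace.e (v : Rˣ) (x : Fin r → Ix n) : TensorSpace n r v := eT R x

/-- The basis of the tensor superspace consisting of the vectors `e_x`. -/
noncomputable def TensorSpace.basis (n r : ℕ) (v : Rˣ) :
    Module.Basis (Fin r → Ix n) R (TensorSpace n r v) :=
  Basis.piTensorProduct fun _ : Fin r => Pi.basisFun R (Ix n)

theorem TensorSpace.basis_apply (x : Fin r → Ix n) : TensorSpace.basis n r v x = e v x := by
  change Basis.piTensorProduct (fun _ : Fin r => Pi.basisFun R (Ix n)) x = eT R x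
  rw [Basis.piTensorProduct_apply]
  simp [eT, e1, Pi.basisFun_apply]

theorem TensorSpace.repr_e (x : Fin r → Ix n) :
    (TensorSpace.basis n r v).repr (e v x) = Finsupp.single x 1 := by
  rw [← basis_apply, Module.Basis.repr_self]

/-- Reversed absolute values of the entries of `x`. -/
def revAbs (x : Fin r → Ix n) (k : Fin r) : Fin n := (x k).abs.rev

/-- The vector with all entries negative and reversed absolute values `y`. -/
noncomputable def TensorSpace.eNeg (v : Rˣ) (y : Fin r → Fin n) : TensorSpace n r v :=
  e v fun k => Sum.inr (y k).rev

theorem e_eq_eNeg {x : Fin r → Ix n} (h : ∀ k, (x k).par = 1) :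
    TensorSpace.e v x = TensorSpace.eNeg v (revAbs x) := by
  unfold TensorSpace.eNeg revAbs
  congr 1
  funext k
  rw [Fin.rev_rev, ← Ix.eq_inr_abs (h k)]

theorem upd_swap (s : SIdx r) (x : Fin r → Ix n) :
    upd s x (x s.hi) (x s.lo) = x ∘ simpleTransp s := by
  funext k
  simp only [upd, Function.comp, Function.update_apply, simpleTransp, Equiv.swap_apply_def]
  split_ifs <;> rfl

/-- Two negative entries are only exchanged or kept, so these vectors span a space stable under the
T_s. The action on it is that of a twisted permutation module: (q-1) - T_s multiplies e_y by q when
the entries agree, and by v with an exchange at an ascent. The reversal turns the ascents of y into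
the descents of the actual indices. -/
theorem T_smul_eNeg (s : SIdx r) (y : Fin r → Fin n) :
    HC.T ((v : R) ^ 2) s • TensorSpace.eNeg v y =
      if y s.lo = y s.hi then - TensorSpace.eNeg v y
      else if y s.lo < y s.hi then ((v : R) ^ 2 - 1) • TensorSpace.eNeg v y -
        (v : R) • TensorSpace.eNeg v (y ∘ simpleTransp s)
      else - ((v : R) • TensorSpace.eNeg v (y ∘ simpleTransp s)) := by
  have h1 := opT_apply v s (fun k => (Sum.inr (y k).rev : Ix n))
  have h2 := upd_swap s (fun k => (Sum.inr (y k).rev : Ix n))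
  have h3 := upd_self s (fun k => (Sum.inr (y k).rev : Ix n))
  simp only [tab, Fin.rev_inj, Fin.rev_lt_rev, h2, h3] at h1
  rw [TensorSpace.T_smul]
  refine h1.trans ?_
  split_ifs with c1 c2 c3 c4
  · exact congrArg (fun x => - eT R x)
      (comp_simpleTransp_of_eq s (y := fun k => (Sum.inr (y k).rev : Ix n)) (by simp only [c1]))
  · exact absurd c2 (lt_asymm c3)
  · rfl
  · exact neg_add_eq_sub _ _
  · exact absurd (lt_trichotomy (y s.lo) (y s.hi)) (by simp [c1, c2, c4])

theorem c_smul_e (j : Fin r) (x : Fin r → Ix n) :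
    HC.c ((v : R) ^ 2) j • TensorSpace.e v x = (-1 : R) ^ (pre x j + (x j).par) •
      TensorSpace.e v (Function.update x j (x j).neg) :=
  (TensorSpace.c_smul j _).trans (opC_apply j x)

theorem exists_smul_c_smul_e (j : Fin r) (x : Fin r → Ix n) :
    ∃ a : R, TensorSpace.e v x =
      a • HC.c ((v : R) ^ 2) j • TensorSpace.e v (Function.update x j (x j).neg) := by
  obtain ⟨a, ha⟩ := opC_flip (R := R) j x
  refine ⟨a, ha.trans ?_⟩
  rw [map_smul, TensorSpace.c_smul]
  rfl

/-- Induction on the number of positive entries. Since c_j flips one sign up to a scalar, statements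
about all basis vectors reduce to the negative ones. -/
theorem TensorSpace.sign_induction {P : (Fin r → Ix n) → Prop} (x : Fin r → Ix n)
    (hneg : ∀ x' : Fin r → Ix n, (∀ k, (x' k).par = 1) → revAbs x' = revAbs x → P x')
    (hflip : ∀ x' j, P (Function.update x' j (x' j).neg) → P x') : P x := by
  induction h : (Finset.univ.filter fun k => (x k).par = 0).card generalizing x with
  | zero =>
    refine hneg x (fun k => ?_) rfl
    rw [Finset.card_eq_zero, Finset.filter_eq_empty_iff] at h
    have := h (Finset.mem_univ k)
    rcases hx : x k with a | a
    · rw [hx] at this; simp [Ix.par] at this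
    · rfl
  | succ m ih =>
    obtain ⟨j, hj⟩ := Finset.card_pos.1 (h ▸ Nat.succ_pos m :
      0 < (Finset.univ.filter fun k => (x k).par = 0).card)
    have hj' := (Finset.mem_filter.1 hj).2
    refine hflip x j (ih _ (fun x' h1 h2 => hneg x' h1 (h2.trans ?_)) ?_)
    · funext k
      by_cases hk : k = j
      · subst hk; simp [revAbs, Ix.abs_neg]
      · simp [revAbs, hk]
    · have : (Finset.univ.filter fun k => (Function.update x j (x j).neg k).par = 0) =
          (Finset.univ.filter fun k => (x k).par = 0).erase j := by
        ext k
        by_cases hk : k = j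
        · subst hk
          simp only [Finset.mem_filter, Finset.mem_univ, true_and, Function.update_self,
            Finset.mem_erase, ne_eq, not_true_eq_false, false_and, iff_false]
          rcases hx : x k with a | a
          · simp [Ix.neg, Ix.par]
          · rw [hx] at hj'; simp [Ix.par] at hj'
        · simp [hk]
      rw [this, Finset.card_erase_of_mem hj, h]; rfl

theorem sum_par_update_neg (x : Fin r → Ix n) (j : Fin r) :
    ∑ k, ((x k).par : ZMod 2) = ∑ k, ((Function.update x j (x j).neg k).par : ZMod 2) + 1 := by
  rw [← Finset.add_sum_erase _ _ (Finset.mem_univ j), ← Finset.add_sum_erase _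
    (fun k => ((Function.update x j (x j).neg k).par : ZMod 2)) (Finset.mem_univ j),
    Function.update_self, Ix.par_neg]
  have : ∑ k ∈ Finset.univ.erase j, ((Function.update x j (x j).neg k).par : ZMod 2) =
      ∑ k ∈ Finset.univ.erase j, ((x k).par : ZMod 2) := Finset.sum_congr rfl fun k hk => by
    rw [Function.update_of_ne (Finset.ne_of_mem_erase hk)]
  rw [this]
  have h2 : (1 : ZMod 2) + 1 = 0 := by decide
  linear_combination -h2

/-- The generation principle behind every surjectivity and parity statement below: from sorted
negative vectors the T_s reach all rearrangements, and the c_j then reach all signs. The family `G`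
tracks parity, with `G r` the slot of the all-negative vectors. Only rearrangements of the given
vector are required to start with, so the principle also applies when just one content is available.
-/
theorem e_mem_of_generators (G : ZMod 2 → Submodule R (TensorSpace n r v)) (x : Fin r → Ix n)
    (hmono : ∀ w : Equiv.Perm (Fin r), Monotone (revAbs x ∘ w) →
      TensorSpace.eNeg v (revAbs x ∘ w) ∈ G r)
    (hT : ∀ p, ∀ m ∈ G p, ∀ s : SIdx r, HC.T ((v : R) ^ 2) s • m ∈ G p)
    (hc : ∀ p, ∀ m ∈ G p, ∀ j : Fin r, HC.c ((v : R) ^ 2) j • m ∈ G (p + 1)) :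
    TensorSpace.e v x ∈ G (∑ k, ((x k).par : ZMod 2)) := by
  have hneg : ∀ m, ∀ y : Fin r → Fin n, invCard y = m → (∃ w : Equiv.Perm (Fin r),
      y = revAbs x ∘ w) → TensorSpace.eNeg v y ∈ G r := by
    intro m
    induction m with
    | zero =>
      rintro y hy ⟨w, rfl⟩
      rcases monotone_or_exists_descent (revAbs x ∘ w) with h | ⟨s, hs⟩
      · exact hmono w h
      · have := invCard_of_gt s hs; omega
    | succ m ih =>
      rintro y hy ⟨w, rfl⟩
      rcases monotone_or_exists_descent (revAbs x ∘ w) with h | ⟨s, hs⟩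
      · exact hmono w h
      · have h1 := invCard_of_gt s hs
        have h2 := ih (revAbs x ∘ w ∘ simpleTransp s) (by
          rw [← Function.comp_assoc]; omega) ⟨w * simpleTransp s, rfl⟩
        have h3 : (revAbs x ∘ w ∘ simpleTransp s) s.lo < (revAbs x ∘ w ∘ simpleTransp s) s.hi := by
          simpa [simpleTransp_lo, simpleTransp_hi] using hs
        have h4 := T_smul_eNeg (v := v) s (revAbs x ∘ w ∘ simpleTransp s)
        rw [if_neg h3.ne, if_pos h3, ← Function.comp_assoc, comp_simpleTransp_comp] at h4
        rw [← Function.comp_assoc] at h2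
        -- At an ascent the formula for T_s is solved for the exchanged vector; this is where v must
        -- be invertible.
        have h5 : TensorSpace.eNeg v (revAbs x ∘ w) = ((v⁻¹ : Rˣ) : R) •
            (((v : R) ^ 2 - 1) • TensorSpace.eNeg v ((revAbs x ∘ w) ∘ simpleTransp s) -
              HC.T ((v : R) ^ 2) s • TensorSpace.eNeg v ((revAbs x ∘ w) ∘ simpleTransp s)) := by
          rw [h4, sub_sub_cancel, smul_smul, Units.inv_mul, one_smul]
        rw [h5]
        exact Submodule.smul_mem _ _ (sub_mem (Submodule.smul_mem _ _ h2) (hT _ _ h2 s))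
  refine TensorSpace.sign_induction (P := fun x => TensorSpace.e v x ∈
    G (∑ k, ((x k).par : ZMod 2))) x (fun x' h1 h2 => ?_) (fun x' j h => ?_)
  · rw [e_eq_eNeg h1, h2]
    have : ∑ k, ((x' k).par : ZMod 2) = r := by simp [h1]
    rw [this]
    exact hneg _ _ rfl ⟨1, rfl⟩
  · obtain ⟨a, ha⟩ := exists_smul_c_smul_e (v := v) j x'
    rw [ha, sum_par_update_neg x' j]
    exact Submodule.smul_mem _ _ (hc _ _ h j)

end

/-! ### Linearity checked on generators, and values of τ -/

section

variable {R : Type*} [CommRing R] {r : ℕ} {q : R}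

theorem HC.map_smul_of_gen {M N : Type*} [AddCommGroup M] [Module R M] [Module (HC r q) M]
    [IsScalarTower R (HC r q) M] [AddCommGroup N] [Module R N] [Module (HC r q) N]
    [IsScalarTower R (HC r q) N] (f : M →ₗ[R] N)
    (hT : ∀ (s : SIdx r) m, f (HC.T q s • m) = HC.T q s • f m)
    (hc : ∀ (j : Fin r) m, f (HC.c q j • m) = HC.c q j • f m) (h : HC r q) (m : M) :
    f (h • m) = h • f m := by
  refine HC.induction (P := fun h => ∀ m, f (h • m) = h • f m) h (fun a m => ?_) (fun g => ?_)
    (fun x y hx hy m => ?_) (fun x y hx hy m => ?_) m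
  · rw [algebraMap_smul, algebraMap_smul, map_smul]
  · rcases g with s | j
    · exact hT s
    · exact hc j
  · rw [add_smul, add_smul, map_add, hx, hy]
  · rw [mul_smul, mul_smul, hx, hy]

theorem tau_T (s : SIdx r) : (tau r q (HC.T q s)).unop = -HC.T q s + algebraMap R _ (q - 1) :=
  congrArg MulOpposite.unop (HC.lift_gen (tauGen r q) (tauGen_rel r q) (HCGen.T s))

theorem tau_c (j : Fin r) : (tau r q (HC.c q j)).unop = HC.c q j :=
  congrArg MulOpposite.unop (HC.lift_gen (tauGen r q) (tauGen_rel r q) (HCGen.c j))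

end

/-! ### Folding maps into the tensor power of V(r|r) -/

section

variable {R : Type*} [CommRing R] {n r : ℕ} {v : Rˣ}

/-- The permutations `z` with `f ∘ z = y`. -/
def permFiber (f y : Fin r → Fin n) : Finset (Equiv.Perm (Fin r)) :=
  Finset.univ.filter fun z : Equiv.Perm (Fin r) => f ∘ z = y

theorem mem_permFiber {f y : Fin r → Fin n} {z : Equiv.Perm (Fin r)} :
    z ∈ permFiber f y ↔ f ∘ z = y := by simp [permFiber]

/-- The map `e_x ↦ ∑_z v^{ℓ(z) - ℓ(y)} e_{z,x}`, where `y` is the function of reversed absolute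
values of `x`, the sum runs over the permutations `z` with `f ∘ z = y` and `e_{z,x}` has the
signs of `x` and the reversed absolute values `z`. -/
noncomputable def foldMap (v : Rˣ) (f : Fin r → Fin n) :
    TensorSpace n r v →ₗ[R] TensorSpace r r v :=
  (TensorSpace.basis n r v).constr R fun x => ((v⁻¹ : Rˣ) : R) ^ invCard (revAbs x) •
    ∑ z ∈ permFiber f (revAbs x), (v : R) ^ invCard z •
      TensorSpace.e v fun k => (x k).relabel (z k).rev

theorem foldMap_e (f : Fin r → Fin n) (x : Fin r → Ix n) :
    foldMap v f (TensorSpace.e v x) = ((v⁻¹ : Rˣ) : R) ^ invCard (revAbs x) •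
      ∑ z ∈ permFiber f (revAbs x), (v : R) ^ invCard z •
        TensorSpace.e v fun k => (x k).relabel (z k).rev := by
  rw [foldMap, ← TensorSpace.basis_apply, Module.Basis.constr_basis]

theorem foldMap_eNeg (f : Fin r → Fin n) (y : Fin r → Fin n) :
    foldMap v f (TensorSpace.eNeg v y) = ((v⁻¹ : Rˣ) : R) ^ invCard y •
      ∑ z ∈ permFiber f y, (v : R) ^ invCard z • TensorSpace.eNeg v z := by
  have h : revAbs (fun k => (Sum.inr (y k).rev : Ix n)) = y := by
    funext k; simp [revAbs, Ix.abs]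
  rw [TensorSpace.eNeg, foldMap_e, h]
  rfl

theorem revAbs_update_neg (x : Fin r → Ix n) (j : Fin r) :
    revAbs (Function.update x j (x j).neg) = revAbs x := by
  funext k
  by_cases hk : k = j
  · subst hk; simp [revAbs, Ix.abs_neg]
  · simp [revAbs, hk]

/-- The sign produced by c_j depends only on parities, while folding changes only absolute values,
with coefficients that ignore signs. -/
theorem foldMap_c_smul (f : Fin r → Fin n) (j : Fin r) (m : TensorSpace n r v) :
    foldMap v f (HC.c ((v : R) ^ 2) j • m) = HC.c ((v : R) ^ 2) j • foldMap v f m := by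
  have key : ∀ x : Fin r → Ix n, foldMap v f (HC.c ((v : R) ^ 2) j • TensorSpace.e v x) =
      HC.c ((v : R) ^ 2) j • foldMap v f (TensorSpace.e v x) := by
    intro x
    rw [c_smul_e, map_smul, foldMap_e, foldMap_e, revAbs_update_neg,
      smul_comm (HC.c ((v : R) ^ 2) j), smul_comm ((-1 : R) ^ _), Finset.smul_sum,
      Finset.smul_sum (r := HC.c ((v : R) ^ 2) j)]
    congr 1
    refine Finset.sum_congr rfl fun z _ => ?_
    rw [smul_comm (HC.c ((v : R) ^ 2) j), c_smul_e, smul_comm ((-1 : R) ^ _)]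
    have h1 : pre (fun k => (x k).relabel (z k).rev) j = pre x j := by
      simp only [pre, Ix.par_relabel]
    rw [h1, Ix.par_relabel]
    congr 3
    funext k
    by_cases hk : k = j
    · subst hk; simp [Ix.relabel_neg]
    · simp [hk]
  have : (foldMap v f).comp (Module.toModuleEnd R (TensorSpace n r v) (HC.c ((v : R) ^ 2) j)) =
      (Module.toModuleEnd R (TensorSpace r r v) (HC.c ((v : R) ^ 2) j)).comp (foldMap v f) :=
    (TensorSpace.basis n r v).ext fun x => by
      rw [TensorSpace.basis_apply]; exact key x
  exact LinearMap.congr_fun this m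

theorem sum_fiber_comp (f : Fin r → Fin n) (s : SIdx r) {M : Type*} [AddCommMonoid M]
    (F : Equiv.Perm (Fin r) → M) (y : Fin r → Fin n) :
    ∑ z ∈ permFiber f y, F (z * simpleTransp s) =
      ∑ z ∈ permFiber f (y ∘ simpleTransp s), F z := by
  refine Finset.sum_equiv (Equiv.mulRight (simpleTransp s)) (fun z => ?_) (fun _ _ => rfl)
  simp only [mem_permFiber, Equiv.coe_mulRight, Equiv.Perm.coe_mul]
  rw [← Function.comp_assoc]
  refine ⟨fun h => by rw [h], fun h => ?_⟩
  rw [← comp_simpleTransp_comp s (f ∘ z), h, comp_simpleTransp_comp]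

/-- The vector v^{ℓ(z)} e_z will be the image of T_z. In this normalisation the symmetric
coefficients v, v of the exchange become the 1 and q of the regular representation. -/
theorem T_smul_scaled_eNeg (s : SIdx r) (z : Equiv.Perm (Fin r)) :
    HC.T ((v : R) ^ 2) s • ((v : R) ^ invCard z • TensorSpace.eNeg v z) =
      if z s.lo < z s.hi then ((v : R) ^ 2 - 1) • ((v : R) ^ invCard z • TensorSpace.eNeg v z) -
        (v : R) ^ invCard (z * simpleTransp s) • TensorSpace.eNeg v (z * simpleTransp s)
      else - ((v : R) ^ 2 • ((v : R) ^ invCard (z * simpleTransp s) •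
        TensorSpace.eNeg v (z * simpleTransp s))) := by
  have hne : z s.lo ≠ z s.hi := fun h => lo_ne_hi s (z.injective h)
  rw [smul_comm, T_smul_eNeg, if_neg hne, Equiv.Perm.coe_mul]
  split_ifs with h
  · rw [invCard_comp_simpleTransp s h, smul_sub, smul_smul _ (v : R), ← pow_succ,
      smul_comm ((v : R) ^ 2 - 1)]
  · rw [invCard_of_gt s (lt_of_le_of_ne (not_lt.1 h) hne.symm), smul_neg, smul_smul, smul_smul]
    congr 2; ring

/-- With f increasing, a strict inequality between entries of y forces the same inequality for every
z in the fibre, so the unequal cases hold term by term. When the two entries agree, the fibre is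
stable under z ↦ zs and the terms have to be paired. -/
theorem T_smul_sum_fiber {f : Fin r → Fin n} (hf : Monotone f) (s : SIdx r) (y : Fin r → Fin n)
    (S : (Fin r → Fin n) → TensorSpace r r v)
    (hS : ∀ y, S y = ∑ z ∈ permFiber f y,
      (v : R) ^ invCard z • TensorSpace.eNeg v z) :
    HC.T ((v : R) ^ 2) s • S y =
      if y s.lo = y s.hi then - S y
      else if y s.lo < y s.hi then ((v : R) ^ 2 - 1) • S y - S (y ∘ simpleTransp s)
      else - ((v : R) ^ 2 • S (y ∘ simpleTransp s)) := by
  have hlt : ∀ z : Equiv.Perm (Fin r), f ∘ z = y → ∀ i j, y i < y j → z i < z j := by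
    rintro z rfl i j h
    by_contra! h'
    exact absurd (hf h') h.not_ge
  simp only [hS]
  rw [Finset.smul_sum]
  simp only [T_smul_scaled_eNeg]
  split_ifs with h1 h2
  -- The weight is q at ascents and 1 at descents, so that T_s sends the term X_z to F(z) - X_z -
  -- F(zs). The two sums of F over the fibre coincide and cancel, which leaves -S.
  · let F : Equiv.Perm (Fin r) → TensorSpace r r v := fun z =>
      (if z s.lo < z s.hi then (v : R) ^ 2 else 1) • (v : R) ^ invCard z • TensorSpace.eNeg v z
    have h3 := sum_fiber_comp f s F y
    rw [comp_simpleTransp_of_eq s h1] at h3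
    have h4 : ∀ z : Equiv.Perm (Fin r), (if z s.lo < z s.hi then
          ((v : R) ^ 2 - 1) • ((v : R) ^ invCard z • TensorSpace.eNeg v z) -
          (v : R) ^ invCard (z * simpleTransp s) • TensorSpace.eNeg v (z * simpleTransp s)
        else - ((v : R) ^ 2 • ((v : R) ^ invCard (z * simpleTransp s) •
          TensorSpace.eNeg v (z * simpleTransp s)))) =
        F z - (v : R) ^ invCard z • TensorSpace.eNeg v z - F (z * simpleTransp s) := by
      intro z
      simp only [F, Equiv.Perm.mul_apply, simpleTransp_lo, simpleTransp_hi]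
      rcases lt_or_gt_of_ne fun h => lo_ne_hi s (z.injective h) with h | h
      · rw [if_pos h, if_pos h, if_neg (lt_asymm h), one_smul, sub_smul, one_smul]
      · rw [if_neg (lt_asymm h), if_neg (lt_asymm h), if_pos h, one_smul, sub_self, zero_sub]
    simp only [h4, Finset.sum_sub_distrib, h3]
    rw [sub_sub_cancel_left]
  · rw [← sum_fiber_comp, Finset.smul_sum, ← Finset.sum_sub_distrib]
    refine Finset.sum_congr rfl fun z hz => ?_
    rw [if_pos (hlt z (mem_permFiber.1 hz) _ _ h2)]
  · rw [← sum_fiber_comp, Finset.smul_sum, ← Finset.sum_neg_distrib]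
    refine Finset.sum_congr rfl fun z hz => ?_
    rw [if_neg (lt_asymm (hlt z (mem_permFiber.1 hz) _ _
      (lt_of_le_of_ne (not_lt.1 h2) (Ne.symm h1))))]

/-- Rescaling the fibre sums by v^{-ℓ(y)} turns the coefficients 1 and q back into v and v, since
ℓ(y) changes by one at an exchange of distinct entries. -/
theorem foldMap_T_smul_eNeg {f : Fin r → Fin n} (hf : Monotone f) (s : SIdx r)
    (y : Fin r → Fin n) :
    foldMap v f (HC.T ((v : R) ^ 2) s • TensorSpace.eNeg v y) =
      HC.T ((v : R) ^ 2) s • foldMap v f (TensorSpace.eNeg v y) := by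
  have hvv : ((v⁻¹ : Rˣ) : R) * v = 1 := v.inv_mul
  rw [T_smul_eNeg, foldMap_eNeg, smul_comm (HC.T ((v : R) ^ 2) s),
    T_smul_sum_fiber hf s y _ fun _ => rfl]
  split_ifs with h1 h2
  · rw [map_neg, foldMap_eNeg, smul_neg]
  · rw [map_sub, map_smul, map_smul, foldMap_eNeg, foldMap_eNeg, invCard_comp_simpleTransp s h2,
      smul_sub, smul_comm ((v : R) ^ 2 - 1), smul_smul (v : R)]
    congr 2
    linear_combination ((v⁻¹ : Rˣ) : R) ^ invCard y * hvv
  · rw [map_neg, map_smul, foldMap_eNeg,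
      invCard_of_gt s (lt_of_le_of_ne (not_lt.1 h2) (Ne.symm h1)), smul_neg, smul_smul, smul_smul]
    congr 2
    linear_combination -((v⁻¹ : Rˣ) : R) ^ invCard (y ∘ simpleTransp s) * v * hvv

/-- The defect D of commutation with T_s satisfies D c_j = c_{j'} D, where j' is the image of j
under s: the correction terms of the mixed relation cancel because folding commutes with the
Clifford generators. Hence D vanishes once it vanishes on negative vectors. -/
theorem foldMap_T_smul {f : Fin r → Fin n} (hf : Monotone f) (s : SIdx r)
    (m : TensorSpace n r v) :
    foldMap v f (HC.T ((v : R) ^ 2) s • m) = HC.T ((v : R) ^ 2) s • foldMap v f m := by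
  let D : TensorSpace n r v →ₗ[R] TensorSpace r r v :=
    (foldMap v f).comp (Module.toModuleEnd R (TensorSpace n r v) (HC.T ((v : R) ^ 2) s)) -
      (Module.toModuleEnd R (TensorSpace r r v) (HC.T ((v : R) ^ 2) s)).comp (foldMap v f)
  have hD : ∀ m, D m = foldMap v f (HC.T ((v : R) ^ 2) s • m) -
    HC.T ((v : R) ^ 2) s • foldMap v f m := fun m => rfl
  have hDc : ∀ j : Fin r, ∃ j' : Fin r, ∀ m, D (HC.c ((v : R) ^ 2) j • m) = HC.c ((v : R) ^ 2) j' • D m := by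
    intro j
    by_cases h1 : j = s.lo
    · subst h1
      refine ⟨s.hi, fun m => ?_⟩
      rw [hD, hD, foldMap_c_smul, ← mul_smul, ← mul_smul, HC.T_c_lo, mul_smul, mul_smul,
        foldMap_c_smul, smul_sub]
    by_cases h2 : j = s.hi
    · subst h2
      refine ⟨s.lo, fun m => ?_⟩
      rw [hD, hD, foldMap_c_smul, ← mul_smul, ← mul_smul, HC.T_c_hi]
      simp only [sub_smul, smul_sub, mul_smul, algebraMap_smul, map_sub, map_smul, foldMap_c_smul]
      abel
    · refine ⟨j, fun m => ?_⟩
      rw [hD, hD, foldMap_c_smul, ← mul_smul, ← mul_smul, HC.T_c s j h1 h2, mul_smul, mul_smul,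
        foldMap_c_smul, smul_sub]
  have hzero : D = 0 := (TensorSpace.basis n r v).ext fun x => by
    rw [TensorSpace.basis_apply, LinearMap.zero_apply]
    refine TensorSpace.sign_induction (P := fun x => D (TensorSpace.e v x) = 0) x
      (fun x' h1 h2 => ?_) (fun x' j h => ?_)
    · rw [e_eq_eNeg h1, hD, foldMap_T_smul_eNeg hf, sub_self]
    · obtain ⟨a, ha⟩ := exists_smul_c_smul_e (v := v) j x'
      obtain ⟨j', hj'⟩ := hDc j
      rw [ha, map_smul, hj', h, smul_zero, smul_zero]
  exact sub_eq_zero.1 ((hD m).symm.trans (LinearMap.congr_fun hzero m))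

end

/-! ### The regular vector and faithfulness -/

section

variable {R : Type*} [CommRing R] {n r : ℕ} {v : Rˣ}

/-- The map `h ↦ e · h = τ(h) e` for the regular vector `e` with reversed absolute values
`0, …, r-1` and negative entries. -/
noncomputable def regMap (r : ℕ) (v : Rˣ) : HC r ((v : R) ^ 2) →ₗ[R] TensorSpace r r v where
  toFun h := (tau r _ h).unop • TensorSpace.eNeg v id
  map_add' h h' := by rw [map_add, MulOpposite.unop_add, add_smul]
  map_smul' a h := by rw [map_smul, MulOpposite.unop_smul, smul_assoc]; rfl

theorem regMap_apply (h : HC r ((v : R) ^ 2)) :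
    regMap r v h = (tau r _ h).unop • TensorSpace.eNeg v id := rfl

theorem regMap_mul (h h' : HC r ((v : R) ^ 2)) :
    regMap r v (h * h') = (tau r _ h').unop • regMap r v h := by
  rw [regMap_apply, regMap_apply, map_mul, MulOpposite.unop_mul, mul_smul]

theorem regMap_mul_T (h : HC r ((v : R) ^ 2)) (s : SIdx r) :
    regMap r v (h * HC.T _ s) =
      ((v : R) ^ 2 - 1) • regMap r v h - HC.T ((v : R) ^ 2) s • regMap r v h := by
  rw [regMap_mul, tau_T, add_smul, neg_smul, algebraMap_smul, neg_add_eq_sub]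

theorem regMap_mul_c (h : HC r ((v : R) ^ 2)) (j : Fin r) :
    regMap r v (h * HC.c _ j) = HC.c ((v : R) ^ 2) j • regMap r v h := by
  rw [regMap_mul, tau_c]

theorem regMap_one : regMap r v 1 = TensorSpace.eNeg v id := by
  rw [regMap_apply, map_one, MulOpposite.unop_one, one_smul]

/-- Each letter of a reduced word is a step up in length, and there (q-1) - T_s sends v^{ℓ(z)} e_z
to v^{ℓ(zs)} e_{zs}. In particular the choice of reduced word does not affect the image. -/
theorem regMap_word (l : List (SIdx r)) (w : Equiv.Perm (Fin r)) (h : IsReducedWord l w) :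
    regMap r v (l.map (HC.T _)).prod = (v : R) ^ invCard w • TensorSpace.eNeg v w := by
  induction l using List.reverseRecOn generalizing w with
  | nil =>
    obtain rfl : 1 = w := h.1
    rw [List.map_nil, List.prod_nil, regMap_one, Equiv.Perm.coe_one,
      invCard_eq_zero monotone_id, pow_zero, one_smul]
  | append_singleton l s ih =>
    obtain ⟨h1, h2⟩ := h.of_append
    have hw : w * simpleTransp s * simpleTransp s = w := by
      rw [mul_assoc, simpleTransp_mul_self, mul_one]
    rw [List.map_append, List.prod_append, List.map_singleton, List.prod_singleton, regMap_mul_T,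
      ih _ h1, T_smul_scaled_eNeg, if_pos h2, sub_sub_cancel, hw]

theorem regMap_Tw (w : Equiv.Perm (Fin r)) :
    regMap r v (HC.Tw _ w) = (v : R) ^ invCard w • TensorSpace.eNeg v w :=
  regMap_word _ _ (exists_reducedWord w).choose_spec

/-- The basis index with reversed absolute values `w` and signs given by `ε`. -/
def signedIndex (w : Equiv.Perm (Fin r)) (ε : Fin r → Bool) (k : Fin r) : Ix r :=
  if ε k then Sum.inl (w k).rev else Sum.inr (w k).rev

theorem revAbs_signedIndex (w : Equiv.Perm (Fin r)) (ε : Fin r → Bool) :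
    revAbs (signedIndex w ε) = w := by
  funext k
  simp only [revAbs, signedIndex]
  split_ifs <;> simp [Ix.abs]

theorem signedIndex_injective :
    Function.Injective fun i : Equiv.Perm (Fin r) × (Fin r → Bool) => signedIndex i.1 i.2 := by
  rintro ⟨w, ε⟩ ⟨w', ε'⟩ h
  simp only at h
  have h1 : w = w' := by
    apply DFunLike.coe_injective
    rw [← revAbs_signedIndex w ε, h, revAbs_signedIndex]
  have h2 : ε = ε' := by
    funext k
    have := congrFun h k
    simp only [signedIndex] at this
    cases hk : ε k <;> cases hk' : ε' k <;> simp [hk, hk'] at this ⊢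
  rw [h1, h2]

/-- The only sorted rearrangement of a permutation is the identity, that is, the regular vector
itself. -/
theorem e_signedIndex_mem_range (w : Equiv.Perm (Fin r)) (ε : Fin r → Bool) :
    TensorSpace.e v (signedIndex w ε) ∈ LinearMap.range (regMap r v) := by
  refine e_mem_of_generators (fun _ => LinearMap.range (regMap r v)) _ (fun w' hw' => ?_) ?_ ?_
  · rw [revAbs_signedIndex, ← Equiv.Perm.coe_mul] at hw' ⊢
    rw [perm_eq_one_of_monotone hw']
    exact ⟨1, regMap_one⟩
  · rintro _ _ ⟨h, rfl⟩ s
    exact ⟨((v : R) ^ 2 - 1) • h - h * HC.T _ s, by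
      rw [map_sub, map_smul, regMap_mul_T, sub_sub_cancel]⟩
  · rintro _ _ ⟨h, rfl⟩ j
    exact ⟨h * HC.c _ j, regMap_mul_c h j⟩

/-- A rank count valid over any commutative ring: N = r!·2^r elements span the source, N basis
vectors lie in the image, and a surjective endomorphism of Rᴺ is injective. The normal forms are
thereby also linearly independent. -/
theorem regMap_injective : Function.Injective (regMap r v) := by
  obtain ⟨g, hg⟩ := HC.spannedBy_top (r := r) (q := (v : R) ^ 2)
  let ι := Equiv.Perm (Fin r) × (Fin r → Bool)
  have hcard : Fintype.card ι = r.factorial * 2 ^ r := by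
    simp [ι, Fintype.card_perm]
  let eqv : ι ≃ Fin (r.factorial * 2 ^ r) := Fintype.equivFinOfCardEq hcard
  let coord : TensorSpace r r v →ₗ[R] (Fin (r.factorial * 2 ^ r) → R) :=
    LinearMap.pi fun i => (TensorSpace.basis r r v).coord
      (signedIndex (eqv.symm i).1 (eqv.symm i).2)
  -- Coefficients of a combination of the spanning elements go to the coordinates of its image at
  -- the signed permutations.
  let F : (Fin (r.factorial * 2 ^ r) → R) →ₗ[R] (Fin (r.factorial * 2 ^ r) → R) :=
    coord.comp ((regMap r v).comp (Fintype.linearCombination R g))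
  have hlin : Function.Surjective (Fintype.linearCombination R g) := by
    rw [← LinearMap.range_eq_top, Fintype.range_linearCombination, hg]
  have hF : Function.Surjective F := by
    rw [← LinearMap.range_eq_top, eq_top_iff, ← (Pi.basisFun R _).span_eq, Submodule.span_le]
    rintro _ ⟨i, rfl⟩
    obtain ⟨h, hh⟩ := e_signedIndex_mem_range (v := v) (eqv.symm i).1 (eqv.symm i).2
    obtain ⟨c, rfl⟩ := hlin h
    refine ⟨c, ?_⟩
    funext j
    simp only [F, LinearMap.comp_apply, hh, coord, LinearMap.pi_apply, Module.Basis.coord_apply,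
      TensorSpace.repr_e, Pi.basisFun_apply]
    rw [Finsupp.single_apply, Pi.single_apply]
    congr 1
    rw [eq_iff_iff, signedIndex_injective.eq_iff, eqv.symm.injective.eq_iff, eq_comm]
  have hinj := OrzechProperty.injective_of_surjective_endomorphism F hF
  rw [injective_iff_map_eq_zero]
  intro h hh
  obtain ⟨c, rfl⟩ := hlin h
  have : F c = F 0 := by
    rw [map_zero]
    change coord (regMap r v _) = 0
    rw [hh, map_zero]
  rw [hinj this, map_zero]

/-- The permutations fixing the block function form the Young subgroup, and a sorted vector has no
inversions, so the fibre sum carries no extra scalar. -/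
theorem regMap_xElt (l : Comp n r) :
    regMap r v (xElt _ l) = foldMap v l.index (TensorSpace.eNeg v l.index) := by
  rw [foldMap_eNeg, invCard_eq_zero l.index_monotone, pow_zero, one_smul, xElt, map_sum]
  simp only [regMap_Tw]
  exact Finset.sum_congr (by ext w; simp [mem_permFiber, l.mem_young]) fun _ _ => rfl

/-- Permuting positions preserves content, so the fibre summed over is empty. -/
theorem foldMap_index_eNeg_of_ne {l l' : Comp n r} (h : l ≠ l') :
    foldMap v l.index (TensorSpace.eNeg v l'.index) = 0 := by
  rw [foldMap_eNeg, Finset.sum_eq_zero, smul_zero]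
  intro z hz
  refine absurd ?_ h
  rw [← content_index l, ← content_index l', ← content_comp l.index z, mem_permFiber.1 hz]

/-- A target index determines z by its absolute values and the signs of x by its signs; then f∘z
determines the absolute values of x. So only one source coordinate contributes, with a power of v as
coefficient. -/
theorem repr_foldMap (f : Fin r → Fin n) (x : Fin r → Ix n) {z : Equiv.Perm (Fin r)}
    (hz : f ∘ z = revAbs x) (m : TensorSpace n r v) :
    (TensorSpace.basis r r v).repr (foldMap v f m) (fun k => (x k).relabel (z k).rev) =
      ((v⁻¹ : Rˣ) : R) ^ invCard (revAbs x) * (v : R) ^ invCard z *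
        (TensorSpace.basis n r v).repr m x := by
  have hinj : ∀ (x' : Fin r → Ix n) (z' : Equiv.Perm (Fin r)), f ∘ z' = revAbs x' →
      ((fun k => (x' k).relabel (z' k).rev) = fun k => (x k).relabel (z k).rev) →
      x' = x ∧ z' = z := by
    intro x' z' hz' h
    have h1 : z' = z := by
      ext k
      have := congrArg Ix.abs (congrFun h k)
      rw [Ix.abs_relabel, Ix.abs_relabel, Fin.rev_inj] at this
      rw [this]
    refine ⟨funext fun k => Ix.ext ?_ ?_, h1⟩
    · have := congrArg Ix.par (congrFun h k)
      rwa [Ix.par_relabel, Ix.par_relabel] at this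
    · rw [h1, hz] at hz'
      exact Fin.rev_injective (congrFun hz' k).symm
  let X : Fin r → Ix r := fun k => (x k).relabel (z k).rev
  have key : ((TensorSpace.basis r r v).coord X).comp (foldMap v f) =
      (((v⁻¹ : Rˣ) : R) ^ invCard (revAbs x) * (v : R) ^ invCard z) •
        (TensorSpace.basis n r v).coord x := by
    refine (TensorSpace.basis n r v).ext fun x' => ?_
    rw [TensorSpace.basis_apply, LinearMap.comp_apply, foldMap_e, map_smul, map_sum,
      LinearMap.smul_apply, Module.Basis.coord_apply, TensorSpace.repr_e]
    simp only [map_smul, Module.Basis.coord_apply, TensorSpace.repr_e, smul_eq_mul]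
    by_cases hx : x' = x
    · subst hx
      rw [Finset.sum_eq_single z, Finsupp.single_eq_same, Finsupp.single_eq_same]
      · ring
      · intro z' hz' hne
        rw [Finsupp.single_apply, if_neg, mul_zero]
        exact fun h => hne (hinj _ _ (mem_permFiber.1 hz') h).2
      · exact fun h => absurd (mem_permFiber.2 hz) h
    · rw [Finset.sum_eq_zero, Finsupp.single_apply, if_neg hx, mul_zero, mul_zero]
      intro z' hz'
      rw [Finsupp.single_apply, if_neg, mul_zero]
      exact fun h => hx (hinj _ _ (mem_permFiber.1 hz') h).1
  exact LinearMap.congr_fun key m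

/-- Choosing λ to be the content of x makes the fibre nonempty, and the coefficient is then a unit.
The restriction to target indices with the signs of x lets one statement serve both injectivity and
the detection of parity. -/
theorem repr_eq_zero_of_foldMap (m : TensorSpace n r v) (x : Fin r → Ix n)
    (h : ∀ l : Comp n r, ∀ X : Fin r → Ix r, (∀ k, (X k).par = (x k).par) →
      (TensorSpace.basis r r v).repr (foldMap v l.index m) X = 0) :
    (TensorSpace.basis n r v).repr m x = 0 := by
  obtain ⟨z, hz⟩ := exists_perm_index_comp (revAbs x)
  have h1 := h (content (revAbs x)) (fun k => (x k).relabel (z k).rev)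
    fun k => Ix.par_relabel _ _
  rw [repr_foldMap _ _ hz] at h1
  refine (IsUnit.mul_right_eq_zero ?_).1 h1
  exact ((v⁻¹).isUnit.pow _).mul (v.isUnit.pow _)

end

/-! ### Gradings -/

section Homog

variable {R : Type*} [CommRing R] {n r : ℕ} {v : Rˣ} {q : R}

theorem HC.gen_prod_mem_homog (l : List (HCGen r)) :
    (l.map (HC.gen r q)).prod ∈ HC.homog r q (l.map HCGen.par).sum :=
  Submodule.subset_span ⟨l, rfl, rfl⟩

theorem HC.mul_gen_mem_homog {p : ZMod 2} {h : HC r q} (hh : h ∈ HC.homog r q p) (g : HCGen r) :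
    h * HC.gen r q g ∈ HC.homog r q (p + g.par) := by
  suffices HC.homog r q p ≤
      (HC.homog r q (p + g.par)).comap (LinearMap.mulRight R (HC.gen r q g)) from this hh
  refine Submodule.span_le.2 ?_
  rintro _ ⟨l, rfl, rfl⟩
  have := HC.gen_prod_mem_homog (q := q) (l ++ [g])
  simpa using this

theorem HC.Tw_mem_homog (w : Equiv.Perm (Fin r)) : HC.Tw q w ∈ HC.homog r q 0 := by
  have := HC.gen_prod_mem_homog (q := q) ((exists_reducedWord w).choose.map HCGen.T)
  rw [List.map_map, List.map_map] at this
  have h0 : (((exists_reducedWord w).choose).map (HCGen.par ∘ HCGen.T)).sum = 0 :=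
    List.sum_eq_zero (by simp [HCGen.par])
  rw [h0] at this
  exact this

theorem xElt_mem_homog (l : Comp n r) : xElt q l ∈ HC.homog r q 0 :=
  Submodule.sum_mem _ fun w _ => HC.Tw_mem_homog w

theorem TensorSpace.homog_le {p : ZMod 2} {P : Submodule R (TensorSpace n r v)}
    (h : ∀ x : Fin r → Ix n, ∑ k, ((x k).par : ZMod 2) = p → TensorSpace.e v x ∈ P) :
    TensorSpace.homog n r v p ≤ P :=
  Submodule.span_le.2 (by rintro _ ⟨x, hx, rfl⟩; exact h x hx)

theorem TensorSpace.e_mem_homog {p : ZMod 2} {x : Fin r → Ix n}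
    (h : ∑ k, ((x k).par : ZMod 2) = p) : TensorSpace.e v x ∈ TensorSpace.homog n r v p :=
  Submodule.subset_span ⟨x, h, rfl⟩

theorem TensorSpace.mem_homog_iff {p : ZMod 2} {m : TensorSpace n r v} :
    m ∈ TensorSpace.homog n r v p ↔ ∀ x : Fin r → Ix n, ∑ k, ((x k).par : ZMod 2) ≠ p →
      (TensorSpace.basis n r v).repr m x = 0 := by
  constructor
  · intro hm x hx
    suffices TensorSpace.homog n r v p ≤
        LinearMap.ker ((TensorSpace.basis n r v).coord x) from this hm
    refine TensorSpace.homog_le fun x' hx' => ?_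
    rw [LinearMap.mem_ker, Module.Basis.coord_apply, TensorSpace.repr_e, Finsupp.single_apply,
      if_neg]
    rintro rfl
    exact hx hx'
  · intro h
    rw [← (TensorSpace.basis n r v).sum_repr m]
    refine Submodule.sum_mem _ fun x _ => ?_
    by_cases hx : ∑ k, ((x k).par : ZMod 2) = p
    · rw [TensorSpace.basis_apply]
      exact Submodule.smul_mem _ _ (TensorSpace.e_mem_homog hx)
    · rw [h x hx, zero_smul]; exact zero_mem _

theorem c_smul_mem_homog {p : ZMod 2} {m : TensorSpace n r v}
    (hm : m ∈ TensorSpace.homog n r v p) (j : Fin r) :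
    HC.c ((v : R) ^ 2) j • m ∈ TensorSpace.homog n r v (p + 1) := by
  suffices TensorSpace.homog n r v p ≤ (TensorSpace.homog n r v (p + 1)).comap
      (Module.toModuleEnd R (TensorSpace n r v) (HC.c ((v : R) ^ 2) j)) from this hm
  refine TensorSpace.homog_le fun x hx => ?_
  change HC.c ((v : R) ^ 2) j • TensorSpace.e v x ∈ TensorSpace.homog n r v (p + 1)
  rw [c_smul_e]
  refine Submodule.smul_mem _ _ (TensorSpace.e_mem_homog ?_)
  rw [← hx, sum_par_update_neg x j, add_assoc, show (1 : ZMod 2) + 1 = 0 by decide, add_zero]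

theorem eNeg_mem_homog (y : Fin r → Fin n) :
    TensorSpace.eNeg v y ∈ TensorSpace.homog n r v r :=
  TensorSpace.e_mem_homog (by simp [Ix.par])

/-- On negative vectors the formula for T_s settles it. A sign change is undone by moving T_s past
c_j, each resulting term having one Clifford factor. -/
theorem T_smul_mem_homog {p : ZMod 2} {m : TensorSpace n r v}
    (hm : m ∈ TensorSpace.homog n r v p) (s : SIdx r) :
    HC.T ((v : R) ^ 2) s • m ∈ TensorSpace.homog n r v p := by
  suffices TensorSpace.homog n r v p ≤ (TensorSpace.homog n r v p).comap
      (Module.toModuleEnd R (TensorSpace n r v) (HC.T ((v : R) ^ 2) s)) from this hm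
  refine TensorSpace.homog_le fun x hx => ?_
  change HC.T ((v : R) ^ 2) s • TensorSpace.e v x ∈ TensorSpace.homog n r v p
  subst hx
  refine TensorSpace.sign_induction (P := fun x => HC.T ((v : R) ^ 2) s • TensorSpace.e v x ∈
    TensorSpace.homog n r v (∑ k, ((x k).par : ZMod 2))) x (fun x' h1 _ => ?_) (fun x' j h => ?_)
  · have : ∑ k, ((x' k).par : ZMod 2) = r := by simp [h1]
    rw [this, e_eq_eNeg h1, T_smul_eNeg]
    split_ifs
    · exact neg_mem (eNeg_mem_homog _)
    · exact sub_mem (Submodule.smul_mem _ _ (eNeg_mem_homog _))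
        (Submodule.smul_mem _ _ (eNeg_mem_homog _))
    · exact neg_mem (Submodule.smul_mem _ _ (eNeg_mem_homog _))
  · obtain ⟨a, ha⟩ := exists_smul_c_smul_e (v := v) j x'
    rw [ha, smul_comm (HC.T ((v : R) ^ 2) s), sum_par_update_neg x' j, ← mul_smul]
    refine Submodule.smul_mem _ _ ?_
    have he := TensorSpace.e_mem_homog (v := v)
      (rfl : ∑ k, ((Function.update x' j (x' j).neg k).par : ZMod 2) = _)
    by_cases h1 : j = s.lo
    · rw [h1] at he h ⊢
      rw [HC.T_c_lo, mul_smul]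
      exact c_smul_mem_homog h _
    by_cases h2 : j = s.hi
    · rw [h2] at he h ⊢
      rw [HC.T_c_hi, sub_smul, mul_smul, mul_smul, algebraMap_smul,
        sub_smul (HC.c _ s.lo)]
      exact sub_mem (c_smul_mem_homog h _)
        (Submodule.smul_mem _ _ (sub_mem (c_smul_mem_homog he _) (c_smul_mem_homog he _)))
    · rw [HC.T_c s j h1 h2, mul_smul]
      exact c_smul_mem_homog h _

/-- The shift by r is the parity of the regular vector; each T_s then keeps the parity and each c_j
changes it. -/
theorem regMap_mem_homog {p : ZMod 2} {h : HC r ((v : R) ^ 2)} (hh : h ∈ HC.homog r _ p) :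
    regMap r v h ∈ TensorSpace.homog r r v (p + r) := by
  suffices HC.homog r _ p ≤ (TensorSpace.homog r r v (p + r)).comap (regMap r v) from this hh
  refine Submodule.span_le.2 ?_
  rintro _ ⟨l, rfl, rfl⟩
  change regMap r v _ ∈ TensorSpace.homog r r v _
  clear hh
  induction l using List.reverseRecOn with
  | nil => simpa [regMap_one] using eNeg_mem_homog id
  | append_singleton l g ih =>
    rw [List.map_append, List.map_append, List.prod_append, List.sum_append, List.map_singleton,
      List.map_singleton, List.prod_singleton, List.sum_singleton]
    rcases g with s | j
    · rw [show HC.gen r ((v : R) ^ 2) (HCGen.T s) = HC.T _ s from rfl, regMap_mul_T, HCGen.par,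
        add_zero]
      exact sub_mem (Submodule.smul_mem _ _ ih) (T_smul_mem_homog ih s)
    · rw [show HC.gen r ((v : R) ^ 2) (HCGen.c j) = HC.c _ j from rfl, regMap_mul_c, HCGen.par,
        add_right_comm]
      exact c_smul_mem_homog ih j

theorem mem_homog_of_foldMap {p : ZMod 2} {m : TensorSpace n r v}
    (h : ∀ l : Comp n r, foldMap v l.index m ∈ TensorSpace.homog r r v p) :
    m ∈ TensorSpace.homog n r v p := by
  refine TensorSpace.mem_homog_iff.2 fun x hx => repr_eq_zero_of_foldMap m x fun l X hX => ?_
  refine TensorSpace.mem_homog_iff.1 (h l) X ?_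
  simpa only [hX] using hx

end Homog

/-! ### The isomorphism and the induced maps on endomorphisms -/

section Theta

variable {R : Type*} [CommRing R] {n r : ℕ} {v : Rˣ}

/-- The identity map from `M` to `M^τ`. -/
def toTwist {q : R} {M : Type*} [AddCommGroup M] [Module R M] [Module (HC r q) M]
    [IsScalarTower R (HC r q) M] : M ≃ₗ[R] TauTwist r q M := LinearEquiv.refl R M

theorem op_smul_toTwist {q : R} {M : Type*} [AddCommGroup M] [Module R M] [Module (HC r q) M]
    [IsScalarTower R (HC r q) M] (h : HC r q) (m : M) :
    MulOpposite.op h • (toTwist m : TauTwist r q M) = toTwist ((tau r q h).unop • m) := rfl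

/-- All the maps `foldMap`, as a homomorphism of right modules. -/
noncomputable def foldHom (n r : ℕ) (v : Rˣ) :
    TauTwist r ((v : R) ^ 2) (TensorSpace n r v) →ₗ[(HC r ((v : R) ^ 2))ᵐᵒᵖ]
      (Comp n r → TauTwist r ((v : R) ^ 2) (TensorSpace r r v)) where
  toFun m l := foldMap v l.index m
  map_add' m m' := funext fun l => map_add (foldMap v l.index) m m'
  map_smul' h m := funext fun l => HC.map_smul_of_gen (foldMap v l.index)
    (foldMap_T_smul l.index_monotone) (foldMap_c_smul l.index) (tau r _ h.unop).unop m

/-- The map `regMap` on every summand of `⨁ x_λ H^c`, as a homomorphism of right modules. -/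
noncomputable def regHom (n r : ℕ) (v : Rˣ) :
    PermSum n r ((v : R) ^ 2) →ₗ[(HC r ((v : R) ^ 2))ᵐᵒᵖ]
      (Comp n r → TauTwist r ((v : R) ^ 2) (TensorSpace r r v)) where
  toFun x l := regMap r v (x l : HC r ((v : R) ^ 2))
  map_add' x y := funext fun l => by
    rw [DirectSum.add_apply, Submodule.coe_add, map_add]; rfl
  map_smul' h x := funext fun l => by
    rw [DirectSum.smul_apply, Submodule.coe_smul]
    exact regMap_mul _ _

theorem foldHom_toTwist (m : TensorSpace n r v) (l : Comp n r) :
    foldHom n r v (toTwist m) l = toTwist (foldMap v l.index m) := rfl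

theorem regHom_apply (x : PermSum n r ((v : R) ^ 2)) (l : Comp n r) :
    regHom n r v x l = toTwist (regMap r v (x l : HC r ((v : R) ^ 2))) := rfl

theorem foldHom_injective : Function.Injective (foldHom n r v) := by
  rw [injective_iff_map_eq_zero]
  intro m hm
  obtain ⟨m, rfl⟩ := toTwist.surjective m
  rw [LinearEquiv.map_eq_zero_iff]
  apply (TensorSpace.basis n r v).repr.injective
  rw [map_zero]
  ext x
  refine repr_eq_zero_of_foldMap m x fun l X _ => ?_
  have := congrFun hm l
  rw [foldHom_toTwist, Pi.zero_apply, LinearEquiv.map_eq_zero_iff] at this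
  rw [this, map_zero, Finsupp.zero_apply]

theorem regHom_injective : Function.Injective (regHom n r v) := by
  intro x y h
  refine DFinsupp.ext fun l => Subtype.ext (regMap_injective (congrFun h l))

/-- The generator of the summand `x_λ H^c`. -/
noncomputable def permGen (q : R) (l : Comp n r) : PermSum n r q :=
  DirectSum.lof (HC r q)ᵐᵒᵖ (Comp n r) (fun l => permModule q l) l
    ⟨xElt q l, Submodule.subset_span rfl⟩

/-- The bridge between the two embeddings: it matches x_λ with the sorted negative vector of content
λ, and both sides vanish in the components other than λ. -/
theorem regHom_permGen (l : Comp n r) :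
    regHom n r v (permGen _ l) = foldHom n r v (toTwist (TensorSpace.eNeg v l.index)) := by
  funext l'
  rw [foldHom_toTwist, regHom_apply]
  congr 1
  by_cases h : l' = l
  · subst h
    rw [permGen, DirectSum.lof_apply, regMap_xElt]
  · rw [foldMap_index_eNeg_of_ne h, permGen, DirectSum.lof_eq_of, DirectSum.of_eq_of_ne _ _ _ h,
      Submodule.coe_zero, map_zero]

/-- Each image is generated by the common elements of `regHom_permGen`: sorted negative vectors
generate the tensor power, and the x_λ generate the direct sum. -/
theorem range_foldHom : LinearMap.range (foldHom (R := R) n r v) =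
    LinearMap.range (regHom n r v) := by
  apply le_antisymm
  · rintro _ ⟨m, rfl⟩
    let G : Submodule R (TensorSpace n r v) :=
      ((LinearMap.range (regHom n r v)).restrictScalars R).comap
        ((foldHom n r v).restrictScalars R ∘ₗ toTwist.toLinearMap)
    have hG : ∀ m, m ∈ G ↔ foldHom n r v (toTwist m) ∈ LinearMap.range (regHom n r v) :=
      fun m => Iff.rfl
    have hop : ∀ (h : HC r ((v : R) ^ 2)) m, m ∈ G → (tau r _ h).unop • m ∈ G := by
      intro h m hm
      have := Submodule.smul_mem _ (MulOpposite.op h) ((hG m).1 hm)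
      rwa [← map_smul, op_smul_toTwist, ← hG] at this
    have htop : ∀ m : TensorSpace n r v, m ∈ G := by
      intro m
      suffices (⊤ : Submodule R (TensorSpace n r v)) ≤ G from this trivial
      rw [← (TensorSpace.basis n r v).span_eq, Submodule.span_le]
      rintro _ ⟨x, rfl⟩
      rw [TensorSpace.basis_apply]
      refine e_mem_of_generators (fun _ => G) x (fun w hw => ?_) (fun _ m hm s => ?_)
        (fun _ m hm j => ?_)
      -- A sorted vector is the block function of its own content, so it comes from the
      -- corresponding generator.
      · rw [← index_content hw]
        exact ⟨permGen _ _, regHom_permGen _⟩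
      · have := hop (HC.T _ s) m hm
        rw [tau_T, add_smul, neg_smul, algebraMap_smul] at this
        -- Stability is known for τ(T_s), and T_s = (q-1) - τ(T_s).
        have := sub_mem (G.smul_mem ((v : R) ^ 2 - 1) hm) this
        simpa using this
      · have := hop (HC.c _ j) m hm
        rwa [tau_c] at this
    exact htop m
  · rintro _ ⟨x, rfl⟩
    induction x using DirectSum.induction_on with
    | zero => rw [map_zero]; exact zero_mem _
    | of l y =>
      obtain ⟨y, hy⟩ := y
      obtain ⟨h, rfl⟩ := Submodule.mem_span_singleton.1 hy
      have : DirectSum.of (fun l => permModule ((v : R) ^ 2) l) l ⟨h • xElt _ l, hy⟩ =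
          h • permGen ((v : R) ^ 2) l := by
        rw [permGen, ← map_smul]; rfl
      rw [this, map_smul, regHom_permGen, ← map_smul]
      exact ⟨_, rfl⟩
    | add x y hx hy => rw [map_add]; exact add_mem hx hy

/-- The isomorphism `θ` from `(V^{⊗r})^τ` to `⨁ x_λ H^c`. -/
noncomputable def theta (n r : ℕ) (v : Rˣ) :
    TauTwist r ((v : R) ^ 2) (TensorSpace n r v) ≃ₗ[(HC r ((v : R) ^ 2))ᵐᵒᵖ]
      PermSum n r ((v : R) ^ 2) :=
  (LinearEquiv.ofInjective (foldHom n r v) foldHom_injective).trans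
    ((LinearEquiv.ofEq _ _ range_foldHom).trans
      (LinearEquiv.ofInjective (regHom n r v) regHom_injective).symm)

theorem regHom_theta (m : TauTwist r ((v : R) ^ 2) (TensorSpace n r v)) :
    regHom n r v (theta n r v m) = foldHom n r v m := by
  have h := congrArg Subtype.val ((LinearEquiv.ofInjective (regHom n r v)
    regHom_injective).apply_symm_apply (LinearEquiv.ofEq _ _ range_foldHom
      (LinearEquiv.ofInjective (foldHom n r v) foldHom_injective m)))
  exact h

theorem theta_eNeg_index (l : Comp n r) :
    theta n r v (toTwist (TensorSpace.eNeg v l.index)) = permGen _ l :=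
  regHom_injective ((regHom_theta _).trans (regHom_permGen l).symm)

theorem permGen_mem_homog (q : R) (l : Comp n r) : permGen q l ∈ PermSum.homog n r q 0 := by
  intro l'
  by_cases h : l' = l
  · subst h
    rw [permGen, DirectSum.lof_apply]
    exact xElt_mem_homog _
  · rw [permGen, DirectSum.lof_eq_of, DirectSum.of_eq_of_ne _ _ _ h]
    exact zero_mem _

theorem PermSum.op_gen_smul_mem_homog {q : R} {p : ZMod 2} {x : PermSum n r q}
    (hx : x ∈ PermSum.homog n r q p) (g : HCGen r) :
    MulOpposite.op (HC.gen r q g) • x ∈ PermSum.homog n r q (p + g.par) := by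
  intro l
  rw [DirectSum.smul_apply, Submodule.coe_smul]
  exact HC.mul_gen_mem_homog (hx l) g

/-- Sorted negative vectors have parity r and go to the even generators x_λ, in accordance with r +
r = 0 mod 2; the algebra generators change both parities equally. -/
theorem theta_mem_homog {p : ZMod 2} {m : TensorSpace n r v}
    (hm : m ∈ TensorSpace.homog n r v p) :
    theta n r v (toTwist m) ∈ PermSum.homog n r ((v : R) ^ 2) (p + r) := by
  let G : ZMod 2 → Submodule R (TensorSpace n r v) := fun p =>
    (PermSum.homog n r ((v : R) ^ 2) (p + r)).comap
      ((theta n r v).toLinearMap.restrictScalars R ∘ₗ toTwist.toLinearMap)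
  have hG : ∀ p m, m ∈ G p ↔
    theta n r v (toTwist m) ∈ PermSum.homog n r ((v : R) ^ 2) (p + r) := fun p m => Iff.rfl
  have hgen : ∀ p m, m ∈ G p → ∀ g,
      (tau r _ (HC.gen r ((v : R) ^ 2) g)).unop • m ∈ G (p + g.par) := by
    intro p m hm g
    have := PermSum.op_gen_smul_mem_homog ((hG p m).1 hm) g
    rwa [← map_smul, add_right_comm, op_smul_toTwist, ← hG] at this
  suffices TensorSpace.homog n r v p ≤ G p from this hm
  refine TensorSpace.homog_le fun x hx => ?_
  subst hx
  refine e_mem_of_generators G x (fun w hw => ?_) (fun p m hm s => ?_) (fun p m hm j => ?_)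
  · rw [← index_content hw, hG, theta_eNeg_index]
    have h2 : (r : ZMod 2) + r = 0 := CharTwo.add_self_eq_zero _
    rw [h2]
    exact permGen_mem_homog _ _
  · have := hgen p m hm (HCGen.T s)
    rw [show HC.gen r ((v : R) ^ 2) (HCGen.T s) = HC.T _ s from rfl, tau_T, add_smul, neg_smul,
      algebraMap_smul, HCGen.par, add_zero] at this
    have := sub_mem ((G p).smul_mem ((v : R) ^ 2 - 1) hm) this
    simpa using this
  · have := hgen p m hm (HCGen.c j)
    rwa [show HC.gen r ((v : R) ^ 2) (HCGen.c j) = HC.c _ j from rfl, tau_c] at this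

/-- For the converse, `regMap` shifts the components of the image by r once more, which restores p;
these are the folded vectors, and parity is detected after folding. -/
theorem mem_homog_iff_theta_mem_homog {p : ZMod 2} {m : TensorSpace n r v} :
    m ∈ TensorSpace.homog n r v p ↔
      theta n r v (toTwist m) ∈ PermSum.homog n r ((v : R) ^ 2) (p + r) := by
  refine ⟨theta_mem_homog, fun h => mem_homog_of_foldMap fun l => ?_⟩
  have h1 := congrFun (regHom_theta (toTwist m)) l
  rw [foldHom_toTwist, regHom_apply, toTwist.injective.eq_iff] at h1
  have h2 := regMap_mem_homog (h l)
  rw [add_assoc, CharTwo.add_self_eq_zero, add_zero] at h2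
  rwa [← h1]

/-- The identification of the endomorphisms of `M` with those of `M^τ`. -/
noncomputable def tauTwistEnd {q : R} (M : Type*) [AddCommGroup M] [Module R M]
    [Module (HC r q) M] [IsScalarTower R (HC r q) M] :
    Module.End (HC r q) M ≃ₐ[R] Module.End (HC r q)ᵐᵒᵖ (TauTwist r q M) where
  toFun f :=
    { toFun := f
      map_add' := f.map_add
      map_smul' := fun h m => f.map_smul (tau r q h.unop).unop m }
  invFun g :=
    { toFun := g
      map_add' := g.map_add
      map_smul' := fun h m => by
        -- Because τ is an involution, acting on the twisted module by τ(h) is acting on M by h.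
        have := g.map_smul (MulOpposite.op (tau r q h).unop) (toTwist m)
        rw [op_smul_toTwist, tau_tau] at this
        have h2 : (tau r q (tau r q h).unop).unop • toTwist.symm (g (toTwist m)) =
            h • toTwist.symm (g (toTwist m)) := by rw [tau_tau]
        exact this.trans h2 }
  left_inv _ := rfl
  right_inv _ := rfl
  map_mul' _ _ := rfl
  map_add' _ _ := rfl
  commutes' _ := rfl

/-- Conjugation applies the shift d once in each direction, so the degree of an endomorphism is
unchanged. -/
theorem isHomogMap_iff {M N : Type*} [AddCommGroup M] [Module R M] [AddCommGroup N] [Module R N]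
    {A : ZMod 2 → Submodule R M} {B : ZMod 2 → Submodule R N} {d : ZMod 2} (θ : M ≃ N)
    (hθ : ∀ p m, m ∈ A p ↔ θ m ∈ B (p + d)) (f : M → M) (p : ZMod 2) :
    IsHomogMap A A p f ↔ IsHomogMap B B p fun x => θ (f (θ.symm x)) := by
  constructor
  · intro h s x hx
    obtain ⟨m, rfl⟩ := θ.surjective x
    have := h (s - d) m ((hθ _ _).2 (by rwa [sub_add_cancel]))
    rw [hθ, add_right_comm, sub_add_cancel] at this
    simpa using this
  · intro h s m hm
    have := h (s + d) (θ m) ((hθ _ _).1 hm)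
    rw [hθ, add_right_comm]
    simpa using this

theorem exists_theta (n r : ℕ) (R : Type*) [CommRing R] (v : Rˣ) :
    ∃ θ : TauTwist r ((v : R) ^ 2) (TensorSpace n r v)
        ≃ₗ[(HC r ((v : R) ^ 2))ᵐᵒᵖ] PermSum n r ((v : R) ^ 2),
      (∀ (p : ZMod 2) (m : TensorSpace n r v), m ∈ TensorSpace.homog n r v p ↔
        θ m ∈ PermSum.homog n r ((v : R) ^ 2) (p + (r : ZMod 2))) ∧
      ∃ (Φ : TensorEnd n r v ≃ₐ[R]
          Module.End (HC r ((v : R) ^ 2))ᵐᵒᵖ (TauTwist r ((v : R) ^ 2) (TensorSpace n r v)))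
        (Φ' : Module.End (HC r ((v : R) ^ 2))ᵐᵒᵖ (TauTwist r ((v : R) ^ 2) (TensorSpace n r v)) ≃ₐ[R]
          QqSchurAlg n r ((v : R) ^ 2)),
        (∀ (f : TensorEnd n r v) (m : TensorSpace n r v), Φ f m = f m) ∧
        (∀ g x, Φ' g x = θ (g (θ.symm x))) ∧
        ∀ (f : TensorEnd n r v) (p : ZMod 2),
          IsHomogMap (TensorSpace.homog n r v) (TensorSpace.homog n r v) p f ↔
          IsHomogMap (PermSum.homog n r ((v : R) ^ 2)) (PermSum.homog n r ((v : R) ^ 2)) p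
            (Φ' (Φ f)) := by
  refine ⟨theta n r v, fun p m => mem_homog_iff_theta_mem_homog, tauTwistEnd _,
    (theta n r v).conjAlgEquiv R, fun f m => rfl, fun g x => rfl, fun f p => ?_⟩
  exact isHomogMap_iff (theta n r v).toEquiv (fun p m => mem_homog_iff_theta_mem_homog) f p

end Theta

end QqSchur

theorem mainTheorem4 (n r : ℕ) :
    (∀ (R : Type*) [CommRing R], ringChar R ≠ 2 → ∀ v : Rˣ,
      ∃ θ : QqSchur.TauTwist r ((v : R) ^ 2) (QqSchur.TensorSpace n r v)
          ≃ₗ[(QqSchur.HC r ((v : R) ^ 2))ᵐᵒᵖ] QqSchur.PermSum n r ((v : R) ^ 2),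
        (∀ (p : ZMod 2) (m : QqSchur.TensorSpace n r v),
          m ∈ QqSchur.TensorSpace.homog n r v p ↔
            θ m ∈ QqSchur.PermSum.homog n r ((v : R) ^ 2) (p + (r : ZMod 2))) ∧
        ∃ (Φ : QqSchur.TensorEnd n r v ≃ₐ[R]
            Module.End (QqSchur.HC r ((v : R) ^ 2))ᵐᵒᵖ
              (QqSchur.TauTwist r ((v : R) ^ 2) (QqSchur.TensorSpace n r v)))
          (Φ' : Module.End (QqSchur.HC r ((v : R) ^ 2))ᵐᵒᵖ
              (QqSchur.TauTwist r ((v : R) ^ 2) (QqSchur.TensorSpace n r v)) ≃ₐ[R]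
            QqSchur.QqSchurAlg n r ((v : R) ^ 2)),
          (∀ (f : QqSchur.TensorEnd n r v) (m : QqSchur.TensorSpace n r v), Φ f m = f m) ∧
          (∀ g x, Φ' g x = θ (g (θ.symm x))) ∧
          ∀ (f : QqSchur.TensorEnd n r v) (p : ZMod 2),
            QqSchur.IsHomogMap (QqSchur.TensorSpace.homog n r v)
              (QqSchur.TensorSpace.homog n r v) p f ↔
            QqSchur.IsHomogMap (QqSchur.PermSum.homog n r ((v : R) ^ 2))
              (QqSchur.PermSum.homog n r ((v : R) ^ 2)) p (Φ' (Φ f))) ∧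
    ∃ Φ : QqSchur.QuantumQueerSchur n r ≃ₐ[LaurentPolynomial ℤ]
        QqSchur.QqSchurAlg n r ((QqSchur.vGen : LaurentPolynomial ℤ) ^ 2),
      ∀ (f : QqSchur.QuantumQueerSchur n r) (p : ZMod 2),
        QqSchur.IsHomogMap (QqSchur.TensorSpace.homog n r QqSchur.vGen)
          (QqSchur.TensorSpace.homog n r QqSchur.vGen) p f ↔
        QqSchur.IsHomogMap (QqSchur.PermSum.homog n r _) (QqSchur.PermSum.homog n r _) p (Φ f) := by
  refine ⟨fun R _ _ v => QqSchur.exists_theta n r R v, ?_⟩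
  obtain ⟨_, _, Φ, Φ', _, _, h⟩ :=
    QqSchur.exists_theta n r (LaurentPolynomial ℤ) QqSchur.vGen
  exact ⟨Φ.trans Φ', h⟩
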